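/- Let $n\ge 3$, $\mathbb H=\{x\in\mathbb R^n:x_1>0\}$, $2^*=\frac{2n}{n-2}$, $2^\#=\frac{2(n-1)}{n-2}$, and let $T_E$ be the Escobar threshold, $T_E=\|W\|_{L^{2^\#}(\partial\mathbb H)}/\|W\|_{L^{2^*}(\mathbb H)}$ with $W(x)=|x+e_1|^{2-n}$. Let $T>0$, $T\ne T_E$, and let $$U(x)=C\,(|x-p|^2+c)^{-\frac{n-2}{2}},\qquad C>0,\ c\in\mathbb R,\ p\in\mathbb R^n,$$ be a bridge extremal with parameter $T$: $|x-p|^2+c>0$ on $\overline{\mathbb H}$, $\|U\|_{L^{2^*}(\mathbb H)}=1$ and $\|U\|_{L^{2^\#}(\partial\mathbb H)}=T$. Then $c\neq0$ (spherical branch $c>0$, hyperbolic branch $c<0$). Put $\eta=\operatorname{sgn} c$ and $\kappa=\eta/\alpha$ with $\alpha=\frac{C^{4/(n-2)}}{4|c|}$, so that $g_U=U^{4/(n-2)}|dx|^2$ has constant curvature $\kappa$. Let $B_\kappa(R)$ be the geodesic ball of radius $R>0$ ($R<\pi/\sqrt\kappa$ if $\kappa>0$) in the model space of curvature $\kappa$,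 with metric $g_\kappa=dr^2+s_\kappa(r)^2g_{\mathbb S^{n-1}}$, and let $F:(\mathbb H,g_U)\to(B_\kappa(R),g_\kappa)$ be the reduction isometry: the map $x\mapsto (x-p)/\sqrt{|c|}$, followed by inverse stereographic projection onto $\mathbb S^n$ (if $\eta=1$) or $\mathbb H^n$ (if $\eta=-1$), and by an orthogonal, respectively Lorentz, transformation that moves the image to the ball about the pole. Let $\sigma$ be the constant with $\partial_\nu U=-\sigma U^{2^\#-1}$ on $\partial\mathbb H$, $\nu=-e_1$, and let $\beta=-(2^\#-2)\sigma$. Such $R$, $F$, $\sigma$ exist, and for all such $R,F,\sigma$ the following holds. Let $$\mathcal Q(\phi)=\int_{B_\kappa(R)}|\nabla_{g_\kappa}\phi|^2\,dV_{g_\kappa}-n\kappa\int_{B_\kappa(R)}\phi^2\,dV_{g_\kappa}-\beta\int_{\partial B_\kappa(R)}\phi^2\,dS_{g_\kappa},$$ with associated symmetric bilinear form $\mathcal B$, and $$\mathcal H_0=\Big\{\phi\in H^1(B_\kappa(R)):\int_{B_\kappa(R)}\phi\,dV_{g_\kappa}=0,\ \int_{\partial B_\kappa(R)}\phi\,dS_{g_\kappa}=0\Big\}.$$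 Let $\ker(\mathcal Q|\mathcal H_0)=\{\phi\in\mathcal H_0:\mathcal B(\phi,\psi)=0\ \ \forall\psi\in\mathcal H_0\}$ and $$\phi_j=\frac{Z_j}{U}\circ F^{-1}\ \ (j=0,2,\dots,n),\qquad Z_0=\frac{n-2}{2}U+x\cdot\nabla U,\quad Z_i=\partial_{x_i}U\ \ (i=2,\dots,n).$$ Then $$\ker(\mathcal Q|\mathcal H_0)=\operatorname{span}\{\phi_0,\phi_2,\dots,\phi_n\}.$$ Moreover every $\phi$ in this kernel satisfies $\mathcal B(\phi,\psi)=0$ for all $\psi\in H^1(B_\kappa(R))$ (it is a weak solution of the Robin problem $-\Delta_{g_\kappa}\phi=n\kappa\phi$ in $B_\kappa(R)$, $\partial_\nu\phi=\beta\phi$ on $\partial B_\kappa(R)$); the $n$ functions $\phi_0,\phi_2,\dots,\phi_n$ are linearly independent, and each lies in the $\ell=1$ sector, i.e. has the form $f(r)Y(\theta)$ in geodesic polar coordinates with $Y$ a spherical harmonic of degree $1$. -/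

import Mathlib

open MeasureTheory Metric Set

noncomputable section

namespace BridgeKernel

/-! ### The half-space and the bridge extremals

The dimension is `n = m + 1`; the first coordinate `x₁` of `x ∈ ℝⁿ` is `x 0`. -/

/-- The open half-space `{x₁ > 0}` in `ℝⁿ`, `n = m + 1`. -/
def halfSpace (m : ℕ) : Set (EuclideanSpace ℝ (Fin (m + 1))) := {x | 0 < x 0}

/-- The boundary point `(0, x')` of the half-space. -/
def bdryPoint {m : ℕ} (x' : EuclideanSpace ℝ (Fin m)) : EuclideanSpace ℝ (Fin (m + 1)) :=
  WithLp.toLp 2 (Fin.cons (0 : ℝ) (fun i => x' i) : Fin (m + 1) → ℝ)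

/-- The critical exponent `2^* = 2n/(n-2)`. -/
def twoStar (n : ℕ) : ℝ := 2 * n / ((n : ℝ) - 2)

/-- The critical trace exponent `2^# = 2(n-1)/(n-2)`. -/
def twoSharp (n : ℕ) : ℝ := 2 * ((n : ℝ) - 1) / ((n : ℝ) - 2)

/-- `U(x) = C (|x - p|² + c)^{-(n-2)/2}`. Up to the action of tangential translations and critical
dilations, `c > 0` is the spherical profile `C (1 + |x - t e₁|²)^{-(n-2)/2}`, `c < 0` is the
hyperbolic profile `C (|x - t e₁|² - 1)^{-(n-2)/2}`, with `t = p₁ / √|c|`, and `c = 0` is the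
Escobar profile. -/
def profile {n : ℕ} (C c : ℝ) (p x : EuclideanSpace ℝ (Fin n)) : ℝ :=
  C * (‖x - p‖ ^ 2 + c) ^ (-((n : ℝ) - 2) / 2)

/-- `‖u‖_{L^{2^*}}` over the half-space. -/
def bulkNorm {m : ℕ} (u : EuclideanSpace ℝ (Fin (m + 1)) → ℝ) : ENNReal :=
  eLpNorm u (ENNReal.ofReal (twoStar (m + 1))) (volume.restrict (halfSpace m))

/-- `‖u‖_{L^{2^#}}` over the boundary of the half-space. -/
def bdryNorm {m : ℕ} (u : EuclideanSpace ℝ (Fin (m + 1)) → ℝ) : ENNReal :=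
  eLpNorm (fun x' : EuclideanSpace ℝ (Fin m) => u (bdryPoint x'))
    (ENNReal.ofReal (twoSharp (m + 1))) volume

/-- The Escobar threshold `T_E`: the boundary norm of the Escobar extremal `|x + e₁|^{2-n}`, after
normalization of its bulk norm to one. -/
def escobarThreshold (m : ℕ) : ℝ :=
  (bdryNorm (m := m) (profile 1 0 (-EuclideanSpace.single 0 1)) /
    bulkNorm (m := m) (profile 1 0 (-EuclideanSpace.single 0 1))).toReal

/-- `U = profile C c p` is a bridge extremal with parameter `T`: it is positive and regular on the
closed half-space, has bulk norm one and boundary norm `T`. -/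
structure IsBridgeExtremal {m : ℕ} (T C c : ℝ) (p : EuclideanSpace ℝ (Fin (m + 1))) : Prop where
  pos : 0 < C
  regular : ∀ x : EuclideanSpace ℝ (Fin (m + 1)), 0 ≤ x 0 → 0 < ‖x - p‖ ^ 2 + c
  bulk : bulkNorm (profile C c p) = 1
  bdry : bdryNorm (profile C c p) = ENNReal.ofReal T

/-- The boundary Euler-Lagrange equation `∂_ν U = -σ U^{2^# - 1}` on `{x₁ = 0}`, where `ν = -e₁`
is the outward unit normal. -/
def BoundaryEquation {m : ℕ} (U : EuclideanSpace ℝ (Fin (m + 1)) → ℝ) (σ : ℝ) : Prop :=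
  ∀ x : EuclideanSpace ℝ (Fin (m + 1)), x 0 = 0 →
    fderiv ℝ U x (-EuclideanSpace.single 0 1) = -σ * U x ^ (twoSharp (m + 1) - 1)

/-- The Jacobi fields. Index `0` is the dilation field `Z₀ = (n-2)/2 U + x · ∇U`; an index `i ≠ 0`
is the tangential translation field, the partial derivative of `U` in the direction of the
coordinate `x i` (that is, `Z_{i+1}` when coordinates are counted from `1`). -/
def jacobiField {m : ℕ} (U : EuclideanSpace ℝ (Fin (m + 1)) → ℝ) (j : Fin (m + 1))
    (x : EuclideanSpace ℝ (Fin (m + 1))) : ℝ :=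
  if j = 0 then (((m + 1 : ℕ) : ℝ) - 2) / 2 * U x + fderiv ℝ U x x
  else fderiv ℝ U x (EuclideanSpace.single j 1)

/-! ### The model ball in geodesic normal coordinates

The geodesic ball `B_κ(R)` is `{v ∈ ℝⁿ : |v| < R}`, `v = r θ`, with the metric
`g_κ = dr² + s_κ(r)² g_{S^{n-1}}`. -/

/-- `s_κ`. -/
def sn (κ r : ℝ) : ℝ :=
  if 0 < κ then Real.sin (√κ * r) / √κ
  else if κ < 0 then Real.sinh (√(-κ) * r) / √(-κ)
  else r

/-- `c_κ = s_κ'`. -/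
def cs (κ r : ℝ) : ℝ :=
  if 0 < κ then Real.cos (√κ * r)
  else if κ < 0 then Real.cosh (√(-κ) * r)
  else 1

/-- The Riemannian volume of `g_κ` on `B_κ(R)`: `s_κ(r)^{n-1} dr dθ = (s_κ(r)/r)^{n-1} dv`. -/
def modelVol (n : ℕ) (κ R : ℝ) : Measure (EuclideanSpace ℝ (Fin n)) :=
  (volume.restrict (ball 0 R)).withDensity
    (fun v => ENNReal.ofReal ((sn κ ‖v‖ / ‖v‖) ^ (n - 1)))

/-- The Riemannian area of `g_κ` on `∂B_κ(R)`, which is parametrized by the unit sphere through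
`θ ↦ R θ`: it is `s_κ(R)^{n-1} dθ`. -/
def modelArea (n : ℕ) (κ R : ℝ) : Measure (sphere (0 : EuclideanSpace ℝ (Fin n)) 1) :=
  ENNReal.ofReal (sn κ R ^ (n - 1)) •
    (volume : Measure (EuclideanSpace ℝ (Fin n))).toSphere

/-- The inner product of `g_κ` on covectors at `v = r θ`, in coordinates: if `a`, `b` are the
Euclidean gradients of `φ`, `ψ` at `v`, this is `⟨∇_{g_κ} φ, ∇_{g_κ} ψ⟩_{g_κ}`, that is,
`∂_r φ ∂_r ψ + s_κ(r)^{-2} ⟨∇_θ φ, ∇_θ ψ⟩`. -/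
def modelInner {n : ℕ} (κ : ℝ) (v a b : EuclideanSpace ℝ (Fin n)) : ℝ :=
  inner ℝ a (‖v‖⁻¹ • v) * inner ℝ b (‖v‖⁻¹ • v) +
    (‖v‖ / sn κ ‖v‖) ^ 2 *
      (inner ℝ a b - inner ℝ a (‖v‖⁻¹ • v) * inner ℝ b (‖v‖⁻¹ • v))

/-- The Euclidean divergence of a vector field. -/
def divergence {n : ℕ} (X : EuclideanSpace ℝ (Fin n) → EuclideanSpace ℝ (Fin n))
    (v : EuclideanSpace ℝ (Fin n)) : ℝ :=
  ∑ i, fderiv ℝ X v (EuclideanSpace.single i 1) i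

/-- An element of `H¹(B_κ(R))`: a square integrable function together with its weak gradient (in
coordinates) and its boundary trace, both square integrable. Green's formula against the fields
with compact support in the ball says that `grad` is the weak gradient, and against the other
fields that `trace` is the boundary trace. -/
structure ModelH1 (n : ℕ) (κ R : ℝ) where
  fn : EuclideanSpace ℝ (Fin n) → ℝ
  grad : EuclideanSpace ℝ (Fin n) → EuclideanSpace ℝ (Fin n)
  trace : sphere (0 : EuclideanSpace ℝ (Fin n)) 1 → ℝ
  memLp_fn : MemLp fn 2 (modelVol n κ R)
  memLp_grad : MemLp grad 2 (modelVol n κ R)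
  memLp_trace : MemLp trace 2 (modelArea n κ R)
  green : ∀ X : EuclideanSpace ℝ (Fin n) → EuclideanSpace ℝ (Fin n), ContDiff ℝ 1 X →
    ∫ v in ball (0 : EuclideanSpace ℝ (Fin n)) R,
        (fn v * divergence X v + inner ℝ (grad v) (X v)) =
      R ^ (n - 1) * ∫ θ : sphere (0 : EuclideanSpace ℝ (Fin n)) 1,
        trace θ * inner ℝ (X (R • (θ : EuclideanSpace ℝ (Fin n)))) (θ : EuclideanSpace ℝ (Fin n))
          ∂(volume : Measure (EuclideanSpace ℝ (Fin n))).toSphere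

/-- The space `H₀`: zero volume mean and zero boundary mean. -/
def ModelH1.MeanZero {n : ℕ} {κ R : ℝ} (φ : ModelH1 n κ R) : Prop :=
  ∫ v, φ.fn v ∂(modelVol n κ R) = 0 ∧ ∫ θ, φ.trace θ ∂(modelArea n κ R) = 0

/-- The symmetric bilinear form of the reduced Robin quadratic form
`Q(φ) = ∫ |∇φ|² dV - n κ ∫ φ² dV - β ∫ φ² dS`. -/
def robinForm {n : ℕ} {κ R : ℝ} (β : ℝ) (φ ψ : ModelH1 n κ R) : ℝ :=
  ∫ v, modelInner κ v (φ.grad v) (ψ.grad v) ∂(modelVol n κ R)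
    - n * κ * ∫ v, φ.fn v * ψ.fn v ∂(modelVol n κ R)
    - β * ∫ θ, φ.trace θ * ψ.trace θ ∂(modelArea n κ R)

/-- The kernel of the form restricted to `H₀`. -/
def robinKernel (n : ℕ) (κ R β : ℝ) : Set (ModelH1 n κ R) :=
  {φ | φ.MeanZero ∧ ∀ ψ : ModelH1 n κ R, ψ.MeanZero → robinForm β φ ψ = 0}

/-- `f` lies in the `ℓ`-th angular sector on the ball: it is `f(r) Y(θ)` with a spherical
harmonic `Y` of degree `ℓ`, the restriction of a harmonic homogeneous polynomial. -/
def InSector {n : ℕ} (ℓ : ℕ) (R : ℝ) (φ : EuclideanSpace ℝ (Fin n) → ℝ) : Prop :=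
  ∃ (f : ℝ → ℝ) (P : MvPolynomial (Fin n) ℝ), P.IsHomogeneous ℓ ∧
    ∑ i, MvPolynomial.pderiv i (MvPolynomial.pderiv i P) = 0 ∧
    ∀ v ∈ ball (0 : EuclideanSpace ℝ (Fin n)) R, v ≠ 0 →
      φ v = f ‖v‖ * MvPolynomial.eval (fun i => (‖v‖⁻¹ • v) i) P

/-! ### The reduction map -/

/-- The point of the unit model quadric with geodesic normal coordinates `v` for the metric of
curvature `κ`: `(sin(√κ r) θ, cos(√κ r))` on `Sⁿ`, `(sinh(√(-κ) r) θ, cosh(√(-κ) r))` on `Hⁿ`. -/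
def modelPoint {n : ℕ} (κ : ℝ) (v : EuclideanSpace ℝ (Fin n)) : EuclideanSpace ℝ (Fin n) × ℝ :=
  ((√|κ| * sn κ ‖v‖) • (‖v‖⁻¹ • v), cs κ ‖v‖)

/-- Inverse stereographic projection onto `Sⁿ` (`η = 1`), and onto `Hⁿ` from `|y| > 1`
(`η = -1`). -/
def invStereo {n : ℕ} (η : ℝ) (y : EuclideanSpace ℝ (Fin n)) : EuclideanSpace ℝ (Fin n) × ℝ :=
  ((2 / (‖y‖ ^ 2 + η)) • y, (‖y‖ ^ 2 - η) / (‖y‖ ^ 2 + η))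

/-- The quadratic form `s² + η |X|²` on `ℝⁿ⁺¹`. Its unit level is `Sⁿ` for `η = 1` and contains
`Hⁿ` as the sheet `s > 0` for `η = -1`. -/
def quadric {n : ℕ} (η : ℝ) (X : EuclideanSpace ℝ (Fin n) × ℝ) : ℝ :=
  X.2 ^ 2 + η * ‖X.1‖ ^ 2

/-- `κ = η / α` with `η` the sign of `c` and `α = C^{4/(n-2)} / (4 |c|)`: the curvature of
`g_U = U^{4/(n-2)} |dx|²` for `U = profile C c p`. -/
def profileCurvature (n : ℕ) (C c : ℝ) : ℝ :=
  Real.sign c / (C ^ (4 / ((n : ℝ) - 2)) / (4 * |c|))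

/-- `F` is a reduction map of the half-space with the metric `g_U` onto the model ball `B_κ(R)`:
inverse stereographic projection of the recentred and rescaled variable, followed by an orthogonal
(respectively Lorentz) transformation `O` which moves the image to the geodesic ball of radius `R`
(in the metric `g_κ`) about the pole, read in normal coordinates. -/
structure IsReductionMap {m : ℕ} (C c : ℝ) (p : EuclideanSpace ℝ (Fin (m + 1))) (R : ℝ)
    (F : EuclideanSpace ℝ (Fin (m + 1)) → EuclideanSpace ℝ (Fin (m + 1))) : Prop where
  radius_pos : 0 < R
  radius_lt : 0 < profileCurvature (m + 1) C c → √(profileCurvature (m + 1) C c) * R < Real.pi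
  bij : BijOn F (halfSpace m) (ball 0 R)
  formula : ∃ O : (EuclideanSpace ℝ (Fin (m + 1)) × ℝ) →ₗ[ℝ] (EuclideanSpace ℝ (Fin (m + 1)) × ℝ),
    (∀ X, quadric (Real.sign c) (O X) = quadric (Real.sign c) X) ∧
    ∀ x ∈ halfSpace m, modelPoint (profileCurvature (m + 1) C c) (F x) =
      O (invStereo (Real.sign c) ((√|c|)⁻¹ • (x - p)))

/-- The reduced Jacobi fields `φ_j = (Z_j / U) ∘ F⁻¹`. -/
def reducedField {m : ℕ} (U : EuclideanSpace ℝ (Fin (m + 1)) → ℝ)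
    (F : EuclideanSpace ℝ (Fin (m + 1)) → EuclideanSpace ℝ (Fin (m + 1))) (j : Fin (m + 1))
    (v : EuclideanSpace ℝ (Fin (m + 1))) : ℝ :=
  jacobiField U j (Function.invFunOn F (halfSpace m) v) / U (Function.invFunOn F (halfSpace m) v)

end BridgeKernel

end

/-! The theorem rests on one identity, β s_κ(R) = c_κ(R) (`IsReductionMap.beta_mul_sn`). It says
that the functions s_κ(r)⟨ω, θ⟩, which are linear functions restricted to the model quadric, satisfy
the Robin condition as well as Δφ + nκφ = 0. They form an n-dimensional space. It remains to see
that the kernel contains nothing else and that the reduced Jacobi fields are a basis of this space.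

The two mean constraints produce no Lagrange multipliers. The form paired with 1 and with c_κ
involves only the two means, and 1 and c_κ span a complement of H₀; so a kernel element on H₀
annihilates all of H¹ (`robinForm_eq_zero_of_mem_robinKernel`).

No regularity theory or separation of variables is applied to such a weak solution φ. It is tested
against f(c_κ)(s_κ⟨ω, θ⟩)^ℓ. The result (`sector_relation`) links a boundary moment, the moment of a
hypergeometric operator applied to f, and a moment of degree ℓ - 2. In the variable x = (1 - c_κ)/2
that operator has parameters a = ℓ - 1, b = ℓ + n, c = n/2 + ℓ. Applied to Euler's integrand τ^(a-1)
(1-τ)^(c-a-1) (1-τx)^(-b) it gives a τ-derivative, that of -b τ^a (1-τ)^(c-a) (1-τx)^(-b-1)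
(`hasDerivAt_hypFlux`). Two consequences follow.

If the boundary moment and the lower moment vanish, the flux is constant in τ and zero at τ = 1. Its
expansion at τ = 0 gives the low moments, and a recursion on powers of c_κ gives the others
(`ModelH1.moment_pow_eq_zero`).

For degree at least 2 the boundary moment is forced to vanish. Rolle's theorem in τ selects a test
function for which the weak relation and a one-dimensional Wronskian identity (`flux_identity`) can
be subtracted, leaving the boundary moment times a positive integral
(`ModelH1.traceMoment_eq_zero`).

After subtraction of the s_κ⟨ω₀, θ⟩ with the same first boundary moment, induction in steps of two
kills all moments. Stone–Weierstrass for the exponentials exp(λ c_κ + s_κ⟨ω, θ⟩) then gives φ =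
s_κ⟨ω₀, θ⟩ (`ModelH1.fn_ae_eq_zero`, `ModelH1.exists_fn_ae_eq_linField`).

On the geometric side, Z_j / U is a linear form in the stereographic coordinates
(`jacobiField_div_profile`). Any admissible O takes one fixed vector, the centre of the image cap,
to the pole (`IsReductionMap.snd_eq`), and every Jacobi form vanishes at that vector. After O each
form therefore depends only on the X-component, and the n forms are independent
(`IsReductionMap.exists_reducedField_eq`). Finally c = 0 is excluded because all Escobar profiles
differ by a translation, a dilation and a factor, none of which changes the ratio of the critical
norms. -/

noncomputable section

namespace BridgeKernel

/-! ### Polar coordinates and the divergence theorem on a ball -/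

open Filter Topology in
/-- Averages of a continuous function over intervals shrinking to their right end point. -/
theorem tendsto_average_left {K : ℝ → ℝ} (hK : Continuous K) (R : ℝ) :
    Tendsto (fun ε : ℝ => ε⁻¹ * ∫ r in (R - ε)..R, K r) (𝓝[>] 0) (𝓝 (K R)) := by
  have h : HasDerivAt (fun u => ∫ r in R..u, K r) (K R) R :=
    intervalIntegral.integral_hasDerivAt_right (hK.intervalIntegrable _ _)
      (hK.stronglyMeasurableAtFilter _ _) hK.continuousAt
  have h2 := hasDerivAt_iff_tendsto_slope_zero.1 h
  have h3 : Tendsto (fun ε : ℝ => -ε) (𝓝[>] 0) (𝓝[≠] 0) := by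
    refine tendsto_nhdsWithin_iff.2 ⟨?_, ?_⟩
    · exact (by simpa using (continuous_neg.tendsto (0 : ℝ)) :
        Tendsto (fun ε : ℝ => -ε) (𝓝 0) (𝓝 0)).mono_left nhdsWithin_le_nhds
    · filter_upwards [self_mem_nhdsWithin] with ε hε
      simpa using (ne_of_gt hε)
  refine (h2.comp h3).congr fun ε => ?_
  simp only [Function.comp, intervalIntegral.integral_same, sub_zero, smul_eq_mul]
  rw [← sub_eq_add_neg, intervalIntegral.integral_symm (R - ε) R, inv_neg]
  ring

/-- Integration in polar coordinates. -/
theorem integral_polar {n : ℕ} (hn : 0 < n) {F : EuclideanSpace ℝ (Fin n) → ℝ}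
    (hF : Integrable F) :
    ∫ v, F v = ∫ r in Ioi (0 : ℝ), r ^ (n - 1) *
      ∫ θ : sphere (0 : EuclideanSpace ℝ (Fin n)) 1, F (r • (θ : EuclideanSpace ℝ (Fin n)))
        ∂(volume : Measure (EuclideanSpace ℝ (Fin n))).toSphere := by
  set μ : Measure (EuclideanSpace ℝ (Fin n)) := volume with hμ
  have : Nonempty (Fin n) := ⟨⟨0, hn⟩⟩
  have hmp := μ.measurePreserving_homeomorphUnitSphereProd
  have hdim : Module.finrank ℝ (EuclideanSpace ℝ (Fin n)) = n := by simp
  rw [hdim] at hmp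
  let G : sphere (0 : EuclideanSpace ℝ (Fin n)) 1 × Ioi (0 : ℝ) → ℝ :=
    fun q => F ((q.2 : ℝ) • (q.1 : EuclideanSpace ℝ (Fin n)))
  have hG : ∀ x : ({0}ᶜ : Set (EuclideanSpace ℝ (Fin n))),
      G (homeomorphUnitSphereProd _ x) = F x := by
    intro x
    have hx : ‖(x : EuclideanSpace ℝ (Fin n))‖ ≠ 0 := norm_ne_zero_iff.2 x.2
    simp [G, smul_smul, hx]
  have hemb := (homeomorphUnitSphereProd (EuclideanSpace ℝ (Fin n))).measurableEmbedding
  have hint : Integrable G (μ.toSphere.prod (Measure.volumeIoiPow (n - 1))) := by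
    rw [← hmp.integrable_comp_emb hemb]
    have : Integrable (fun x : ({0}ᶜ : Set (EuclideanSpace ℝ (Fin n))) => F x)
        (μ.comap (↑)) := by
      have := (integrableOn_iff_comap_subtypeVal (μ := μ) (f := F)
        (measurableSet_singleton (0 : EuclideanSpace ℝ (Fin n))).compl).1 hF.integrableOn
      exact this
    refine this.congr (Filter.Eventually.of_forall fun x => ?_)
    exact (hG x).symm
  calc
    ∫ v, F v ∂μ = ∫ x : ({(0)}ᶜ : Set (EuclideanSpace ℝ (Fin n))), F x ∂(μ.comap (↑)) := by
      rw [integral_subtype_comap (measurableSet_singleton _).compl F, restrict_compl_singleton]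
    _ = ∫ q, G q ∂(μ.toSphere.prod (Measure.volumeIoiPow (n - 1))) := by
      rw [← hmp.integral_comp hemb]
      exact integral_congr_ae (Filter.Eventually.of_forall fun x => (hG x).symm)
    _ = ∫ r : Ioi (0 : ℝ), ∫ θ, G (θ, r) ∂μ.toSphere ∂(Measure.volumeIoiPow (n - 1)) :=
      integral_prod_symm _ hint
    _ = _ := by
      simp only [Measure.volumeIoiPow, ENNReal.ofReal]
      rw [integral_withDensity_eq_integral_smul,
        integral_subtype_comap measurableSet_Ioi fun a : ℝ => Real.toNNReal (a ^ (n - 1)) •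
          ∫ θ : sphere (0 : EuclideanSpace ℝ (Fin n)) 1,
            F (a • (θ : EuclideanSpace ℝ (Fin n))) ∂μ.toSphere]
      · refine setIntegral_congr_fun measurableSet_Ioi fun x hx => ?_
        rw [NNReal.smul_def, Real.coe_toNNReal _ (pow_nonneg (le_of_lt hx) _), smul_eq_mul]
      · exact (measurable_subtype_coe.pow_const _).real_toNNReal

/-- The mean of a continuous function over the spheres about the origin is continuous. -/
theorem continuous_integral_sphere {n : ℕ}
    {F : ℝ → sphere (0 : EuclideanSpace ℝ (Fin n)) 1 → ℝ} (hF : Continuous (Function.uncurry F)) :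
    Continuous fun r : ℝ => ∫ θ, F r θ ∂(volume : Measure (EuclideanSpace ℝ (Fin n))).toSphere := by
  have := continuous_parametric_integral_of_continuous
    (μ := (volume : Measure (EuclideanSpace ℝ (Fin n))).toSphere) hF
    (isCompact_univ (X := sphere (0 : EuclideanSpace ℝ (Fin n)) 1))
  simpa using this

/-- Integration over a spherical shell in polar coordinates. -/
theorem integral_shell {n : ℕ} (hn : 0 < n) {a b : ℝ} {F : EuclideanSpace ℝ (Fin n) → ℝ}
    (hF : IntegrableOn F {v | ‖v‖ ∈ Ioc a b}) (ha : 0 ≤ a) (hab : a ≤ b) :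
    ∫ v in {v : EuclideanSpace ℝ (Fin n) | ‖v‖ ∈ Ioc a b}, F v = ∫ r in a..b, r ^ (n - 1) *
      ∫ θ : sphere (0 : EuclideanSpace ℝ (Fin n)) 1, F (r • (θ : EuclideanSpace ℝ (Fin n)))
        ∂(volume : Measure (EuclideanSpace ℝ (Fin n))).toSphere := by
  have hms : MeasurableSet {v : EuclideanSpace ℝ (Fin n) | ‖v‖ ∈ Ioc a b} :=
    measurable_norm measurableSet_Ioc
  rw [← integral_indicator hms, integral_polar hn (hF.integrable_indicator hms),
    intervalIntegral.integral_of_le hab, ← integral_indicator measurableSet_Ioi,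
    ← integral_indicator measurableSet_Ioc]
  congr 1
  ext r
  by_cases hr : 0 < r
  · have h1 : ∀ θ : sphere (0 : EuclideanSpace ℝ (Fin n)) 1,
        ‖r • (θ : EuclideanSpace ℝ (Fin n))‖ = r := by
      intro θ; rw [norm_smul]; simp [abs_of_pos hr]
    by_cases hr2 : r ∈ Ioc a b
    · simp [indicator, hr, hr2, h1]
      left
      simp [hr2.1, hr2.2]
    · rw [indicator_of_notMem hr2]
      have : ∀ θ : sphere (0 : EuclideanSpace ℝ (Fin n)) 1,
          indicator {v : EuclideanSpace ℝ (Fin n) | ‖v‖ ∈ Ioc a b} F (r • θ) = 0 := by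
        intro θ
        refine indicator_of_notMem ?_ _
        simp only [mem_ofPred_eq, h1]
        exact hr2
      simp only [this, integral_zero, mul_zero, indicator_of_mem (show r ∈ Ioi 0 from hr)]
  · rw [indicator_of_notMem (by exact hr), indicator_of_notMem]
    rintro ⟨h, -⟩
    exact hr (lt_of_le_of_lt ha h)

theorem hasFDerivAt_norm_of_ne_zero {n : ℕ} {v : EuclideanSpace ℝ (Fin n)} (hv : v ≠ 0) :
    HasFDerivAt (fun v : EuclideanSpace ℝ (Fin n) => ‖v‖) (‖v‖⁻¹ • innerSL ℝ v) v := by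
  have hv' : ‖v‖ ≠ 0 := norm_ne_zero_iff.2 hv
  have h := (hasFDerivAt_id v).norm_sq.sqrt (by simpa using hv)
  simp only [id, Real.sqrt_sq (norm_nonneg _)] at h
  refine h.congr_fderiv ?_
  ext w
  simp
  field_simp

/-- The piecewise linear radial cutoff, equal to one on the ball of radius `R - ε` and to zero
outside the ball of radius `R`. -/
def radialCutoff (n : ℕ) (R ε : ℝ) (v : EuclideanSpace ℝ (Fin n)) : ℝ :=
  max 0 (min 1 (ε⁻¹ * (R - ‖v‖)))

theorem radialCutoff_of_le {n : ℕ} {R ε : ℝ} (hε : 0 < ε) {v : EuclideanSpace ℝ (Fin n)}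
    (hv : ‖v‖ ≤ R - ε) : radialCutoff n R ε v = 1 := by
  have : 1 ≤ ε⁻¹ * (R - ‖v‖) := by
    rw [inv_mul_eq_div, le_div_iff₀ hε]; linarith
  rw [radialCutoff, min_eq_left this, max_eq_right zero_le_one]

theorem radialCutoff_of_ge {n : ℕ} {R ε : ℝ} (hε : 0 < ε) {v : EuclideanSpace ℝ (Fin n)}
    (hv : R ≤ ‖v‖) : radialCutoff n R ε v = 0 := by
  have : ε⁻¹ * (R - ‖v‖) ≤ 0 := mul_nonpos_of_nonneg_of_nonpos (by positivity) (by linarith)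
  rw [radialCutoff, max_eq_left ((min_le_right _ _).trans this)]

theorem radialCutoff_of_mem {n : ℕ} {R ε : ℝ} (hε : 0 < ε) {v : EuclideanSpace ℝ (Fin n)}
    (hv : R - ε ≤ ‖v‖) (hv' : ‖v‖ ≤ R) : radialCutoff n R ε v = ε⁻¹ * (R - ‖v‖) := by
  have h1 : ε⁻¹ * (R - ‖v‖) ≤ 1 := by
    rw [inv_mul_eq_div, div_le_iff₀ hε]; linarith
  have h2 : 0 ≤ ε⁻¹ * (R - ‖v‖) := mul_nonneg (by positivity) (by linarith)
  rw [radialCutoff, min_eq_right h1, max_eq_right h2]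

theorem radialCutoff_mem_Icc (n : ℕ) (R ε : ℝ) (v : EuclideanSpace ℝ (Fin n)) :
    radialCutoff n R ε v ∈ Icc (0 : ℝ) 1 :=
  ⟨le_max_left _ _, max_le zero_le_one (min_le_left _ _)⟩

theorem lipschitzWith_radialCutoff (n : ℕ) (R : ℝ) {ε : ℝ} (hε : 0 < ε) :
    LipschitzWith (ε⁻¹).toNNReal (radialCutoff n R ε) := by
  have : LipschitzWith (ε⁻¹).toNNReal
      (fun v : EuclideanSpace ℝ (Fin n) => ε⁻¹ * (R - ‖v‖)) := by
    refine LipschitzWith.of_dist_le_mul fun v w => ?_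
    rw [Real.dist_eq, ← mul_sub, abs_mul, abs_of_pos (inv_pos.2 hε),
      Real.coe_toNNReal _ (inv_pos.2 hε).le]
    refine mul_le_mul_of_nonneg_left ?_ (inv_pos.2 hε).le
    rw [dist_eq_norm, show R - ‖v‖ - (R - ‖w‖) = -(‖v‖ - ‖w‖) by ring, abs_neg]
    exact abs_norm_sub_norm_le v w
  exact (this.const_min 1).const_max 0

/-- The two excluded spheres, where the cutoff has a corner, are null sets, so this determines the
derivative almost everywhere. -/
theorem lineDeriv_radialCutoff {n : ℕ} {R ε : ℝ} (hε : 0 < ε) (hεR : ε < R)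
    {v : EuclideanSpace ℝ (Fin n)} (h1 : ‖v‖ ≠ R) (h2 : ‖v‖ ≠ R - ε)
    (w : EuclideanSpace ℝ (Fin n)) :
    lineDeriv ℝ (radialCutoff n R ε) v w =
      {v : EuclideanSpace ℝ (Fin n) | ‖v‖ ∈ Ioc (R - ε) R}.indicator
        (fun v => -(ε⁻¹ * inner ℝ (‖v‖⁻¹ • v) w)) v := by
  have hcont : ContinuousAt (fun v : EuclideanSpace ℝ (Fin n) => ‖v‖) v :=
    continuous_norm.continuousAt
  rcases lt_or_gt_of_ne h1 with h1 | h1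
  · rcases lt_or_gt_of_ne h2 with h2 | h2
    · rw [indicator_of_notMem (fun h => absurd h.1 (not_lt.2 h2.le))]
      have : radialCutoff n R ε =ᶠ[nhds v] fun _ => 1 := by
        filter_upwards [hcont.eventually (gt_mem_nhds h2)] with x hx
        exact radialCutoff_of_le hε hx.le
      rw [this.lineDeriv_eq]
      simp [lineDeriv]
    · rw [indicator_of_mem (s := {v : EuclideanSpace ℝ (Fin n) | ‖v‖ ∈ Ioc (R - ε) R})
        (show ‖v‖ ∈ Ioc (R - ε) R from ⟨h2, h1.le⟩)]
      have : radialCutoff n R ε =ᶠ[nhds v] fun x => ε⁻¹ * (R - ‖x‖) := by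
        filter_upwards [hcont.eventually (gt_mem_nhds h1), hcont.eventually (lt_mem_nhds h2)]
          with x hx hx'
        exact radialCutoff_of_mem hε hx'.le hx.le
      rw [this.lineDeriv_eq]
      have hv : v ≠ 0 := by
        rintro rfl
        simp at h2
        linarith
      have := (((hasFDerivAt_norm_of_ne_zero hv).const_sub R).const_mul ε⁻¹).hasLineDerivAt w
      rw [this.lineDeriv]
      simp [real_inner_smul_left]
  · rw [indicator_of_notMem (fun h => absurd h.2 (not_le.2 h1))]
    have : radialCutoff n R ε =ᶠ[nhds v] fun _ => 0 := by
      filter_upwards [hcont.eventually (lt_mem_nhds h1)] with x hx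
      exact radialCutoff_of_ge hε hx.le
    rw [this.lineDeriv_eq]
    simp [lineDeriv]

/-- Integration by parts moves the derivative to the Lipschitz cutoff, whose gradient lives on a
shell of width ε. As ε → 0 the shell average becomes the boundary term of the divergence theorem. -/
theorem integral_fderiv_mul_radialCutoff {n : ℕ} (hn : 0 < n) {R ε : ℝ} (hε : 0 < ε)
    (hεR : ε < R) {f : EuclideanSpace ℝ (Fin n) → ℝ} (hf : ContDiff ℝ 1 f)
    (w : EuclideanSpace ℝ (Fin n)) :
    ∫ v, fderiv ℝ f v w * radialCutoff n R ε v =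
      ε⁻¹ * ∫ v in {v : EuclideanSpace ℝ (Fin n) | ‖v‖ ∈ Ioc (R - ε) R},
        f v * inner ℝ (‖v‖⁻¹ • v) w := by
  have : Nonempty (Fin n) := ⟨⟨0, hn⟩⟩
  -- Integration by parts needs a globally Lipschitz factor; the bump makes `f` one without changing
  -- it on the support of the radial cutoff.
  let χ : ContDiffBump (0 : EuclideanSpace ℝ (Fin n)) := ⟨R + 1, R + 2, by linarith, by linarith⟩
  have hχf : ContDiff ℝ 1 (fun v => χ v * f v) := χ.contDiff.mul hf
  have hχs : HasCompactSupport (fun v => χ v * f v) := χ.hasCompactSupport.mul_right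
  obtain ⟨C, hC⟩ := hχf.lipschitzWith_of_hasCompactSupport hχs (by simp)
  have hχ1 : ∀ v : EuclideanSpace ℝ (Fin n), ‖v‖ < R + 1 → χ v = 1 := fun v hv =>
    χ.one_of_mem_closedBall (by simpa using hv.le)
  have hcs : HasCompactSupport (radialCutoff n R ε) := by
    refine HasCompactSupport.intro (isCompact_closedBall (0 : EuclideanSpace ℝ (Fin n)) R) ?_
    intro v hv
    refine radialCutoff_of_ge hε ?_
    simp only [mem_closedBall, dist_zero_right, not_le] at hv
    exact hv.le
  have key := LipschitzWith.integral_lineDeriv_mul_eq (μ := volume) hC (lipschitzWith_radialCutoff n R hε) hcs w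
  have e1 : ∀ v, lineDeriv ℝ (fun v => χ v * f v) v w * radialCutoff n R ε v =
      fderiv ℝ f v w * radialCutoff n R ε v := by
    intro v
    rcases lt_or_ge ‖v‖ (R + 1) with hv | hv
    · have : (fun v => χ v * f v) =ᶠ[nhds v] f := by
        filter_upwards [continuous_norm.continuousAt.eventually (gt_mem_nhds hv)] with x hx
        rw [hχ1 x hx, one_mul]
      rw [this.lineDeriv_eq, (hf.differentiable (by simp) v).lineDeriv_eq_fderiv]
    · rw [radialCutoff_of_ge hε (by linarith)]; simp
  have e2 : ∀ᵐ v : EuclideanSpace ℝ (Fin n),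
      lineDeriv ℝ (radialCutoff n R ε) v (-w) * (χ v * f v) =
      {v : EuclideanSpace ℝ (Fin n) | ‖v‖ ∈ Ioc (R - ε) R}.indicator
        (fun v => ε⁻¹ * (f v * inner ℝ (‖v‖⁻¹ • v) w)) v := by
    have hs : ∀ r : ℝ, r ≠ 0 → ∀ᵐ v : EuclideanSpace ℝ (Fin n), ‖v‖ ≠ r := by
      intro r hr
      have : volume (sphere (0 : EuclideanSpace ℝ (Fin n)) r) = 0 :=
        Measure.addHaar_sphere_of_ne_zero _ _ hr
      filter_upwards [measure_eq_zero_iff_ae_notMem.1 this] with v hv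
      simpa using hv
    filter_upwards [hs R (by linarith), hs (R - ε) (by linarith)] with v h1 h2
    rw [lineDeriv_radialCutoff hε hεR h1 h2]
    by_cases hv : v ∈ {v : EuclideanSpace ℝ (Fin n) | ‖v‖ ∈ Ioc (R - ε) R}
    · rw [indicator_of_mem hv, indicator_of_mem hv, hχ1 v (by linarith [hv.2]), inner_neg_right]
      ring
    · rw [indicator_of_notMem hv, indicator_of_notMem hv, zero_mul]
  have hms : MeasurableSet {v : EuclideanSpace ℝ (Fin n) | ‖v‖ ∈ Ioc (R - ε) R} :=
    measurable_norm measurableSet_Ioc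
  simp only [e1] at key
  rw [key, integral_congr_ae e2, integral_indicator hms, integral_const_mul]

open Filter Topology in
/-- The divergence theorem on a ball. -/
theorem integral_divergence_ball {n : ℕ} (hn : 0 < n) {R : ℝ} (hR : 0 < R)
    {Y : EuclideanSpace ℝ (Fin n) → EuclideanSpace ℝ (Fin n)} (hY : ContDiff ℝ 1 Y) :
    ∫ v in ball (0 : EuclideanSpace ℝ (Fin n)) R, divergence Y v =
      R ^ (n - 1) * ∫ θ : sphere (0 : EuclideanSpace ℝ (Fin n)) 1,
        inner ℝ (Y (R • (θ : EuclideanSpace ℝ (Fin n)))) (θ : EuclideanSpace ℝ (Fin n))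
          ∂(volume : Measure (EuclideanSpace ℝ (Fin n))).toSphere := by
  have hYi : ∀ i, ContDiff ℝ 1 (fun v => Y v i) := fun i => by fun_prop
  have hdiv : ∀ v, divergence Y v = ∑ i, fderiv ℝ (fun v => Y v i) v
      (EuclideanSpace.single i 1) := by
    intro v
    refine Finset.sum_congr rfl fun i _ => ?_
    have h := ((EuclideanSpace.proj (𝕜 := ℝ) i : _ →L[ℝ] ℝ).hasFDerivAt (x := Y v)).comp v
      ((hY.differentiable (by simp)) v).hasFDerivAt
    have h' : HasFDerivAt (fun v => Y v i)
      ((EuclideanSpace.proj (𝕜 := ℝ) i : _ →L[ℝ] ℝ).comp (fderiv ℝ Y v)) v := h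
    rw [h'.fderiv]
    simp
  have hcont : Continuous (divergence Y) := by
    have : divergence Y = fun v => ∑ i, fderiv ℝ (fun v => Y v i) v
      (EuclideanSpace.single i 1) := funext hdiv
    rw [this]
    exact continuous_finsetSum _ fun i _ =>
      ((hYi i).continuous_fderiv (by simp)).clm_apply continuous_const
  set K : ℝ → ℝ := fun r => r ^ (n - 1) * ∫ θ : sphere (0 : EuclideanSpace ℝ (Fin n)) 1,
        inner ℝ (Y (r • (θ : EuclideanSpace ℝ (Fin n)))) (θ : EuclideanSpace ℝ (Fin n))
          ∂(volume : Measure (EuclideanSpace ℝ (Fin n))).toSphere with hK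
  have hKc : Continuous K := by
    refine (continuous_pow _).mul (continuous_integral_sphere ?_)
    have := hY.continuous
    unfold Function.uncurry
    fun_prop
  have hshell : ∀ ε ∈ Ioo 0 R, ∫ v, divergence Y v * radialCutoff n R ε v =
      ε⁻¹ * ∫ r in (R - ε)..R, K r := by
    rintro ε ⟨hε, hεR⟩
    have hgc := (lipschitzWith_radialCutoff n R hε).continuous
    have hcs : HasCompactSupport (radialCutoff n R ε) := by
      refine HasCompactSupport.intro (isCompact_closedBall (0 : EuclideanSpace ℝ (Fin n)) R) ?_
      intro v hv
      refine radialCutoff_of_ge hε ?_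
      simp only [mem_closedBall, dist_zero_right, not_le] at hv
      exact hv.le
    simp only [hdiv, Finset.sum_mul]
    have hsub : {v : EuclideanSpace ℝ (Fin n) | ‖v‖ ∈ Ioc (R - ε) R} ⊆ closedBall 0 R := by
      intro v hv; simpa using hv.2
    have hms : MeasurableSet {v : EuclideanSpace ℝ (Fin n) | ‖v‖ ∈ Ioc (R - ε) R} :=
      measurable_norm measurableSet_Ioc
    have hintg : ∀ (f : EuclideanSpace ℝ (Fin n) → ℝ) (w : EuclideanSpace ℝ (Fin n)),
        Continuous f → IntegrableOn (fun v => f v * inner ℝ (‖v‖⁻¹ • v) w)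
          {v : EuclideanSpace ℝ (Fin n) | ‖v‖ ∈ Ioc (R - ε) R} := by
      intro f w hf
      have h1 : IntegrableOn f {v : EuclideanSpace ℝ (Fin n) | ‖v‖ ∈ Ioc (R - ε) R} :=
        (hf.continuousOn.integrableOn_compact (isCompact_closedBall _ _)).mono_set hsub
      refine Integrable.mul_bdd (c := ‖w‖) h1 ?_ ?_
      · exact Measurable.aestronglyMeasurable (by fun_prop)
      · refine Eventually.of_forall fun v => ?_
        refine (norm_inner_le_norm _ _).trans ?_
        have : ‖‖v‖⁻¹ • v‖ ≤ 1 := by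
          rw [norm_smul, norm_inv, norm_norm]
          exact inv_mul_le_one
        nlinarith [norm_nonneg w]
    rw [integral_finsetSum]
    · simp only [integral_fderiv_mul_radialCutoff hn hε hεR (hYi _)]
      rw [← Finset.mul_sum, ← integral_finsetSum _ fun i _ => hintg _ _ (hYi i).continuous,
        integral_shell hn (integrable_finsetSum _ fun i _ => hintg _ _ (hYi i).continuous)
          (by linarith) (by linarith)]
      congr 1
      refine intervalIntegral.integral_congr fun r hr => ?_
      rw [uIcc_of_le (by linarith)] at hr
      have hr0 : 0 < r := by linarith [hr.1]
      simp only [hK]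
      congr 1
      refine integral_congr_ae (Eventually.of_forall fun θ => ?_)
      have hθ : ‖(θ : EuclideanSpace ℝ (Fin n))‖ = 1 := by simp
      simp only [norm_smul, hθ, mul_one, Real.norm_eq_abs, abs_of_pos hr0, smul_smul,
        inv_mul_cancel₀ hr0.ne', one_smul]
      rw [PiLp.inner_apply]
      refine Finset.sum_congr rfl fun i _ => ?_
      simp [EuclideanSpace.inner_single_right, mul_comm]
    · intro i _
      exact ((((hYi i).continuous_fderiv (by simp)).clm_apply continuous_const).mul
        hgc).integrable_of_hasCompactSupport hcs.mul_left
  -- The same integrals have two limits: dominated convergence gives the integral over the ball, and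
  -- the shell averages give the sphere integral.
  have hlim1 : Tendsto (fun ε => ∫ v, divergence Y v * radialCutoff n R ε v) (𝓝[>] 0)
      (𝓝 (∫ v, (ball (0 : EuclideanSpace ℝ (Fin n)) R).indicator (divergence Y) v)) := by
    have hint : Integrable ((ball (0 : EuclideanSpace ℝ (Fin n)) R).indicator
        fun v => |divergence Y v|) := by
      rw [integrable_indicator_iff measurableSet_ball]
      exact (hcont.abs.continuousOn.integrableOn_compact
        (isCompact_closedBall (0 : EuclideanSpace ℝ (Fin n)) R)).mono_set ball_subset_closedBall
    refine tendsto_integral_filter_of_dominated_convergence _ ?_ ?_ hint ?_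
    · filter_upwards [self_mem_nhdsWithin] with ε hε
      exact (hcont.mul (lipschitzWith_radialCutoff n R hε).continuous).aestronglyMeasurable
    · filter_upwards [self_mem_nhdsWithin] with ε hε
      refine Eventually.of_forall fun v => ?_
      by_cases hv : v ∈ ball (0 : EuclideanSpace ℝ (Fin n)) R
      · rw [indicator_of_mem hv, norm_mul, Real.norm_eq_abs, Real.norm_eq_abs,
          abs_of_nonneg (radialCutoff_mem_Icc n R ε v).1]
        exact mul_le_of_le_one_right (abs_nonneg _) (radialCutoff_mem_Icc n R ε v).2
      · rw [indicator_of_notMem hv, radialCutoff_of_ge hε (by simpa using hv)]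
        simp
    · refine Eventually.of_forall fun v => ?_
      by_cases hv : v ∈ ball (0 : EuclideanSpace ℝ (Fin n)) R
      · rw [indicator_of_mem hv]
        refine tendsto_const_nhds.congr' ?_
        have hv' : 0 < R - ‖v‖ := by simpa using hv
        filter_upwards [self_mem_nhdsWithin,
          nhdsWithin_le_nhds (gt_mem_nhds hv')] with ε hε hε2
        rw [radialCutoff_of_le hε (by linarith), mul_one]
      · rw [indicator_of_notMem hv]
        refine tendsto_const_nhds.congr' ?_
        filter_upwards [self_mem_nhdsWithin] with ε hε
        rw [radialCutoff_of_ge hε (by simpa using hv), mul_zero]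
  rw [integral_indicator measurableSet_ball] at hlim1
  have hlim2 := tendsto_average_left hKc R
  refine tendsto_nhds_unique hlim1 (hlim2.congr' ?_)
  filter_upwards [self_mem_nhdsWithin, nhdsWithin_le_nhds (gt_mem_nhds hR)] with ε h1 h2
  exact (hshell ε ⟨h1, h2⟩).symm

/-! ### The functions `s_κ`, `c_κ` -/

theorem sn_of_pos {κ : ℝ} (h : 0 < κ) (r : ℝ) : sn κ r = Real.sin (√κ * r) / √κ := by
  simp [sn, h]

theorem sn_of_neg {κ : ℝ} (h : κ < 0) (r : ℝ) : sn κ r = Real.sinh (√(-κ) * r) / √(-κ) := by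
  simp [sn, h, not_lt.2 h.le]

theorem sn_zero_curvature (r : ℝ) : sn 0 r = r := by simp [sn]

theorem cs_of_pos {κ : ℝ} (h : 0 < κ) (r : ℝ) : cs κ r = Real.cos (√κ * r) := by
  simp [cs, h]

theorem cs_of_neg {κ : ℝ} (h : κ < 0) (r : ℝ) : cs κ r = Real.cosh (√(-κ) * r) := by
  simp [cs, h, not_lt.2 h.le]

theorem cs_zero_curvature (r : ℝ) : cs 0 r = 1 := by simp [cs]

theorem sn_zero (κ : ℝ) : sn κ 0 = 0 := by
  simp [sn]

theorem cs_zero (κ : ℝ) : cs κ 0 = 1 := by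
  simp [cs]

theorem cs_sq_add (κ r : ℝ) : cs κ r ^ 2 + κ * sn κ r ^ 2 = 1 := by
  rcases lt_trichotomy κ 0 with h | rfl | h
  · rw [sn_of_neg h, cs_of_neg h, div_pow, Real.sq_sqrt (by linarith)]
    have hκ : κ ≠ 0 := h.ne
    have := Real.cosh_sq (√(-κ) * r)
    rw [this, div_neg, mul_neg, mul_div_cancel₀ _ hκ]
    ring
  · simp [cs_zero_curvature]
  · rw [sn_of_pos h, cs_of_pos h, div_pow, Real.sq_sqrt h.le]
    have := Real.sin_sq_add_cos_sq (√κ * r)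
    field_simp
    linarith

theorem sn_two_mul (κ r : ℝ) : sn κ (2 * r) = 2 * sn κ r * cs κ r := by
  rcases lt_trichotomy κ 0 with h | rfl | h
  · rw [sn_of_neg h, sn_of_neg h, cs_of_neg h, mul_left_comm, Real.sinh_two_mul]
    ring
  · simp [sn_zero_curvature, cs_zero_curvature]
  · rw [sn_of_pos h, sn_of_pos h, cs_of_pos h, mul_left_comm, Real.sin_two_mul]
    ring

theorem hasDerivAt_sn (κ r : ℝ) : HasDerivAt (sn κ) (cs κ r) r := by
  rcases lt_trichotomy κ 0 with h | rfl | h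
  · have hs : √(-κ) ≠ 0 := (Real.sqrt_pos.2 (by linarith)).ne'
    rw [cs_of_neg h, funext (sn_of_neg h)]
    have := (((hasDerivAt_id r).const_mul (√(-κ))).sinh).div_const (√(-κ))
    simp only [id, mul_one, mul_div_cancel_right₀ _ hs] at this
    exact this
  · rw [cs_zero_curvature, funext sn_zero_curvature]
    exact hasDerivAt_id r
  · have hs : √κ ≠ 0 := (Real.sqrt_pos.2 h).ne'
    rw [cs_of_pos h, funext (sn_of_pos h)]
    have := (((hasDerivAt_id r).const_mul (√κ)).sin).div_const (√κ)
    simp only [id, mul_one, mul_div_cancel_right₀ _ hs] at this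
    exact this

theorem hasDerivAt_cs (κ r : ℝ) : HasDerivAt (cs κ) (-κ * sn κ r) r := by
  rcases lt_trichotomy κ 0 with h | rfl | h
  · have hs : √(-κ) ≠ 0 := (Real.sqrt_pos.2 (by linarith)).ne'
    have hs2 : √(-κ) * √(-κ) = -κ := Real.mul_self_sqrt (by linarith)
    rw [sn_of_neg h, funext (cs_of_neg h)]
    have := ((hasDerivAt_id r).const_mul (√(-κ))).cosh
    refine this.congr_deriv ?_
    simp only [id, mul_one]
    rw [← mul_div_assoc, eq_div_iff hs, mul_assoc, hs2]
    ring
  · rw [sn_zero_curvature, funext cs_zero_curvature]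
    simpa using hasDerivAt_const r (1 : ℝ)
  · have hs : √κ ≠ 0 := (Real.sqrt_pos.2 h).ne'
    have hs2 : √κ * √κ = κ := Real.mul_self_sqrt h.le
    rw [sn_of_pos h, funext (cs_of_pos h)]
    have := ((hasDerivAt_id r).const_mul (√κ)).cos
    refine this.congr_deriv ?_
    simp only [id, mul_one]
    rw [← mul_div_assoc, eq_div_iff hs, mul_assoc, hs2]
    ring

theorem continuous_sn (κ : ℝ) : Continuous (sn κ) :=
  continuous_iff_continuousAt.2 fun r => (hasDerivAt_sn κ r).continuousAt

theorem continuous_cs (κ : ℝ) : Continuous (cs κ) :=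
  continuous_iff_continuousAt.2 fun r => (hasDerivAt_cs κ r).continuousAt

theorem sn_pos {κ R r : ℝ} (hκ : 0 < κ → √κ * R < Real.pi) (h0 : 0 < r) (hr : r ≤ R) :
    0 < sn κ r := by
  rcases lt_trichotomy κ 0 with h | rfl | h
  · have hs : 0 < √(-κ) := Real.sqrt_pos.2 (by linarith)
    rw [sn_of_neg h]
    exact div_pos (Real.sinh_pos_iff.2 (mul_pos hs h0)) hs
  · rwa [sn_zero_curvature]
  · have hs : 0 < √κ := Real.sqrt_pos.2 h
    rw [sn_of_pos h]
    refine div_pos (Real.sin_pos_of_pos_of_lt_pi (mul_pos hs h0) ?_) hs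
    exact (mul_le_mul_of_nonneg_left hr hs.le).trans_lt (hκ h)

/-! ### Smoothness in normal coordinates -/

open Nat in
theorem hasSum_sn (κ r : ℝ) :
    HasSum (fun k : ℕ => (-κ) ^ k * r ^ (2 * k + 1) / ((2 * k + 1)! : ℝ)) (sn κ r) := by
  rcases lt_trichotomy κ 0 with h | rfl | h
  · have hs : √(-κ) ≠ 0 := (Real.sqrt_pos.2 (by linarith)).ne'
    have hs2 : √(-κ) ^ 2 = -κ := Real.sq_sqrt (by linarith)
    rw [sn_of_neg h]
    refine ((Real.hasSum_sinh (√(-κ) * r)).div_const (√(-κ))).congr_fun ?_ |> id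
    intro k
    have e : √(-κ) ^ (2 * k + 1) = (-κ) ^ k * √(-κ) := by rw [pow_succ, pow_mul, hs2]
    rw [mul_pow, e]
    field_simp
  · rw [sn_zero_curvature]
    -- In the flat case only the term k = 0 survives.
    convert hasSum_single (f := fun k : ℕ => (-0 : ℝ) ^ k * r ^ (2 * k + 1) / ((2 * k + 1)! : ℝ))
      0 ?_ using 1
    · simp
    · intro k hk
      simp [hk]
  · have hs : √κ ≠ 0 := (Real.sqrt_pos.2 h).ne'
    have hs2 : √κ ^ 2 = κ := Real.sq_sqrt h.le
    rw [sn_of_pos h]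
    refine ((Real.hasSum_sin (√κ * r)).div_const (√κ)).congr_fun ?_ |> id
    intro k
    have e : √κ ^ (2 * k + 1) = κ ^ k * √κ := by rw [pow_succ, pow_mul, hs2]
    rw [neg_pow, mul_pow, e]
    field_simp

open Nat in
theorem hasSum_cs (κ r : ℝ) :
    HasSum (fun k : ℕ => (-κ) ^ k * r ^ (2 * k) / ((2 * k)! : ℝ)) (cs κ r) := by
  rcases lt_trichotomy κ 0 with h | rfl | h
  · have hs2 : √(-κ) ^ 2 = -κ := Real.sq_sqrt (by linarith)
    rw [cs_of_neg h]
    refine (Real.hasSum_cosh (√(-κ) * r)).congr_fun ?_ |> id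
    intro k
    rw [mul_pow, pow_mul √(-κ), hs2]
  · rw [cs_zero_curvature]
    convert hasSum_single (f := fun k : ℕ => (-0 : ℝ) ^ k * r ^ (2 * k) / ((2 * k)! : ℝ))
      0 ?_ using 1
    · simp
    · intro k hk
      simp [hk]
  · have hs2 : √κ ^ 2 = κ := Real.sq_sqrt h.le
    rw [cs_of_pos h]
    refine (Real.hasSum_cos (√κ * r)).congr_fun ?_ |> id
    intro k
    rw [neg_pow, mul_pow, pow_mul √κ, hs2]
    ring

/-- A real power series which converges absolutely everywhere has a smooth sum. -/
theorem contDiff_tsum_pow {a : ℕ → ℝ} (ha : ∀ r : ℝ, Summable fun k => |a k| * r ^ k) :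
    ContDiff ℝ (⊤ : ℕ∞) fun z : ℝ => ∑' k, a k * z ^ k := by
  set p := FormalMultilinearSeries.ofScalars ℝ a
  have hr : p.radius = ⊤ := by
    refine p.radius_eq_top_of_summable_norm fun r => ?_
    simpa [p] using ha r
  have h := p.hasFPowerSeriesOnBall (by rw [hr]; exact ENNReal.zero_lt_top)
  have h2 := h.analyticOnNhd
  rw [hr, Metric.eball_top] at h2
  have h3 : p.sum = fun z : ℝ => ∑' k, a k * z ^ k := by
    have := FormalMultilinearSeries.ofScalarsSum_eq_tsum (E := ℝ) a
    simpa [FormalMultilinearSeries.ofScalarsSum] using this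
  rw [h3] at h2
  exact h2.contDiff

open Nat in
/-- The smooth extension of `s_κ(|v|) / |v|` to the origin. -/
def snRatio {n : ℕ} (κ : ℝ) (v : EuclideanSpace ℝ (Fin n)) : ℝ :=
  ∑' k : ℕ, (-κ) ^ k / ((2 * k + 1)! : ℝ) * (‖v‖ ^ 2) ^ k

open Nat in
/-- The smooth extension of `(s_κ(|v|) c_κ(|v|) / |v| - 1) / |v|²` to the origin. -/
def snDefect {n : ℕ} (κ : ℝ) (v : EuclideanSpace ℝ (Fin n)) : ℝ :=
  ∑' k : ℕ, (-κ) ^ (k + 1) * 4 ^ (k + 1) / ((2 * k + 3)! : ℝ) * (‖v‖ ^ 2) ^ k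

open Nat in
theorem summable_of_le_factorial {a : ℕ → ℝ} {A B : ℝ}
    (h : ∀ k, |a k| ≤ A * B ^ k / (k ! : ℝ)) (r : ℝ) : Summable fun k => |a k| * r ^ k := by
  refine Summable.of_norm_bounded (g := fun k => A * ((B * |r|) ^ k / (k ! : ℝ)))
    ((Real.summable_pow_div_factorial _).mul_left A) fun k => ?_
  rw [norm_mul, norm_pow, Real.norm_eq_abs, Real.norm_eq_abs, abs_abs]
  calc |a k| * |r| ^ k ≤ A * B ^ k / (k ! : ℝ) * |r| ^ k :=
        mul_le_mul_of_nonneg_right (h k) (by positivity)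
    _ = _ := by rw [mul_pow]; ring

open Nat in
theorem contDiff_snRatio {n : ℕ} (κ : ℝ) :
    ContDiff ℝ (⊤ : ℕ∞) (snRatio κ : EuclideanSpace ℝ (Fin n) → ℝ) := by
  refine (contDiff_tsum_pow (a := fun k => (-κ) ^ k / ((2 * k + 1)! : ℝ)) ?_).comp
    (contDiff_norm_sq ℝ)
  refine summable_of_le_factorial (A := 1) (B := |κ|) fun k => ?_
  rw [abs_div, abs_pow, abs_neg, one_mul, Nat.abs_cast]
  gcongr
  omega

open Nat in
theorem contDiff_cs_norm {n : ℕ} (κ : ℝ) :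
    ContDiff ℝ (⊤ : ℕ∞) (fun v : EuclideanSpace ℝ (Fin n) => cs κ ‖v‖) := by
  have h := (contDiff_tsum_pow (a := fun k => (-κ) ^ k / ((2 * k)! : ℝ)) ?_).comp
    (contDiff_norm_sq ℝ (E := EuclideanSpace ℝ (Fin n)))
  · convert h using 1
    ext v
    rw [← (hasSum_cs κ ‖v‖).tsum_eq, Function.comp]
    refine tsum_congr fun k => ?_
    rw [← pow_mul]
    ring
  refine summable_of_le_factorial (A := 1) (B := |κ|) fun k => ?_
  rw [abs_div, abs_pow, abs_neg, one_mul, Nat.abs_cast]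
  gcongr
  omega

open Nat in
theorem contDiff_snDefect {n : ℕ} (κ : ℝ) :
    ContDiff ℝ (⊤ : ℕ∞) (snDefect κ : EuclideanSpace ℝ (Fin n) → ℝ) := by
  refine (contDiff_tsum_pow (a := fun k => (-κ) ^ (k + 1) * 4 ^ (k + 1) / ((2 * k + 3)! : ℝ)) ?_).comp
    (contDiff_norm_sq ℝ)
  refine summable_of_le_factorial (A := |κ| * 4) (B := |κ| * 4) fun k => ?_
  rw [abs_div, abs_mul, abs_pow, abs_neg, Nat.abs_cast, abs_of_pos (show (0 : ℝ) < 4 ^ (k + 1) by positivity),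
    ← mul_pow,
    _root_.pow_succ']
  gcongr
  omega

theorem norm_mul_snRatio {n : ℕ} (κ : ℝ) (v : EuclideanSpace ℝ (Fin n)) :
    ‖v‖ * snRatio κ v = sn κ ‖v‖ := by
  rw [snRatio, ← tsum_mul_left, ← (hasSum_sn κ ‖v‖).tsum_eq]
  refine tsum_congr fun k => ?_
  rw [← pow_mul]
  ring

theorem snRatio_eq {n : ℕ} (κ : ℝ) {v : EuclideanSpace ℝ (Fin n)} (hv : v ≠ 0) :
    snRatio κ v = sn κ ‖v‖ / ‖v‖ := by
  rw [← norm_mul_snRatio, mul_div_cancel_left₀ _ (norm_ne_zero_iff.2 hv)]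

theorem snRatio_zero {n : ℕ} (κ : ℝ) : snRatio κ (0 : EuclideanSpace ℝ (Fin n)) = 1 := by
  rw [snRatio, tsum_eq_single 0]
  · simp
  · intro k hk; simp [hk]

/-- The double angle formula turns s_κ c_κ into s_κ(2r)/2, so the coefficients are those of the sine
series at 2r with its first term removed. This explains the powers of 4. -/
theorem norm_sq_mul_snDefect {n : ℕ} (κ : ℝ) (v : EuclideanSpace ℝ (Fin n)) :
    ‖v‖ ^ 2 * snDefect κ v = snRatio κ v * cs κ ‖v‖ - 1 := by
  by_cases hv : v = 0
  · simp [hv, snRatio_zero, cs_zero]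
  have hv' : ‖v‖ ≠ 0 := norm_ne_zero_iff.2 hv
  have h1 := hasSum_sn κ (2 * ‖v‖)
  rw [sn_two_mul, ← hasSum_nat_add_iff' 1] at h1
  have h2 := (h1.div_const (2 * ‖v‖)).tsum_eq
  rw [snDefect, ← tsum_mul_left, snRatio_eq κ hv]
  calc _ = ∑' k : ℕ, (-κ) ^ (k + 1) * (2 * ‖v‖) ^ (2 * (k + 1) + 1) /
        ((2 * (k + 1) + 1).factorial : ℝ) / (2 * ‖v‖) := by
        refine tsum_congr fun k => ?_
        have e : (4 : ℝ) ^ (k + 1) = (2 : ℝ) ^ (2 * (k + 1)) := by rw [pow_mul]; norm_num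
        rw [e, show 2 * (k + 1) + 1 = 2 * k + 3 by ring]
        field_simp
        ring
    _ = _ := by
        rw [h2]
        simp
        field_simp

theorem snRatio_pos {n : ℕ} {κ R : ℝ} (hκ : 0 < κ → √κ * R < Real.pi)
    {v : EuclideanSpace ℝ (Fin n)} (hv : ‖v‖ ≤ R) : 0 < snRatio κ v := by
  by_cases h : v = 0
  · rw [h, snRatio_zero]; exact one_pos
  · rw [snRatio_eq κ h]
    exact div_pos (sn_pos hκ (norm_pos_iff.2 h) hv) (norm_pos_iff.2 h)

/-! ### Rules for the divergence -/

theorem divergence_smul {n : ℕ} {g : EuclideanSpace ℝ (Fin n) → ℝ}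
    {Y : EuclideanSpace ℝ (Fin n) → EuclideanSpace ℝ (Fin n)} {v : EuclideanSpace ℝ (Fin n)}
    (hg : DifferentiableAt ℝ g v) (hY : DifferentiableAt ℝ Y v) :
    divergence (fun v => g v • Y v) v = g v * divergence Y v + fderiv ℝ g v (Y v) := by
  have hsum : Y v = ∑ i, Y v i • EuclideanSpace.single i (1 : ℝ) := by
    ext k
    simp [Finset.sum_apply, Pi.single_apply]
  have h : fderiv ℝ g v (Y v) = ∑ i, fderiv ℝ g v (EuclideanSpace.single i 1) * Y v i := by
    conv_lhs => rw [hsum]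
    rw [map_sum]
    refine Finset.sum_congr rfl fun i _ => ?_
    rw [map_smul, smul_eq_mul, mul_comm]
  rw [divergence, divergence, h, Finset.mul_sum, ← Finset.sum_add_distrib]
  refine Finset.sum_congr rfl fun i _ => ?_
  rw [(hg.hasFDerivAt.fun_smul hY.hasFDerivAt).fderiv]
  simp

theorem divergence_add {n : ℕ}
    {Y Z : EuclideanSpace ℝ (Fin n) → EuclideanSpace ℝ (Fin n)} {v : EuclideanSpace ℝ (Fin n)}
    (hY : DifferentiableAt ℝ Y v) (hZ : DifferentiableAt ℝ Z v) :
    divergence (fun v => Y v + Z v) v = divergence Y v + divergence Z v := by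
  rw [divergence, divergence, divergence, ← Finset.sum_add_distrib]
  refine Finset.sum_congr rfl fun i _ => ?_
  rw [(hY.hasFDerivAt.fun_add hZ.hasFDerivAt).fderiv]
  simp

theorem divergence_const {n : ℕ} (w v : EuclideanSpace ℝ (Fin n)) :
    divergence (fun _ => w) v = 0 := by
  simp [divergence]

theorem divergence_id {n : ℕ} (v : EuclideanSpace ℝ (Fin n)) :
    divergence (fun v => v) v = n := by
  simp [divergence]

/-! ### Derivatives in normal coordinates -/

section
variable {n : ℕ} (κ : ℝ) {v : EuclideanSpace ℝ (Fin n)}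

theorem hasFDerivAt_cs_norm (hv : v ≠ 0) :
    HasFDerivAt (fun v : EuclideanSpace ℝ (Fin n) => cs κ ‖v‖)
      ((-κ * snRatio κ v) • innerSL ℝ v) v := by
  refine ((hasDerivAt_cs κ ‖v‖).comp_hasFDerivAt v (hasFDerivAt_norm_of_ne_zero hv)).congr_fderiv ?_
  rw [snRatio_eq κ hv, smul_smul]
  congr 1
  ring

theorem hasFDerivAt_snRatio (hv : v ≠ 0) :
    HasFDerivAt (snRatio κ : EuclideanSpace ℝ (Fin n) → ℝ)
      (((cs κ ‖v‖ - snRatio κ v) / ‖v‖ ^ 2) • innerSL ℝ v) v := by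
  have hv' : ‖v‖ ≠ 0 := norm_ne_zero_iff.2 hv
  have h1 := (hasDerivAt_sn κ ‖v‖).div (hasDerivAt_id ‖v‖) hv'
  have h2 := h1.comp_hasFDerivAt v (hasFDerivAt_norm_of_ne_zero hv)
  have h3 : HasFDerivAt (snRatio κ : EuclideanSpace ℝ (Fin n) → ℝ) _ v :=
    h2.congr_of_eventuallyEq (by
      filter_upwards [isOpen_ne.mem_nhds hv] with w hw
      simp [snRatio_eq κ hw])
  refine h3.congr_fderiv ?_
  rw [smul_smul, snRatio_eq κ hv]
  congr 1
  simp only [id]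
  field_simp

theorem hasFDerivAt_snDefect (hv : v ≠ 0) :
    HasFDerivAt (snDefect κ : EuclideanSpace ℝ (Fin n) → ℝ)
      ((((cs κ ‖v‖ - snRatio κ v) / ‖v‖ ^ 2 * cs κ ‖v‖ - κ * snRatio κ v ^ 2
        - 2 * snDefect κ v) / ‖v‖ ^ 2) • innerSL ℝ v) v := by
  have hv' : ‖v‖ ≠ 0 := norm_ne_zero_iff.2 hv
  have h1 := (((hasFDerivAt_snRatio κ hv).mul (hasFDerivAt_cs_norm κ hv)).sub_const 1)
  have h2 := (hasFDerivAt_id v).norm_sq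
  simp only [id] at h2
  have h3 : HasFDerivAt (snDefect κ : EuclideanSpace ℝ (Fin n) → ℝ) _ v :=
    (h1.mul ((hasDerivAt_inv (pow_ne_zero 2 hv')).comp_hasFDerivAt v h2)).congr_of_eventuallyEq (by
      filter_upwards [isOpen_ne.mem_nhds hv] with w hw
      have := norm_sq_mul_snDefect κ w
      have hw' : ‖w‖ ≠ 0 := norm_ne_zero_iff.2 hw
      simp only [Pi.mul_apply, Function.comp]
      rw [← this]
      field_simp)
  refine h3.congr_fderiv ?_
  have h4 := norm_sq_mul_snDefect κ v
  ext w
  simp [← h4]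
  field_simp
  ring

end

/-! ### The test functions `f(c_κ) g(ξ)` and their weighted gradients -/

/-- The function `s_κ(r) ⟨ω, θ⟩` of the ball, in normal coordinates. -/
def linField {n : ℕ} (κ : ℝ) (ω v : EuclideanSpace ℝ (Fin n)) : ℝ :=
  snRatio κ v * inner ℝ ω v

theorem contDiff_linField {n : ℕ} (κ : ℝ) (ω : EuclideanSpace ℝ (Fin n)) :
    ContDiff ℝ (⊤ : ℕ∞) (linField κ ω) :=
  (contDiff_snRatio κ).mul (contDiff_const.inner ℝ contDiff_id)

section
variable {n : ℕ} (κ : ℝ) (ω : EuclideanSpace ℝ (Fin n)) {v : EuclideanSpace ℝ (Fin n)}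

theorem hasFDerivAt_linField (hv : v ≠ 0) :
    HasFDerivAt (linField κ ω)
      (snRatio κ v • innerSL ℝ ω + (inner ℝ ω v * ((cs κ ‖v‖ - snRatio κ v) / ‖v‖ ^ 2)) •
        innerSL ℝ v) v := by
  have := (hasFDerivAt_snRatio κ hv).mul (innerSL ℝ ω).hasFDerivAt
  refine this.congr_fderiv ?_
  simp [smul_smul]

/-- The density times the model gradient of `-c_κ / κ`. -/
def radialField {n : ℕ} (j : ℕ) (κ : ℝ) (v : EuclideanSpace ℝ (Fin n)) :
    EuclideanSpace ℝ (Fin n) :=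
  snRatio κ v ^ (j + 2) • v

/-- The density times the model gradient of `linField κ ω`. -/
def axialField {n : ℕ} (j : ℕ) (κ : ℝ) (ω v : EuclideanSpace ℝ (Fin n)) :
    EuclideanSpace ℝ (Fin n) :=
  snRatio κ v ^ j • (ω + (snDefect κ v * inner ℝ ω v) • v)

theorem contDiff_radialField (j : ℕ) :
    ContDiff ℝ (⊤ : ℕ∞) (radialField j κ : EuclideanSpace ℝ (Fin n) → _) :=
  ((contDiff_snRatio κ).pow _).smul contDiff_id

theorem contDiff_axialField (j : ℕ) : ContDiff ℝ (⊤ : ℕ∞) (axialField j κ ω) :=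
  ((contDiff_snRatio κ).pow _).smul (contDiff_const.add
    (((contDiff_snDefect κ).mul (contDiff_const.inner ℝ contDiff_id)).smul contDiff_id))

theorem cs_sq_add_snRatio (v : EuclideanSpace ℝ (Fin n)) :
    cs κ ‖v‖ ^ 2 + κ * (snRatio κ v ^ 2 * ‖v‖ ^ 2) = 1 := by
  rw [← mul_pow, mul_comm (snRatio κ v), norm_mul_snRatio]
  exact cs_sq_add κ ‖v‖

theorem divergence_radialField (j : ℕ) {v : EuclideanSpace ℝ (Fin (j + 2))} (hv : v ≠ 0) :
    divergence (radialField j κ) v = snRatio κ v ^ (j + 1) * ((j + 2) * cs κ ‖v‖) := by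
  have hv' : ‖v‖ ≠ 0 := norm_ne_zero_iff.2 hv
  have h1 := (hasFDerivAt_snRatio κ hv).pow (j + 2)
  unfold radialField
  rw [divergence_smul h1.differentiableAt differentiableAt_fun_id, divergence_id, h1.fderiv]
  simp
  field_simp
  ring

theorem divergence_axialField (j : ℕ) (ω : EuclideanSpace ℝ (Fin (j + 2)))
    {v : EuclideanSpace ℝ (Fin (j + 2))} (hv : v ≠ 0) (he : snRatio κ v ≠ 0) :
    divergence (axialField j κ ω) v =
      -(snRatio κ v ^ (j + 1) * ((j + 2) * κ * linField κ ω v)) := by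
  have hv' : ‖v‖ ≠ 0 := norm_ne_zero_iff.2 hv
  have h1 := (hasFDerivAt_snRatio κ hv).pow j
  have h2 := (hasFDerivAt_snDefect κ hv).mul (innerSL ℝ ω).hasFDerivAt
  have h2' : HasFDerivAt (fun v => snDefect κ v * inner ℝ ω v) _ v := h2
  have h3 : DifferentiableAt ℝ (fun v => (snDefect κ v * inner ℝ ω v) • v) v :=
    h2'.differentiableAt.smul differentiableAt_fun_id
  unfold axialField
  rw [divergence_smul h1.differentiableAt ((differentiableAt_const ω).fun_add h3),
    divergence_add (differentiableAt_const ω) h3, divergence_const,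
    divergence_smul h2'.differentiableAt differentiableAt_fun_id, divergence_id, h2'.fderiv,
    h1.fderiv]
  have e1 := norm_sq_mul_snDefect κ v
  have e2 := cs_sq_add_snRatio κ v
  -- The truncated exponent at j = 0 is harmless because of the factor j.
  have hj : (j : ℝ) * snRatio κ v ^ (j - 1) = j * snRatio κ v ^ j / snRatio κ v := by
    rcases j with _ | j
    · simp
    · rw [Nat.add_sub_cancel, pow_succ]; field_simp
  simp [linField, inner_add_right, real_inner_smul_right, real_inner_comm ω v]
  rw [hj]
  have e3 : snDefect κ v = (snRatio κ v * cs κ ‖v‖ - 1) / ‖v‖ ^ 2 := by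
    rw [← e1]; field_simp
  -- Eliminating κ through c_κ² + κ s_κ² = 1 leaves a rational identity in free variables.
  have e4 : κ = (1 - cs κ ‖v‖ ^ 2) / (snRatio κ v ^ 2 * ‖v‖ ^ 2) := by
    rw [eq_div_iff (by positivity)]; linarith
  rw [e3]
  generalize snRatio κ v = e at *
  generalize cs κ ‖v‖ = s at *
  subst e4
  generalize ‖v‖ = r at *
  field_simp
  ring

end

/-- The function `f(c_κ(r)) g(s_κ(r) ⟨ω, θ⟩)` of the ball, in normal coordinates. -/
def testFn {n : ℕ} (κ : ℝ) (ω : EuclideanSpace ℝ (Fin n)) (f g : ℝ → ℝ)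
    (v : EuclideanSpace ℝ (Fin n)) : ℝ :=
  f (cs κ ‖v‖) * g (linField κ ω v)

/-- The density times the model gradient of `testFn κ ω f g`. -/
def testField {n : ℕ} (j : ℕ) (κ : ℝ) (ω : EuclideanSpace ℝ (Fin n)) (f g : ℝ → ℝ)
    (v : EuclideanSpace ℝ (Fin n)) : EuclideanSpace ℝ (Fin n) :=
  (-κ * deriv f (cs κ ‖v‖) * g (linField κ ω v)) • radialField j κ v +
    (f (cs κ ‖v‖) * deriv g (linField κ ω v)) • axialField j κ ω v

/-- The model Laplacian of `testFn κ ω f g`, at a point where `c_κ = s` and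
`linField κ ω = ξ`. -/
def testLap (n : ℕ) (κ W : ℝ) (f g : ℝ → ℝ) (s ξ : ℝ) : ℝ :=
  κ * ((1 - s ^ 2) * deriv (deriv f) s - n * s * deriv f s) * g ξ
    - 2 * κ * s * ξ * deriv f s * deriv g ξ
    + f s * (deriv (deriv g) ξ * (W - κ * ξ ^ 2) - n * κ * ξ * deriv g ξ)

section
variable {n : ℕ} {κ : ℝ} (ω : EuclideanSpace ℝ (Fin n)) {f g : ℝ → ℝ}

theorem contDiffAt_deriv {f : ℝ → ℝ} {s : ℝ} (hf : ContDiffAt ℝ (⊤ : ℕ∞) f s) :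
    ContDiffAt ℝ (⊤ : ℕ∞) (deriv f) s := by
  have h : ContDiffAt ℝ (⊤ : ℕ∞) (fderiv ℝ f) s := hf.fderiv_right (by simp)
  exact h.clm_apply contDiffAt_const

theorem contDiff_comp_cs (hf : ∀ r, ContDiffAt ℝ (⊤ : ℕ∞) f (cs κ r)) :
    ContDiff ℝ (⊤ : ℕ∞) (fun v : EuclideanSpace ℝ (Fin n) => f (cs κ ‖v‖)) :=
  contDiff_iff_contDiffAt.2 fun v => (hf ‖v‖).comp v (contDiff_cs_norm κ).contDiffAt

theorem contDiff_comp_linField (hg : ContDiff ℝ (⊤ : ℕ∞) g) :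
    ContDiff ℝ (⊤ : ℕ∞) (fun v => g (linField κ ω v)) :=
  hg.comp (contDiff_linField κ ω)

theorem contDiff_deriv_top {g : ℝ → ℝ} (hg : ContDiff ℝ (⊤ : ℕ∞) g) :
    ContDiff ℝ (⊤ : ℕ∞) (deriv g) :=
  contDiff_iff_contDiffAt.2 fun _ => contDiffAt_deriv hg.contDiffAt

theorem contDiff_testFn (hf : ∀ r, ContDiffAt ℝ (⊤ : ℕ∞) f (cs κ r))
    (hg : ContDiff ℝ (⊤ : ℕ∞) g) : ContDiff ℝ (⊤ : ℕ∞) (testFn κ ω f g) :=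
  (contDiff_comp_cs hf).mul (contDiff_comp_linField ω hg)

theorem contDiff_testField (j : ℕ) (hf : ∀ r, ContDiffAt ℝ (⊤ : ℕ∞) f (cs κ r))
    (hg : ContDiff ℝ (⊤ : ℕ∞) g) : ContDiff ℝ (⊤ : ℕ∞) (testField j κ ω f g) :=
  (((contDiff_const.mul (contDiff_comp_cs fun r => contDiffAt_deriv (hf r))).mul
    (contDiff_comp_linField ω hg)).smul (contDiff_radialField κ j)).add
  (((contDiff_comp_cs hf).mul (contDiff_comp_linField ω (contDiff_deriv_top hg))).smul
    (contDiff_axialField κ ω j))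

variable {v : EuclideanSpace ℝ (Fin n)}

theorem hasFDerivAt_mul_comp {f g : ℝ → ℝ} (hv : v ≠ 0)
    (hf : DifferentiableAt ℝ f (cs κ ‖v‖)) (hg : DifferentiableAt ℝ g (linField κ ω v)) :
    HasFDerivAt (fun v => f (cs κ ‖v‖) * g (linField κ ω v))
      ((f (cs κ ‖v‖) * deriv g (linField κ ω v) * snRatio κ v) • innerSL ℝ ω +
       (-(κ * snRatio κ v * deriv f (cs κ ‖v‖) * g (linField κ ω v)) +
         f (cs κ ‖v‖) * deriv g (linField κ ω v) * inner ℝ ω v *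
          ((cs κ ‖v‖ - snRatio κ v) / ‖v‖ ^ 2)) • innerSL ℝ v) v := by
  have h1 := hf.hasDerivAt.comp_hasFDerivAt v (hasFDerivAt_cs_norm κ hv)
  have h2 := hg.hasDerivAt.comp_hasFDerivAt v (hasFDerivAt_linField κ ω hv)
  refine (h1.mul h2).congr_fderiv ?_
  ext w
  simp
  ring

theorem hasFDerivAt_testFn (hv : v ≠ 0) (hf : ∀ r, ContDiffAt ℝ (⊤ : ℕ∞) f (cs κ r))
    (hg : ContDiff ℝ (⊤ : ℕ∞) g) :
    HasFDerivAt (testFn κ ω f g)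
      ((f (cs κ ‖v‖) * deriv g (linField κ ω v) * snRatio κ v) • innerSL ℝ ω +
       (-(κ * snRatio κ v * deriv f (cs κ ‖v‖) * g (linField κ ω v)) +
         f (cs κ ‖v‖) * deriv g (linField κ ω v) * inner ℝ ω v *
          ((cs κ ‖v‖ - snRatio κ v) / ‖v‖ ^ 2)) • innerSL ℝ v) v :=
  hasFDerivAt_mul_comp ω hv ((hf _).differentiableAt (by simp)) (hg.differentiable (by simp) _)

theorem gradient_testFn (hv : v ≠ 0) (hf : ∀ r, ContDiffAt ℝ (⊤ : ℕ∞) f (cs κ r))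
    (hg : ContDiff ℝ (⊤ : ℕ∞) g) :
    gradient (testFn κ ω f g) v =
      (f (cs κ ‖v‖) * deriv g (linField κ ω v) * snRatio κ v) • ω +
       (-(κ * snRatio κ v * deriv f (cs κ ‖v‖) * g (linField κ ω v)) +
         f (cs κ ‖v‖) * deriv g (linField κ ω v) * inner ℝ ω v *
          ((cs κ ‖v‖ - snRatio κ v) / ‖v‖ ^ 2)) • v := by
  refine ext_inner_right ℝ fun w => ?_
  rw [inner_gradient_left, (hasFDerivAt_testFn ω hv hf hg).fderiv]
  simp [inner_add_left, real_inner_smul_left]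

/-- This is the bridge from the metric g_κ to Green's formula in coordinates: density times model
inner product is a Euclidean pairing with a field that is smooth across the origin. -/
theorem modelInner_gradient_testFn (j : ℕ) (hv : v ≠ 0) (he : snRatio κ v ≠ 0)
    (hf : ∀ r, ContDiffAt ℝ (⊤ : ℕ∞) f (cs κ r))
    (hg : ContDiff ℝ (⊤ : ℕ∞) g) (a : EuclideanSpace ℝ (Fin n)) :
    (sn κ ‖v‖ / ‖v‖) ^ (j + 1) * modelInner κ v a (gradient (testFn κ ω f g) v) =
      inner ℝ a (testField j κ ω f g v) := by
  have hv' : ‖v‖ ≠ 0 := norm_ne_zero_iff.2 hv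
  have e0 : ‖v‖ / sn κ ‖v‖ = (snRatio κ v)⁻¹ := by rw [snRatio_eq κ hv, inv_div]
  have e1 := norm_sq_mul_snDefect κ v
  have e3 : snDefect κ v = (snRatio κ v * cs κ ‖v‖ - 1) / ‖v‖ ^ 2 := by
    rw [← e1]; field_simp
  rw [gradient_testFn ω hv hf hg, modelInner, e0, ← snRatio_eq κ hv, testField, radialField,
    axialField]
  simp only [inner_add_left, inner_add_right, real_inner_smul_left, real_inner_smul_right,
    real_inner_self_eq_norm_sq]
  rw [e3]
  generalize f (cs κ ‖v‖) = F0
  generalize deriv f (cs κ ‖v‖) = F1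
  generalize g (linField κ ω v) = G0
  generalize deriv g (linField κ ω v) = G1
  generalize snRatio κ v = e at *
  generalize cs κ ‖v‖ = s
  generalize inner ℝ ω v = q
  generalize inner ℝ a v = av
  generalize inner ℝ a ω = aw
  generalize ‖v‖ = r at *
  field_simp
  ring

theorem inner_testField_sphere (j : ℕ) {R : ℝ} (hR : 0 < R) {θ : EuclideanSpace ℝ (Fin n)}
    (hθ : ‖θ‖ = 1) :
    R ^ (j + 1) * inner ℝ (testField j κ ω f g (R • θ)) θ =
      sn κ R ^ (j + 1) * (-(κ * sn κ R * deriv f (cs κ R) * g (sn κ R * inner ℝ ω θ)) +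
        f (cs κ R) * deriv g (sn κ R * inner ℝ ω θ) * (cs κ R * inner ℝ ω θ)) := by
  have hn : ‖R • θ‖ = R := by rw [norm_smul, hθ, mul_one, Real.norm_of_nonneg hR.le]
  have e1 := norm_sq_mul_snDefect κ (R • θ)
  have e2 := norm_mul_snRatio κ (R • θ)
  rw [hn] at e1 e2
  have e3 : linField κ ω (R • θ) = sn κ R * inner ℝ ω θ := by
    rw [linField, real_inner_smul_right, ← e2]; ring
  have e4 : R ^ (j + 1) * inner ℝ (radialField j κ (R • θ)) θ = sn κ R ^ (j + 1) * sn κ R := by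
    rw [radialField, real_inner_smul_left, real_inner_smul_left, real_inner_self_eq_norm_sq, hθ,
      ← e2]
    ring
  have e5 : R ^ (j + 1) * inner ℝ (axialField j κ ω (R • θ)) θ =
      sn κ R ^ (j + 1) * (cs κ R * inner ℝ ω θ) := by
    rw [axialField, real_inner_smul_left, inner_add_left, real_inner_smul_left,
      real_inner_smul_left, real_inner_smul_right, real_inner_self_eq_norm_sq, hθ]
    rw [← e2]
    linear_combination (R ^ (j + 1) * snRatio κ (R • θ) ^ j * inner ℝ ω θ) * e1
  rw [testField, inner_add_left, real_inner_smul_left, real_inner_smul_left, hn, e3]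
  linear_combination (-κ * deriv f (cs κ R) * g (sn κ R * inner ℝ ω θ)) * e4 +
    (f (cs κ R) * deriv g (sn κ R * inner ℝ ω θ)) * e5

end

/-- With ξ = s_κ⟨ω, θ⟩, the formula is the chain rule for Δc_κ = -nκ c_κ, Δξ = -nκ ξ, |∇c_κ|² = κ(1
- c_κ²), ⟨∇c_κ, ∇ξ⟩ = -κ c_κ ξ and |∇ξ|² = |ω|² - κ ξ². -/
theorem divergence_testField {j : ℕ} {κ : ℝ} (ω : EuclideanSpace ℝ (Fin (j + 2))) {f g : ℝ → ℝ}
    {v : EuclideanSpace ℝ (Fin (j + 2))} (hv : v ≠ 0) (he : snRatio κ v ≠ 0)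
    (hf : ∀ r, ContDiffAt ℝ (⊤ : ℕ∞) f (cs κ r)) (hg : ContDiff ℝ (⊤ : ℕ∞) g) :
    divergence (testField j κ ω f g) v = snRatio κ v ^ (j + 1) *
      testLap (j + 2) κ (‖ω‖ ^ 2) f g (cs κ ‖v‖) (linField κ ω v) := by
  have hv' : ‖v‖ ≠ 0 := norm_ne_zero_iff.2 hv
  have hf1 := fun r => contDiffAt_deriv (hf r)
  have hg1 := contDiff_deriv_top hg
  have hA := (hasFDerivAt_testFn ω hv hf1 hg).const_mul (-κ)
  have hB := hasFDerivAt_testFn ω hv hf hg1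
  have hA' : HasFDerivAt (fun v => -κ * deriv f (cs κ ‖v‖) * g (linField κ ω v)) _ v :=
    hA.congr_of_eventuallyEq (Filter.Eventually.of_forall fun w => by
      simp only [testFn]; ring)
  have hB' : HasFDerivAt (fun v => f (cs κ ‖v‖) * deriv g (linField κ ω v)) _ v := hB
  have dV1 : DifferentiableAt ℝ (radialField j κ) v :=
    (contDiff_radialField κ j).differentiable (by simp) v
  have dV2 : DifferentiableAt ℝ (axialField j κ ω) v :=
    (contDiff_axialField κ ω j).differentiable (by simp) v
  unfold testField
  rw [divergence_add (hA'.differentiableAt.fun_smul dV1) (hB'.differentiableAt.fun_smul dV2),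
    divergence_smul hA'.differentiableAt dV1, divergence_smul hB'.differentiableAt dV2,
    divergence_radialField κ j hv, divergence_axialField κ j ω hv he, hA'.fderiv, hB'.fderiv,
    testLap]
  have e1 := norm_sq_mul_snDefect κ v
  have e2 := cs_sq_add_snRatio κ v
  have e3 : snDefect κ v = (snRatio κ v * cs κ ‖v‖ - 1) / ‖v‖ ^ 2 := by
    rw [← e1]; field_simp
  simp only [radialField, axialField, add_apply, smul_apply,
    innerSL_apply_apply, smul_eq_mul, inner_add_right, real_inner_smul_right, real_inner_self_eq_norm_sq, real_inner_comm ω v]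
  rw [e3]
  generalize deriv (deriv f) (cs κ ‖v‖) = F2
  generalize f (cs κ ‖v‖) = F0
  generalize deriv f (cs κ ‖v‖) = F1
  generalize deriv (deriv g) (linField κ ω v) = G2
  generalize g (linField κ ω v) = G0
  generalize deriv g (linField κ ω v) = G1
  simp only [linField]
  generalize snRatio κ v = e at *
  generalize cs κ ‖v‖ = s at *
  generalize inner ℝ ω v = q
  generalize ‖ω‖ = W
  generalize ‖v‖ = r at *
  have e4 : κ = (1 - s ^ 2) / (e ^ 2 * r ^ 2) := by
    rw [eq_div_iff (by positivity)]; linarith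
  subst e4
  push_cast
  field_simp
  ring

/-! ### The model measures -/

section
variable {j : ℕ} {κ R : ℝ}

theorem modelVol_eq (j : ℕ) (κ R : ℝ) : modelVol (j + 2) κ R =
    (volume.restrict (ball (0 : EuclideanSpace ℝ (Fin (j + 2))) R)).withDensity
      (fun v => ENNReal.ofReal (snRatio κ v ^ (j + 1))) := by
  rw [modelVol]
  refine withDensity_congr_ae (ae_restrict_of_ae ?_)
  have h0 : ∀ᵐ v : EuclideanSpace ℝ (Fin (j + 2)), v ≠ 0 := by
    simp [ae_iff, measure_singleton]
  filter_upwards [h0] with v hv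
  rw [snRatio_eq κ hv]
  rfl

theorem ae_ball_ne_zero (j : ℕ) (R : ℝ) :
    ∀ᵐ v ∂(volume.restrict (ball (0 : EuclideanSpace ℝ (Fin (j + 2))) R)),
      v ∈ ball (0 : EuclideanSpace ℝ (Fin (j + 2))) R ∧ v ≠ 0 := by
  have h0 : ∀ᵐ v : EuclideanSpace ℝ (Fin (j + 2)), v ≠ 0 := by
    simp [ae_iff, measure_singleton]
  filter_upwards [ae_restrict_mem measurableSet_ball, ae_restrict_of_ae h0] with v h1 h2
  exact ⟨h1, h2⟩

theorem continuous_snRatio {n : ℕ} (κ : ℝ) :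
    Continuous (snRatio κ : EuclideanSpace ℝ (Fin n) → ℝ) :=
  (contDiff_snRatio κ).continuous

theorem snRatio_pos_of_mem_ball (hκ : 0 < κ → √κ * R < Real.pi)
    {v : EuclideanSpace ℝ (Fin (j + 2))} (hv : v ∈ ball (0 : EuclideanSpace ℝ (Fin (j + 2))) R) :
    0 < snRatio κ v :=
  snRatio_pos hκ (by simpa using (mem_ball_zero_iff.1 hv).le)

theorem integral_modelVol (hκ : 0 < κ → √κ * R < Real.pi)
    (F : EuclideanSpace ℝ (Fin (j + 2)) → ℝ) :
    ∫ v, F v ∂(modelVol (j + 2) κ R) =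
      ∫ v in ball (0 : EuclideanSpace ℝ (Fin (j + 2))) R, snRatio κ v ^ (j + 1) * F v := by
  rw [modelVol_eq, integral_withDensity_eq_integral_toReal_smul]
  · refine integral_congr_ae ?_
    filter_upwards [ae_ball_ne_zero j R] with v hv
    rw [ENNReal.toReal_ofReal (pow_nonneg (snRatio_pos_of_mem_ball hκ hv.1).le _), smul_eq_mul]
  · exact ((continuous_snRatio κ).pow _).measurable.ennreal_ofReal
  · exact Filter.Eventually.of_forall fun _ => ENNReal.ofReal_lt_top

/-- The density is continuous and positive on the closed ball, since R stays below the first zero of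
s_κ. Hence the weighted and the Euclidean L² spaces agree. -/
theorem exists_modelVol_bounds (hκ : 0 < κ → √κ * R < Real.pi) :
    ∃ c C : ENNReal, c ≠ ⊤ ∧ C ≠ ⊤ ∧
      volume.restrict (ball (0 : EuclideanSpace ℝ (Fin (j + 2))) R) ≤
        c • modelVol (j + 2) κ R ∧
      modelVol (j + 2) κ R ≤
        C • volume.restrict (ball (0 : EuclideanSpace ℝ (Fin (j + 2))) R) := by
  have hcpt := isCompact_closedBall (0 : EuclideanSpace ℝ (Fin (j + 2))) R
  have hcont : ContinuousOn (fun v : EuclideanSpace ℝ (Fin (j + 2)) => snRatio κ v ^ (j + 1))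
    (closedBall 0 R) := ((continuous_snRatio κ).pow _).continuousOn
  have hpos : ∀ v ∈ closedBall (0 : EuclideanSpace ℝ (Fin (j + 2))) R,
      0 < snRatio κ v ^ (j + 1) := fun v hv => pow_pos (snRatio_pos hκ (by simpa using hv)) _
  obtain ⟨a, ha, hab⟩ := hcpt.exists_forall_le' hcont hpos
  obtain ⟨b, hb⟩ := hcpt.bddAbove_image hcont
  refine ⟨ENNReal.ofReal a⁻¹, ENNReal.ofReal b, ENNReal.ofReal_ne_top, ENNReal.ofReal_ne_top,
    ?_, ?_⟩
  · have hm : Measurable fun v : EuclideanSpace ℝ (Fin (j + 2)) =>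
        ENNReal.ofReal (snRatio κ v ^ (j + 1)) :=
      ((continuous_snRatio κ).pow _).measurable.ennreal_ofReal
    rw [modelVol_eq, ← withDensity_smul _ hm]
    conv_lhs => rw [← withDensity_one (μ := volume.restrict (ball _ R))]
    refine withDensity_mono ?_
    filter_upwards [ae_ball_ne_zero j R] with v hv
    simp only [Pi.one_apply, Pi.smul_apply, smul_eq_mul]
    rw [← ENNReal.ofReal_mul (by positivity), ← ENNReal.ofReal_one]
    refine ENNReal.ofReal_le_ofReal ?_
    rw [inv_mul_eq_div, le_div_iff₀ ha, one_mul]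
    exact hab v (ball_subset_closedBall hv.1)
  · rw [modelVol_eq, ← withDensity_const]
    refine withDensity_mono ?_
    filter_upwards [ae_ball_ne_zero j R] with v hv
    exact ENNReal.ofReal_le_ofReal (hb ⟨v, ball_subset_closedBall hv.1, rfl⟩)

theorem isFiniteMeasure_modelVol (hκ : 0 < κ → √κ * R < Real.pi) :
    IsFiniteMeasure (modelVol (j + 2) κ R) := by
  obtain ⟨c, C, -, hC, -, h⟩ := exists_modelVol_bounds (j := j) hκ
  refine ⟨(h univ).trans_lt ?_⟩
  simp only [Measure.smul_apply, smul_eq_mul, Measure.restrict_apply_univ]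
  exact ENNReal.mul_lt_top hC.lt_top measure_ball_lt_top

theorem isFiniteMeasure_modelArea (n : ℕ) (κ R : ℝ) : IsFiniteMeasure (modelArea n κ R) := by
  refine ⟨?_⟩
  rw [modelArea, Measure.smul_apply, smul_eq_mul]
  exact ENNReal.mul_lt_top ENNReal.ofReal_lt_top (measure_lt_top _ _)

theorem modelVol_absolutelyContinuous (n : ℕ) (κ R : ℝ) :
    modelVol n κ R ≪ volume.restrict (ball (0 : EuclideanSpace ℝ (Fin n)) R) :=
  withDensity_absolutelyContinuous _ _

theorem absolutelyContinuous_modelVol (hκ : 0 < κ → √κ * R < Real.pi) :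
    volume.restrict (ball (0 : EuclideanSpace ℝ (Fin (j + 2))) R) ≪ modelVol (j + 2) κ R := by
  obtain ⟨c, C, -, -, h, -⟩ := exists_modelVol_bounds (j := j) hκ
  exact (Measure.absolutelyContinuous_of_le_smul h)

theorem MemLp_restrict_of_modelVol (hκ : 0 < κ → √κ * R < Real.pi) {G : Type*}
    [NormedAddCommGroup G] {F : EuclideanSpace ℝ (Fin (j + 2)) → G} {p : ENNReal}
    (hF : MemLp F p (modelVol (j + 2) κ R)) :
    MemLp F p (volume.restrict (ball 0 R)) := by
  obtain ⟨c, C, hc, -, h, -⟩ := exists_modelVol_bounds (j := j) hκ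
  exact hF.of_measure_le_smul hc h

theorem ae_modelVol_mem (j : ℕ) (κ R : ℝ) : ∀ᵐ v ∂(modelVol (j + 2) κ R),
    v ∈ ball (0 : EuclideanSpace ℝ (Fin (j + 2))) R ∧ v ≠ 0 :=
  (modelVol_absolutelyContinuous _ _ _).ae_le (ae_ball_ne_zero j R)

theorem memLp_modelVol_of_continuous (hκ : 0 < κ → √κ * R < Real.pi) {G : Type*}
    [NormedAddCommGroup G] [SecondCountableTopology G] {F : EuclideanSpace ℝ (Fin (j + 2)) → G}
    {p : ENNReal} (hF : Continuous F) : MemLp F p (modelVol (j + 2) κ R) := by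
  have := isFiniteMeasure_modelVol (j := j) hκ
  obtain ⟨b, hb⟩ := (isCompact_closedBall (0 : EuclideanSpace ℝ (Fin (j + 2))) R).bddAbove_image
    hF.norm.continuousOn
  refine MemLp.of_bound hF.aestronglyMeasurable b ?_
  filter_upwards [ae_modelVol_mem j κ R] with v hv
  exact hb ⟨v, ball_subset_closedBall hv.1, rfl⟩

theorem memLp_modelArea_of_continuous {n : ℕ}
    {F : sphere (0 : EuclideanSpace ℝ (Fin n)) 1 → ℝ} {p : ENNReal} (hF : Continuous F) :
    MemLp F p (modelArea n κ R) := by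
  have := isFiniteMeasure_modelArea n κ R
  obtain ⟨b, hb⟩ := (isCompact_univ (X := sphere (0 : EuclideanSpace ℝ (Fin n)) 1)).bddAbove_image
    hF.norm.continuousOn
  exact MemLp.of_bound hF.aestronglyMeasurable b
    (Filter.Eventually.of_forall fun v => hb ⟨v, mem_univ _, rfl⟩)

theorem integral_modelArea {n : ℕ} (hs : 0 ≤ sn κ R)
    (F : sphere (0 : EuclideanSpace ℝ (Fin n)) 1 → ℝ) :
    ∫ θ, F θ ∂(modelArea n κ R) = sn κ R ^ (n - 1) *
      ∫ θ, F θ ∂(volume : Measure (EuclideanSpace ℝ (Fin n))).toSphere := by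
  rw [modelArea, integral_smul_measure, ENNReal.toReal_ofReal (pow_nonneg hs _), smul_eq_mul]

theorem MemLp_toSphere_of_modelArea {n : ℕ} (hs : 0 < sn κ R)
    {F : sphere (0 : EuclideanSpace ℝ (Fin n)) 1 → ℝ} {p : ENNReal}
    (hF : MemLp F p (modelArea n κ R)) :
    MemLp F p (volume : Measure (EuclideanSpace ℝ (Fin n))).toSphere := by
  refine hF.of_measure_le_smul (c := (ENNReal.ofReal (sn κ R ^ (n - 1)))⁻¹) ?_ ?_
  · simpa using pow_pos hs _
  · rw [modelArea, smul_smul, ENNReal.inv_mul_cancel (by simpa using pow_pos hs _)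
      ENNReal.ofReal_ne_top, one_smul]

end

/-! ### The space `H¹` -/

section
variable {j : ℕ} {κ R : ℝ}

theorem continuous_divergence {n : ℕ} {X : EuclideanSpace ℝ (Fin n) → EuclideanSpace ℝ (Fin n)}
    (hX : ContDiff ℝ 1 X) : Continuous (divergence X) := by
  refine continuous_finsetSum _ fun i _ => ?_
  have := (hX.continuous_fderiv (by simp)).clm_apply
    (continuous_const (y := (EuclideanSpace.single i (1 : ℝ) : EuclideanSpace ℝ (Fin n))))
  fun_prop

theorem continuous_gradient {n : ℕ} {ψ : EuclideanSpace ℝ (Fin n) → ℝ} (hψ : ContDiff ℝ 1 ψ) :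
    Continuous (gradient ψ) :=
  (InnerProductSpace.toDual ℝ _).symm.continuous.comp (hψ.continuous_fderiv (by simp))

/-- A continuously differentiable function as an element of `H¹`. -/
def smoothH1 (hκ : 0 < κ → √κ * R < Real.pi) (hR : 0 < R)
    (ψ : EuclideanSpace ℝ (Fin (j + 2)) → ℝ) (hψ : ContDiff ℝ 1 ψ) : ModelH1 (j + 2) κ R where
  fn := ψ
  grad := gradient ψ
  trace θ := ψ (R • (θ : EuclideanSpace ℝ (Fin (j + 2))))
  memLp_fn := memLp_modelVol_of_continuous hκ hψ.continuous
  memLp_grad := memLp_modelVol_of_continuous hκ (continuous_gradient hψ)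
  memLp_trace := memLp_modelArea_of_continuous (by have := hψ.continuous; fun_prop)
  green X hX := by
    have h := integral_divergence_ball (Nat.succ_pos _) hR (hψ.smul hX)
    have e : ∀ v, divergence (ψ • X) v = ψ v * divergence X v + inner ℝ (gradient ψ v) (X v) := by
      intro v
      rw [inner_gradient_left]
      exact divergence_smul (hψ.differentiable (by simp) v) (hX.differentiable (by simp) v)
    simp only [e] at h
    rw [h]
    simp only [Pi.smul_apply', real_inner_smul_left]

theorem integrable_inner_of_memLp {α : Type*} [MeasurableSpace α] {μ : Measure α} {n : ℕ}
    {a b : α → EuclideanSpace ℝ (Fin n)} (ha : MemLp a 2 μ) (hb : MemLp b 2 μ) :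
    Integrable (fun v => inner ℝ (a v) (b v)) μ := by
  refine (ha.norm.integrable_mul hb.norm).mono' (ha.1.inner hb.1)
    (Filter.Eventually.of_forall fun v => ?_)
  exact norm_inner_le_norm _ _

theorem ModelH1.integrable_green (hκ : 0 < κ → √κ * R < Real.pi) (φ : ModelH1 (j + 2) κ R)
    {X : EuclideanSpace ℝ (Fin (j + 2)) → EuclideanSpace ℝ (Fin (j + 2))}
    (hX : ContDiff ℝ 1 X) :
    IntegrableOn (fun v => φ.fn v * divergence X v) (ball 0 R) ∧
    IntegrableOn (fun v => inner ℝ (φ.grad v) (X v)) (ball 0 R) := by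
  have h1 := (MemLp_restrict_of_modelVol hκ φ.memLp_fn)
  have h2 := (MemLp_restrict_of_modelVol hκ φ.memLp_grad)
  have h3 : MemLp (divergence X) 2
      (volume.restrict (ball (0 : EuclideanSpace ℝ (Fin (j + 2))) R)) :=
    MemLp_restrict_of_modelVol hκ (memLp_modelVol_of_continuous hκ (continuous_divergence hX))
  have h4 : MemLp X 2 (volume.restrict (ball (0 : EuclideanSpace ℝ (Fin (j + 2))) R)) :=
    MemLp_restrict_of_modelVol hκ (memLp_modelVol_of_continuous hκ hX.continuous)
  exact ⟨h1.integrable_mul h3, integrable_inner_of_memLp h2 h4⟩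

theorem ModelH1.integrable_green_trace (hs : 0 < sn κ R) (φ : ModelH1 (j + 2) κ R)
    {X : EuclideanSpace ℝ (Fin (j + 2)) → EuclideanSpace ℝ (Fin (j + 2))}
    (hX : ContDiff ℝ 1 X) :
    Integrable (fun θ : sphere (0 : EuclideanSpace ℝ (Fin (j + 2))) 1 => φ.trace θ *
      inner ℝ (X (R • (θ : EuclideanSpace ℝ (Fin (j + 2))))) (θ : EuclideanSpace ℝ (Fin (j + 2))))
      (volume : Measure (EuclideanSpace ℝ (Fin (j + 2)))).toSphere := by
  have h3 : MemLp (fun θ : sphere (0 : EuclideanSpace ℝ (Fin (j + 2))) 1 =>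
      inner ℝ (X (R • (θ : EuclideanSpace ℝ (Fin (j + 2))))) (θ : EuclideanSpace ℝ (Fin (j + 2))))
      2 (modelArea (j + 2) κ R) :=
    memLp_modelArea_of_continuous (by have := hX.continuous; fun_prop)
  exact (MemLp_toSphere_of_modelArea hs φ.memLp_trace).integrable_mul
    (MemLp_toSphere_of_modelArea hs h3)

/-- The element `φ + a ψ` of `H¹`. -/
def ModelH1.addSmul (hκ : 0 < κ → √κ * R < Real.pi) (hs : 0 < sn κ R)
    (φ ψ : ModelH1 (j + 2) κ R) (a : ℝ) : ModelH1 (j + 2) κ R where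
  fn v := φ.fn v + a * ψ.fn v
  grad v := φ.grad v + a • ψ.grad v
  trace θ := φ.trace θ + a * ψ.trace θ
  memLp_fn := φ.memLp_fn.add (ψ.memLp_fn.const_mul a)
  memLp_grad := φ.memLp_grad.add (ψ.memLp_grad.const_smul a)
  memLp_trace := φ.memLp_trace.add (ψ.memLp_trace.const_mul a)
  green X hX := by
    have h1 := φ.integrable_green hκ hX
    have h2 := ψ.integrable_green hκ hX
    have e1 : ∀ v, (φ.fn v + a * ψ.fn v) * divergence X v +
        inner ℝ (φ.grad v + a • ψ.grad v) (X v) =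
        (φ.fn v * divergence X v + inner ℝ (φ.grad v) (X v)) +
        a * (ψ.fn v * divergence X v + inner ℝ (ψ.grad v) (X v)) := by
      intro v
      rw [inner_add_left, real_inner_smul_left]
      ring
    have i1 : IntegrableOn (fun v => φ.fn v * divergence X v + inner ℝ (φ.grad v) (X v))
        (ball 0 R) := h1.1.add h1.2
    have i2 : IntegrableOn (fun v => a * (ψ.fn v * divergence X v + inner ℝ (ψ.grad v) (X v)))
        (ball 0 R) := (h2.1.add h2.2).const_mul a
    simp only [e1]
    simp only [add_mul _ _ (inner ℝ _ _), mul_assoc a]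
    rw [integral_add i1 i2, integral_const_mul,
      φ.green X hX, ψ.green X hX, integral_add (φ.integrable_green_trace hs hX)
        ((ψ.integrable_green_trace hs hX).const_mul a), integral_const_mul]
    ring

theorem modelInner_comm {n : ℕ} (κ : ℝ) (v a b : EuclideanSpace ℝ (Fin n)) :
    modelInner κ v a b = modelInner κ v b a := by
  rw [modelInner, modelInner, real_inner_comm b a]
  ring

theorem robinForm_comm {n : ℕ} {β : ℝ} (φ ψ : ModelH1 n κ R) :
    robinForm β φ ψ = robinForm β ψ φ := by
  simp only [robinForm, modelInner_comm κ _ (φ.grad _), mul_comm (φ.fn _), mul_comm (φ.trace _)]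

/-- The radial part is a product of L² functions; the angular part carries the factor (r/s_κ)²,
which is bounded on the closed ball. -/
theorem integrable_modelInner (hκ : 0 < κ → √κ * R < Real.pi)
    {a b : EuclideanSpace ℝ (Fin (j + 2)) → EuclideanSpace ℝ (Fin (j + 2))}
    (ha : MemLp a 2 (modelVol (j + 2) κ R)) (hb : MemLp b 2 (modelVol (j + 2) κ R)) :
    Integrable (fun v => modelInner κ v (a v) (b v)) (modelVol (j + 2) κ R) := by
  set μ := modelVol (j + 2) κ R
  have hu : ∀ v : EuclideanSpace ℝ (Fin (j + 2)), ‖‖v‖⁻¹ • v‖ ≤ 1 := by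
    intro v
    rw [norm_smul, norm_inv, norm_norm]
    exact inv_mul_le_one
  have hmeas : AEStronglyMeasurable (fun v : EuclideanSpace ℝ (Fin (j + 2)) => ‖v‖⁻¹ • v) μ :=
    Measurable.aestronglyMeasurable (by fun_prop)
  have hr : ∀ {c : EuclideanSpace ℝ (Fin (j + 2)) → EuclideanSpace ℝ (Fin (j + 2))},
      MemLp c 2 μ → MemLp (fun v => inner ℝ (c v) (‖v‖⁻¹ • v)) 2 μ := by
    intro c hc
    refine hc.mono (hc.aestronglyMeasurable.inner hmeas) (Filter.Eventually.of_forall fun v => ?_)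
    refine (norm_inner_le_norm _ _).trans ?_
    exact mul_le_of_le_one_right (norm_nonneg _) (hu v)
  have h1 := (hr ha).integrable_mul (hr hb)
  have h2 := (integrable_inner_of_memLp ha hb).sub h1
  have hcpt := isCompact_closedBall (0 : EuclideanSpace ℝ (Fin (j + 2))) R
  obtain ⟨C, hC⟩ := hcpt.bddAbove_image (f := fun v => ‖((snRatio κ v)⁻¹) ^ 2‖)
    (ContinuousOn.norm (ContinuousOn.pow (ContinuousOn.inv₀ (continuous_snRatio κ).continuousOn
      fun v hv => (snRatio_pos hκ (by simpa using hv)).ne') 2))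
  have hsn : Measurable (sn κ) := (continuous_sn κ).measurable
  have h3 : Integrable (fun v => (‖v‖ / sn κ ‖v‖) ^ 2 *
      (inner ℝ (a v) (b v) - inner ℝ (a v) (‖v‖⁻¹ • v) * inner ℝ (b v) (‖v‖⁻¹ • v))) μ := by
    refine Integrable.bdd_mul (c := C) h2 ?_ ?_
    · exact Measurable.aestronglyMeasurable
        ((measurable_norm.div (hsn.comp measurable_norm)).pow_const 2)
    · filter_upwards [ae_modelVol_mem j κ R] with v hv
      rw [show ‖v‖ / sn κ ‖v‖ = (snRatio κ v)⁻¹ by rw [snRatio_eq κ hv.2, inv_div]]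
      exact hC ⟨v, ball_subset_closedBall hv.1, rfl⟩
  exact h1.add h3

theorem modelInner_add_smul {n : ℕ} (v a b b' : EuclideanSpace ℝ (Fin n)) (t : ℝ) :
    modelInner κ v a (b + t • b') = modelInner κ v a b + t * modelInner κ v a b' := by
  simp only [modelInner, inner_add_left, inner_add_right, real_inner_smul_left,
    real_inner_smul_right]
  ring

theorem robinForm_addSmul (hκ : 0 < κ → √κ * R < Real.pi) (hs : 0 < sn κ R) (β : ℝ)
    (φ ψ χ : ModelH1 (j + 2) κ R) (a : ℝ) :
    robinForm β φ (ψ.addSmul hκ hs χ a) = robinForm β φ ψ + a * robinForm β φ χ := by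
  have i1 : Integrable (fun v => φ.fn v * ψ.fn v) (modelVol (j + 2) κ R) :=
    φ.memLp_fn.integrable_mul ψ.memLp_fn
  have i2 : Integrable (fun v => a * (φ.fn v * χ.fn v)) (modelVol (j + 2) κ R) :=
    (φ.memLp_fn.integrable_mul χ.memLp_fn).const_mul a
  have i3 : Integrable (fun θ => φ.trace θ * ψ.trace θ) (modelArea (j + 2) κ R) :=
    φ.memLp_trace.integrable_mul ψ.memLp_trace
  have i4 : Integrable (fun θ => a * (φ.trace θ * χ.trace θ)) (modelArea (j + 2) κ R) :=
    (φ.memLp_trace.integrable_mul χ.memLp_trace).const_mul a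
  simp only [robinForm, ModelH1.addSmul, modelInner_add_smul, mul_add, mul_left_comm _ a]
  rw [integral_add (integrable_modelInner hκ φ.memLp_grad ψ.memLp_grad)
      ((integrable_modelInner hκ φ.memLp_grad χ.memLp_grad).const_mul a),
    integral_add i1 i2, integral_add i3 i4,
    integral_const_mul, integral_const_mul, integral_const_mul]
  ring

end

/-! ### The weak formulation against test functions -/

section
variable {j : ℕ} {κ R β : ℝ}

/-- The Robin boundary operator `∂_ν - β` applied to `testFn κ ω f g`, at a boundary point with
`⟨ω, θ⟩ = q`. -/
def testBdry (κ R β : ℝ) (f g : ℝ → ℝ) (q : ℝ) : ℝ :=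
  -(κ * sn κ R * deriv f (cs κ R) * g (sn κ R * q)) +
    f (cs κ R) * deriv g (sn κ R * q) * (cs κ R * q) - β * (f (cs κ R) * g (sn κ R * q))

theorem linField_smul_sphere {n : ℕ} (hR : 0 < R) (ω : EuclideanSpace ℝ (Fin n))
    {θ : EuclideanSpace ℝ (Fin n)} (hθ : ‖θ‖ = 1) :
    linField κ ω (R • θ) = sn κ R * inner ℝ ω θ := by
  have hn : ‖R • θ‖ = R := by rw [norm_smul, hθ, mul_one, Real.norm_of_nonneg hR.le]
  have e2 := norm_mul_snRatio κ (R • θ)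
  rw [hn] at e2
  rw [linField, real_inner_smul_right, ← e2]
  ring

theorem testFn_smul_sphere {n : ℕ} (hR : 0 < R) (ω : EuclideanSpace ℝ (Fin n)) (f g : ℝ → ℝ)
    {θ : EuclideanSpace ℝ (Fin n)} (hθ : ‖θ‖ = 1) :
    testFn κ ω f g (R • θ) = f (cs κ R) * g (sn κ R * inner ℝ ω θ) := by
  rw [testFn, linField_smul_sphere hR ω hθ, norm_smul, hθ, mul_one, Real.norm_of_nonneg hR.le]

theorem continuous_testLap {n : ℕ} (N : ℕ) (W : ℝ) (ω : EuclideanSpace ℝ (Fin n)) {f g : ℝ → ℝ}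
    (hf : ∀ r, ContDiffAt ℝ (⊤ : ℕ∞) f (cs κ r)) (hg : ContDiff ℝ (⊤ : ℕ∞) g) :
    Continuous fun v : EuclideanSpace ℝ (Fin n) => testLap N κ W f g (cs κ ‖v‖) (linField κ ω v) := by
  have hf1 := fun r => contDiffAt_deriv (hf r)
  have hf2 := fun r => contDiffAt_deriv (hf1 r)
  have hg1 := contDiff_deriv_top hg
  have c0 := (contDiff_comp_cs (n := n) hf).continuous
  have c1 := (contDiff_comp_cs (n := n) hf1).continuous
  have c2 := (contDiff_comp_cs (n := n) hf2).continuous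
  have d0 := (contDiff_comp_linField (κ := κ) ω hg).continuous
  have d1 := (contDiff_comp_linField (κ := κ) ω hg1).continuous
  have d2 := (contDiff_comp_linField (κ := κ) ω (contDiff_deriv_top hg1)).continuous
  have s := (contDiff_cs_norm (n := n) κ).continuous
  have l := (contDiff_linField κ ω).continuous
  exact (((continuous_const.mul (((continuous_const.sub (s.pow 2)).mul c2).sub
    ((continuous_const.mul s).mul c1))).mul d0).sub
      ((((continuous_const.mul s).mul l).mul c1).mul d1)).add
    (c0.mul ((d2.mul (continuous_const.sub (continuous_const.mul (l.pow 2)))).sub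
      ((continuous_const.mul l).mul d1)))

/-- All derivatives are moved to the test function by `green` with X = `testField`. From here on φ
enters only through its values and its trace. -/
theorem robinForm_testFn (hκ : 0 < κ → √κ * R < Real.pi) (hR : 0 < R) (φ : ModelH1 (j + 2) κ R)
    (ω : EuclideanSpace ℝ (Fin (j + 2))) {f g : ℝ → ℝ}
    (hf : ∀ r, ContDiffAt ℝ (⊤ : ℕ∞) f (cs κ r)) (hg : ContDiff ℝ (⊤ : ℕ∞) g) (β : ℝ)
    (h1 : ContDiff ℝ 1 (testFn κ ω f g)) :
    robinForm β φ (smoothH1 hκ hR (testFn κ ω f g) h1) =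
      ∫ θ : sphere (0 : EuclideanSpace ℝ (Fin (j + 2))) 1,
        φ.trace θ * testBdry κ R β f g (inner ℝ ω (θ : EuclideanSpace ℝ (Fin (j + 2))))
          ∂(modelArea (j + 2) κ R) -
      ∫ v, φ.fn v * (testLap (j + 2) κ (‖ω‖ ^ 2) f g (cs κ ‖v‖) (linField κ ω v) +
        (j + 2) * κ * testFn κ ω f g v) ∂(modelVol (j + 2) κ R) := by
  have hs : 0 < sn κ R := sn_pos hκ hR le_rfl
  have hX : ContDiff ℝ 1 (testField j κ ω f g) := (contDiff_testField ω j hf hg).of_le (by simp)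
  have I1 : ∫ v, modelInner κ v (φ.grad v) (gradient (testFn κ ω f g) v)
      ∂(modelVol (j + 2) κ R) =
      ∫ v in ball (0 : EuclideanSpace ℝ (Fin (j + 2))) R,
        inner ℝ (φ.grad v) (testField j κ ω f g v) := by
    rw [integral_modelVol hκ]
    refine integral_congr_ae ?_
    filter_upwards [ae_ball_ne_zero j R] with v hv
    rw [← modelInner_gradient_testFn ω j hv.2 (snRatio_pos_of_mem_ball hκ hv.1).ne' hf hg,
      snRatio_eq κ hv.2]
  have I2 : ∫ v in ball (0 : EuclideanSpace ℝ (Fin (j + 2))) R,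
        φ.fn v * divergence (testField j κ ω f g) v =
      ∫ v, φ.fn v * testLap (j + 2) κ (‖ω‖ ^ 2) f g (cs κ ‖v‖) (linField κ ω v)
        ∂(modelVol (j + 2) κ R) := by
    rw [integral_modelVol hκ]
    refine integral_congr_ae ?_
    filter_upwards [ae_ball_ne_zero j R] with v hv
    rw [divergence_testField ω hv.2 (snRatio_pos_of_mem_ball hκ hv.1).ne' hf hg]
    ring
  have hg1 := φ.green _ hX
  have hi := φ.integrable_green hκ hX
  rw [integral_add hi.1 hi.2, I2, ← I1] at hg1
  have I3 : Integrable (fun v => φ.fn v * testLap (j + 2) κ (‖ω‖ ^ 2) f g (cs κ ‖v‖)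
      (linField κ ω v)) (modelVol (j + 2) κ R) :=
    φ.memLp_fn.integrable_mul
      (memLp_modelVol_of_continuous (p := 2) hκ (continuous_testLap (j + 2) _ ω hf hg))
  have I4 : Integrable (fun v => φ.fn v * testFn κ ω f g v) (modelVol (j + 2) κ R) :=
    φ.memLp_fn.integrable_mul
      (memLp_modelVol_of_continuous (p := 2) hκ (contDiff_testFn ω hf hg).continuous)
  have I5 : ∫ v, φ.fn v * (testLap (j + 2) κ (‖ω‖ ^ 2) f g (cs κ ‖v‖) (linField κ ω v) +
        (j + 2) * κ * testFn κ ω f g v) ∂(modelVol (j + 2) κ R) =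
      ∫ v, φ.fn v * testLap (j + 2) κ (‖ω‖ ^ 2) f g (cs κ ‖v‖) (linField κ ω v)
        ∂(modelVol (j + 2) κ R) +
      (j + 2) * κ * ∫ v, φ.fn v * testFn κ ω f g v ∂(modelVol (j + 2) κ R) := by
    rw [← integral_const_mul, ← integral_add I3 (I4.const_mul _)]
    refine integral_congr_ae (Filter.Eventually.of_forall fun v => ?_)
    ring
  have hnorm : ∀ θ : sphere (0 : EuclideanSpace ℝ (Fin (j + 2))) 1,
      ‖(θ : EuclideanSpace ℝ (Fin (j + 2)))‖ = 1 := fun θ => by simp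
  have J1 : Integrable (fun θ : sphere (0 : EuclideanSpace ℝ (Fin (j + 2))) 1 =>
      φ.trace θ * testFn κ ω f g (R • (θ : EuclideanSpace ℝ (Fin (j + 2)))))
      (volume : Measure (EuclideanSpace ℝ (Fin (j + 2)))).toSphere :=
    (MemLp_toSphere_of_modelArea hs φ.memLp_trace).integrable_mul
      (MemLp_toSphere_of_modelArea hs (memLp_modelArea_of_continuous (p := 2) (by
        have := (contDiff_testFn ω hf hg).continuous; fun_prop)))
  have J2 := φ.integrable_green_trace hs hX
  have J3 : R ^ (j + 2 - 1) * ∫ θ : sphere (0 : EuclideanSpace ℝ (Fin (j + 2))) 1,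
        φ.trace θ * inner ℝ (testField j κ ω f g (R • (θ : EuclideanSpace ℝ (Fin (j + 2)))))
          (θ : EuclideanSpace ℝ (Fin (j + 2)))
          ∂(volume : Measure (EuclideanSpace ℝ (Fin (j + 2)))).toSphere -
      β * ∫ θ : sphere (0 : EuclideanSpace ℝ (Fin (j + 2))) 1,
        φ.trace θ * testFn κ ω f g (R • (θ : EuclideanSpace ℝ (Fin (j + 2))))
          ∂(modelArea (j + 2) κ R) =
      ∫ θ : sphere (0 : EuclideanSpace ℝ (Fin (j + 2))) 1,
        φ.trace θ * testBdry κ R β f g (inner ℝ ω (θ : EuclideanSpace ℝ (Fin (j + 2))))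
          ∂(modelArea (j + 2) κ R) := by
    rw [integral_modelArea hs.le, integral_modelArea hs.le, mul_left_comm β,
      ← integral_const_mul, ← integral_const_mul, ← integral_const_mul, ← integral_const_mul,
      ← integral_sub (J2.const_mul _) ((J1.const_mul β).const_mul _)]
    refine integral_congr_ae (Filter.Eventually.of_forall fun θ => ?_)
    have h := inner_testField_sphere (κ := κ) (f := f) (g := g) ω j hR (hnorm θ)
    have h2 := testFn_smul_sphere (κ := κ) hR ω f g (hnorm θ)
    simp only [show j + 2 - 1 = j + 1 from rfl, h2, testBdry]
    linear_combination (φ.trace θ) * h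
  rw [show j + 2 - 1 = j + 1 from rfl] at hg1 J3
  rw [robinForm]
  simp only [smoothH1]
  rw [← J3, I5]
  push_cast
  linarith

end


/-! ### The Lagrange multipliers -/

section
variable {j : ℕ} {κ R β : ℝ}

/-- (κ c_κ)' = -κ² s_κ is negative for either sign of the curvature, so the factor κ treats both
cases at once. -/
theorem kappa_mul_cs_lt (hκ0 : κ ≠ 0) (hκ : 0 < κ → √κ * R < Real.pi) {r : ℝ} (hr : 0 ≤ r)
    (hrR : r < R) : κ * cs κ R < κ * cs κ r := by
  have h : StrictAntiOn (fun r => κ * cs κ r) (Icc 0 R) := by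
    refine strictAntiOn_of_deriv_neg (convex_Icc 0 R)
      ((continuous_const.mul (continuous_cs κ)).continuousOn) fun x hx => ?_
    rw [interior_Icc] at hx
    rw [((hasDerivAt_cs κ x).const_mul κ).deriv]
    have := mul_pos (pow_pos (abs_pos.2 hκ0) 2) (sn_pos hκ hx.1 hx.2.le)
    rw [sq_abs] at this
    linarith
  exact h ⟨hr, hrR.le⟩ ⟨hr.trans hrR.le, le_rfl⟩ hrR

theorem modelVol_ne_zero (hκ : 0 < κ → √κ * R < Real.pi) (hR : 0 < R) :
    modelVol (j + 2) κ R ≠ 0 := by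
  intro h
  have := absolutelyContinuous_modelVol (j := j) hκ
  rw [h] at this
  have h2 := this (s := univ) (by simp)
  rw [Measure.restrict_apply_univ] at h2
  exact (measure_ball_pos volume _ hR).ne' h2

theorem integral_pos_of_ae_pos {α : Type*} [MeasurableSpace α] {μ : Measure α} (hμ : μ ≠ 0)
    {f : α → ℝ} (hf : Integrable f μ) (h : ∀ᵐ x ∂μ, 0 < f x) : 0 < ∫ x, f x ∂μ := by
  have h0 : 0 ≤ᵐ[μ] f := h.mono fun x hx => hx.le
  refine lt_of_le_of_ne (integral_nonneg_of_ae h0) fun h1 => hμ ?_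
  have h2 := (integral_eq_zero_iff_of_nonneg_ae h0 hf).1 h1.symm
  have h3 : ∀ᵐ x ∂μ, False := by
    filter_upwards [h, h2] with x hx hx2
    exact hx.ne' hx2
  exact ae_eq_bot.1 (Filter.eventually_false_iff_eq_bot.1 h3)

theorem integral_cs_sub_pos (hκ0 : κ ≠ 0) (hκ : 0 < κ → √κ * R < Real.pi) (hR : 0 < R) :
    0 < ∫ v, κ * (cs κ ‖v‖ - cs κ R) ∂(modelVol (j + 2) κ R) := by
  have := isFiniteMeasure_modelVol (j := j) hκ
  refine integral_pos_of_ae_pos (modelVol_ne_zero hκ hR) ?_ ?_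
  · refine memLp_one_iff_integrable.1 (memLp_modelVol_of_continuous hκ ?_)
    exact continuous_const.mul ((contDiff_cs_norm κ).continuous.sub continuous_const)
  · filter_upwards [ae_modelVol_mem j κ R] with v hv
    have := kappa_mul_cs_lt hκ0 hκ (norm_nonneg v) (mem_ball_zero_iff.1 hv.1)
    linarith

theorem contDiffAt_one_top (r : ℝ) :
    ContDiffAt ℝ (⊤ : ℕ∞) (fun _ : ℝ => (1 : ℝ)) (cs κ r) := contDiffAt_const

theorem contDiffAt_id_top (r : ℝ) :
    ContDiffAt ℝ (⊤ : ℕ∞) (fun s : ℝ => s) (cs κ r) := contDiffAt_id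

theorem contDiff_one_top : ContDiff ℝ (⊤ : ℕ∞) (fun _ : ℝ => (1 : ℝ)) := contDiff_const

theorem contDiff_id_top : ContDiff ℝ (⊤ : ℕ∞) (fun s : ℝ => s) := contDiff_id

/-- The constant function one as an element of `H¹`. -/
def oneH1 (j : ℕ) (hκ : 0 < κ → √κ * R < Real.pi) (hR : 0 < R) : ModelH1 (j + 2) κ R :=
  smoothH1 hκ hR (testFn κ 0 (fun _ => 1) (fun _ => 1))
    ((contDiff_testFn 0 contDiffAt_one_top contDiff_one_top).of_le (by simp))

/-- The function `c_κ(r)` as an element of `H¹`. -/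
def csH1 (j : ℕ) (hκ : 0 < κ → √κ * R < Real.pi) (hR : 0 < R) : ModelH1 (j + 2) κ R :=
  smoothH1 hκ hR (testFn κ 0 (fun s => s) (fun _ => 1))
    ((contDiff_testFn 0 contDiffAt_id_top contDiff_one_top).of_le (by simp))

/-- The function `s_κ(r) ⟨ω, θ⟩` as an element of `H¹`. -/
def linH1 (hκ : 0 < κ → √κ * R < Real.pi) (hR : 0 < R) (ω : EuclideanSpace ℝ (Fin (j + 2))) :
    ModelH1 (j + 2) κ R :=
  smoothH1 hκ hR (testFn κ ω (fun _ => 1) (fun s => s))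
    ((contDiff_testFn ω contDiffAt_one_top contDiff_id_top).of_le (by simp))

theorem robinForm_one (hκ : 0 < κ → √κ * R < Real.pi) (hR : 0 < R) (φ : ModelH1 (j + 2) κ R) :
    robinForm β φ (oneH1 j hκ hR) =
      -(j + 2) * κ * ∫ v, φ.fn v ∂(modelVol (j + 2) κ R) -
        β * ∫ θ, φ.trace θ ∂(modelArea (j + 2) κ R) := by
  rw [oneH1, robinForm_testFn hκ hR φ 0 contDiffAt_one_top contDiff_one_top]
  simp only [testBdry, testLap, testFn, deriv_const', mul_zero, zero_mul, mul_one, neg_zero,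
    zero_sub, zero_add, sub_zero, add_zero, mul_neg, integral_mul_const, integral_neg]
  ring

/-- c_κ solves Δu + nκu = 0, so only the boundary term remains, and it is a multiple of the boundary
mean. -/
theorem robinForm_cs (hκ : 0 < κ → √κ * R < Real.pi) (hR : 0 < R) (φ : ModelH1 (j + 2) κ R) :
    robinForm β φ (csH1 j hκ hR) =
      (-κ * sn κ R - β * cs κ R) * ∫ θ, φ.trace θ ∂(modelArea (j + 2) κ R) := by
  rw [csH1, robinForm_testFn hκ hR φ 0 contDiffAt_id_top contDiff_one_top]
  have h1 : deriv (fun s : ℝ => s) = fun _ => 1 := by ext x; simp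
  have h2 : ∀ v : EuclideanSpace ℝ (Fin (j + 2)), φ.fn v *
      (testLap (j + 2) κ (‖(0 : EuclideanSpace ℝ (Fin (j + 2)))‖ ^ 2) (fun s => s) (fun _ => 1)
        (cs κ ‖v‖) (linField κ 0 v) + (j + 2) * κ * testFn κ 0 (fun s => s) (fun _ => 1) v) = 0 := by
    intro v
    simp only [testLap, testFn, h1, deriv_const']
    push_cast
    ring
  have h3 : ∀ q, testBdry κ R β (fun s => s) (fun _ => 1) q = -κ * sn κ R - β * cs κ R := by
    intro q
    simp only [testBdry, h1, deriv_const']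
    ring
  simp only [h2, integral_zero, h3]
  rw [integral_mul_const]
  ring

/-- s_κ⟨ω, θ⟩ solves Δu + nκu = 0, and β s_κ(R) = c_κ(R) is exactly its Robin condition. -/
theorem robinForm_lin (hκ : 0 < κ → √κ * R < Real.pi) (hR : 0 < R)
    (hβ : β * sn κ R = cs κ R) (φ : ModelH1 (j + 2) κ R) (ω : EuclideanSpace ℝ (Fin (j + 2))) :
    robinForm β φ (linH1 hκ hR ω) = 0 := by
  rw [linH1, robinForm_testFn hκ hR φ ω contDiffAt_one_top contDiff_id_top]
  have h1 : deriv (fun s : ℝ => s) = fun _ => 1 := by ext x; simp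
  have h2 : ∀ v : EuclideanSpace ℝ (Fin (j + 2)), φ.fn v *
      (testLap (j + 2) κ (‖ω‖ ^ 2) (fun _ => 1) (fun s => s)
        (cs κ ‖v‖) (linField κ ω v) + (j + 2) * κ * testFn κ ω (fun _ => 1) (fun s => s) v) = 0 := by
    intro v
    simp only [testLap, testFn, h1, deriv_const']
    push_cast
    ring
  have h3 : ∀ q, testBdry κ R β (fun _ => 1) (fun s => s) q = 0 := by
    intro q
    simp only [testBdry, h1, deriv_const', ← hβ]
    ring
  simp [h2, h3]

/-- The form vanishes on this function paired with c_κ and with 1. By the two formulas above these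
pairings are the means up to nonzero factors, so no symmetry argument is needed. -/
theorem meanZero_lin (hκ0 : κ ≠ 0) (hκ : 0 < κ → √κ * R < Real.pi) (hR : 0 < R)
    (hβ : β * sn κ R = cs κ R) (ω : EuclideanSpace ℝ (Fin (j + 2))) :
    (linH1 hκ hR ω).MeanZero := by
  have h1 := robinForm_cs (β := β) hκ hR (linH1 hκ hR ω)
  have h2 := robinForm_one (β := β) hκ hR (linH1 hκ hR ω)
  rw [robinForm_comm, robinForm_lin hκ hR hβ] at h1 h2
  have hs := sn_pos hκ hR le_rfl
  have h3 : -κ * sn κ R - β * cs κ R ≠ 0 := by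
    intro h
    have := cs_sq_add κ R
    -- After multiplication by s_κ(R) and use of β s_κ(R) = c_κ(R), the factor becomes -(κ s_κ² +
    -- c_κ²).
    have h4 : (-κ * sn κ R - β * cs κ R) * sn κ R = -1 := by
      linear_combination (-cs κ R) * hβ - this
    rw [h] at h4
    linarith
  have h4 : ∫ θ, (linH1 hκ hR ω).trace θ ∂(modelArea (j + 2) κ R) = 0 :=
    (mul_eq_zero.1 h1.symm).resolve_left h3
  refine ⟨?_, h4⟩
  rw [h4, mul_zero, sub_zero] at h2
  refine (mul_eq_zero.1 h2.symm).resolve_left (mul_ne_zero ?_ hκ0)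
  have : (0 : ℝ) < j + 2 := by positivity
  linarith

theorem modelArea_real_pos (hκ : 0 < κ → √κ * R < Real.pi) (hR : 0 < R) :
    0 < (modelArea (j + 2) κ R).real univ := by
  have := isFiniteMeasure_modelArea (j + 2) κ R
  have hs := sn_pos hκ hR le_rfl
  refine ENNReal.toReal_pos ?_ (measure_ne_top _ _)
  rw [modelArea, Measure.smul_apply, smul_eq_mul]
  refine mul_ne_zero ?_ ?_
  · simpa using pow_pos hs _
  · rw [Measure.measure_univ_ne_zero]
    exact Measure.toSphere_ne_zero _

/-- A form kernel element on the space of mean zero functions is in the kernel of the form. -/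
theorem robinForm_eq_zero_of_mem_robinKernel (hκ0 : κ ≠ 0) (hκ : 0 < κ → √κ * R < Real.pi)
    (hR : 0 < R) {φ : ModelH1 (j + 2) κ R} (hφ : φ ∈ robinKernel (j + 2) κ R β)
    (ψ : ModelH1 (j + 2) κ R) : robinForm β φ ψ = 0 := by
  have hs := sn_pos hκ hR le_rfl
  have := isFiniteMeasure_modelVol (j := j) hκ
  have := isFiniteMeasure_modelArea (j + 2) κ R
  have h1 : robinForm β φ (oneH1 j hκ hR) = 0 := by
    rw [robinForm_one, hφ.1.1, hφ.1.2]; ring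
  have h2 : robinForm β φ (csH1 j hκ hR) = 0 := by
    rw [robinForm_cs, hφ.1.2]; ring
  set V := (modelVol (j + 2) κ R).real univ
  set A := (modelArea (j + 2) κ R).real univ with hA
  have hApos : 0 < A := modelArea_real_pos hκ hR
  set S := ∫ v, cs κ ‖v‖ ∂(modelVol (j + 2) κ R) with hS
  have icont : ∀ {F : EuclideanSpace ℝ (Fin (j + 2)) → ℝ}, Continuous F →
      Integrable F (modelVol (j + 2) κ R) := fun hF =>
    memLp_one_iff_integrable.1 (memLp_modelVol_of_continuous hκ hF)
  -- This is the determinant, up to the boundary area, of the two means on span{1, c_κ}. It is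
  -- nonzero because κ(c_κ(r) - c_κ(R)) > 0 inside the ball.
  have hSV : S - cs κ R * V ≠ 0 := by
    have := integral_cs_sub_pos (j := j) hκ0 hκ hR
    rw [integral_const_mul, integral_sub (icont (contDiff_cs_norm κ).continuous)
      (icont continuous_const), integral_const, smul_eq_mul] at this
    intro h
    rw [← hS, mul_comm _ (cs κ R), h] at this
    simp at this
  set P := ∫ v, ψ.fn v ∂(modelVol (j + 2) κ R) with hP
  set Q := ∫ θ, ψ.trace θ ∂(modelArea (j + 2) κ R) with hQ
  -- The coefficients a, b solve the 2 × 2 system that makes ψ + a + b c_κ mean zero in the bulk and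
  -- on the boundary.
  set b := (V * Q / A - P) / (S - cs κ R * V) with hb
  set a := -b * cs κ R - Q / A with ha
  have hmz : ((ψ.addSmul hκ hs (oneH1 j hκ hR) a).addSmul hκ hs (csH1 j hκ hR) b).MeanZero := by
    constructor
    · have e : ∀ v, ((ψ.addSmul hκ hs (oneH1 j hκ hR) a).addSmul hκ hs (csH1 j hκ hR) b).fn v =
          ψ.fn v + (a + b * cs κ ‖v‖) := by
        intro v
        simp only [ModelH1.addSmul, oneH1, csH1, smoothH1, testFn]
        ring
      simp only [e]
      rw [integral_add (ψ.memLp_fn.integrable (by norm_num)) (icont (by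
          have := (contDiff_cs_norm (n := j + 2) κ).continuous; fun_prop)),
        integral_add (icont continuous_const) ((icont (contDiff_cs_norm κ).continuous).const_mul b),
        integral_const_mul, integral_const, ← hS, ← hP, smul_eq_mul]
      have : b * (S - cs κ R * V) = V * Q / A - P := div_mul_cancel₀ _ hSV
      change P + (V * a + b * S) = 0
      rw [ha]
      linear_combination this
    · have e : ∀ θ, ((ψ.addSmul hκ hs (oneH1 j hκ hR) a).addSmul hκ hs (csH1 j hκ hR) b).trace θ =
          ψ.trace θ + (a + b * cs κ R) := by
        intro θ
        simp only [ModelH1.addSmul, oneH1, csH1, smoothH1]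
        rw [testFn_smul_sphere hR _ _ _ (by simp), testFn_smul_sphere hR _ _ _ (by simp)]
        ring
      simp only [e]
      rw [integral_add (ψ.memLp_trace.integrable (by norm_num)) (integrable_const _),
        integral_const, ← hQ, smul_eq_mul]
      change Q + A * (a + b * cs κ R) = 0
      rw [ha]
      field_simp
      ring
  have h3 := hφ.2 _ hmz
  rw [robinForm_addSmul, robinForm_addSmul, h1, h2] at h3
  simpa using h3

end

/-! ### Integrals depending on a parameter through `(1 - τ x)^{-N}` -/

section
open Filter Topology
variable {α : Type*} [MeasurableSpace α] {μ : Measure α} {w x : α → ℝ} {B x₁ : ℝ}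

/-- `∫ w (1 - τ x)^{-N}`. -/
def invPowIntegral (μ : Measure α) (w x : α → ℝ) (N : ℕ) (τ : ℝ) : ℝ :=
  ∫ v, w v * ((1 - τ * x v) ^ N)⁻¹ ∂μ

/-- For τ in [0, 1] one has 1 - τy ≥ 1 - x₁ for either sign of y. Moving τ by less than ε costs at
most half of this, and ε is chosen through the bound B on |y|. -/
theorem exists_lower_bound (h0 : 0 ≤ x₁) (h1 : x₁ < 1) (hB : 0 ≤ B) {τ : ℝ}
    (hτ : τ ∈ Icc (0 : ℝ) 1) : ∃ ε > 0, ∃ m > 0, ∀ τ' ∈ ball τ ε, ∀ y, |y| ≤ B → y ≤ x₁ →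
      m ≤ 1 - τ' * y := by
  refine ⟨(1 - x₁) / (2 * (B + 1)), by have := sub_pos.2 h1; positivity, (1 - x₁) / 2,
    by linarith, fun τ' hτ' y hyB hy => ?_⟩
  rw [mem_ball, Real.dist_eq, lt_div_iff₀ (by positivity)] at hτ'
  have h2 : 1 - x₁ ≤ 1 - τ * y := by
    rcases le_total y 0 with h | h
    · nlinarith [hτ.1]
    · nlinarith [hτ.2]
  have h3 : |(τ' - τ) * y| ≤ |τ' - τ| * (B + 1) := by
    rw [abs_mul]
    exact mul_le_mul_of_nonneg_left (by linarith) (abs_nonneg _)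
  have h4 := (abs_le.1 h3).2
  nlinarith

theorem integrable_mul_inv_pow (hw : Integrable w μ) (hx : AEStronglyMeasurable x μ)
    (hB : 0 ≤ B) (h0 : 0 ≤ x₁) (h1 : x₁ < 1) (hbd : ∀ᵐ v ∂μ, |x v| ≤ B ∧ x v ≤ x₁) (N : ℕ)
    {τ : ℝ} (hτ : τ ∈ Icc (0 : ℝ) 1) : Integrable (fun v => w v * ((1 - τ * x v) ^ N)⁻¹) μ := by
  obtain ⟨ε, hε, m, hm, hlow⟩ := exists_lower_bound h0 h1 hB hτ
  refine hw.mul_bdd (c := (m ^ N)⁻¹) ?_ ?_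
  · exact (((aemeasurable_const.sub (hx.aemeasurable.const_mul τ)).pow_const N).inv).aestronglyMeasurable
  · filter_upwards [hbd] with v hv
    have := hlow τ (mem_ball_self hε) _ hv.1 hv.2
    rw [norm_inv, norm_pow, Real.norm_of_nonneg (hm.le.trans this)]
    gcongr

theorem hasDerivAt_invPowIntegral (hw : Integrable w μ) (hx : AEStronglyMeasurable x μ)
    (hB : 0 ≤ B) (h0 : 0 ≤ x₁) (h1 : x₁ < 1) (hbd : ∀ᵐ v ∂μ, |x v| ≤ B ∧ x v ≤ x₁) (N : ℕ)
    {τ : ℝ} (hτ : τ ∈ Icc (0 : ℝ) 1) :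
    HasDerivAt (invPowIntegral μ w x N)
      (∫ v, w v * (N * x v * ((1 - τ * x v) ^ (N + 1))⁻¹) ∂μ) τ := by
  obtain ⟨ε, hε, m, hm, hlow⟩ := exists_lower_bound h0 h1 hB hτ
  have hmeas : ∀ (N : ℕ) (τ : ℝ), AEStronglyMeasurable (fun v => ((1 - τ * x v) ^ N)⁻¹) μ :=
    fun N τ => (((aemeasurable_const.sub
      (hx.aemeasurable.const_mul τ)).pow_const N).inv).aestronglyMeasurable
  refine (hasDerivAt_integral_of_dominated_loc_of_deriv_le (F := fun τ v =>
    w v * ((1 - τ * x v) ^ N)⁻¹) (F' := fun τ v => w v * (N * x v * ((1 - τ * x v) ^ (N + 1))⁻¹))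
    (bound := fun v => ‖w v‖ * (N * B * (m ^ (N + 1))⁻¹)) (ball_mem_nhds τ hε) ?_ ?_ ?_ ?_ ?_ ?_).2
  · exact Eventually.of_forall fun τ' => hw.1.mul (hmeas N τ')
  · exact integrable_mul_inv_pow hw hx hB h0 h1 hbd N hτ
  · exact hw.1.mul ((aestronglyMeasurable_const.mul hx).mul (hmeas _ τ))
  · filter_upwards [hbd] with v hv τ' hτ'
    have := hlow τ' hτ' _ hv.1 hv.2
    rw [norm_mul, norm_mul, norm_mul, norm_inv, norm_pow, Real.norm_of_nonneg (hm.le.trans this),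
      Real.norm_natCast, Real.norm_eq_abs (x v)]
    have hv1 := hv.1
    have h2 : 0 ≤ ((1 - τ' * x v) ^ (N + 1))⁻¹ := inv_nonneg.2 (pow_nonneg (hm.le.trans this) _)
    gcongr
  · exact hw.norm.mul_const _
  · filter_upwards [hbd] with v hv τ' hτ'
    have h := hlow τ' hτ' _ hv.1 hv.2
    have hne : 1 - τ' * x v ≠ 0 := (hm.trans_le h).ne'
    have h2 := ((((hasDerivAt_id τ').mul_const (x v)).const_sub 1).pow N).inv (pow_ne_zero N hne)
    refine (h2.const_mul (w v)).congr_deriv ?_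
    simp only [Pi.pow_apply, id]
    rcases N with _ | N
    · simp
    · rw [Nat.add_sub_cancel]
      field_simp
      ring

/-- Writing τx = 1 - (1 - τx) keeps the family of integrals closed under τ d/dτ. -/
theorem deriv_invPowIntegral (hw : Integrable w μ) (hx : AEStronglyMeasurable x μ)
    (hB : 0 ≤ B) (h0 : 0 ≤ x₁) (h1 : x₁ < 1) (hbd : ∀ᵐ v ∂μ, |x v| ≤ B ∧ x v ≤ x₁) (N : ℕ)
    {τ : ℝ} (hτ : τ ∈ Icc (0 : ℝ) 1) :
    τ * ∫ v, w v * (N * x v * ((1 - τ * x v) ^ (N + 1))⁻¹) ∂μ =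
      N * (invPowIntegral μ w x (N + 1) τ - invPowIntegral μ w x N τ) := by
  obtain ⟨ε, hε, m, hm, hlow⟩ := exists_lower_bound h0 h1 hB hτ
  rw [invPowIntegral, invPowIntegral, ← integral_sub
    (integrable_mul_inv_pow hw hx hB h0 h1 hbd _ hτ)
    (integrable_mul_inv_pow hw hx hB h0 h1 hbd _ hτ), ← integral_const_mul, ← integral_const_mul]
  refine integral_congr_ae ?_
  filter_upwards [hbd] with v hv
  have h := hlow τ (mem_ball_self hε) _ hv.1 hv.2
  have hne : 1 - τ * x v ≠ 0 := (hm.trans_le h).ne'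
  field_simp
  ring

/-- The image of `(1 - τ x)^{-b}` under the hypergeometric operator
`x (1 - x) ∂² + c (1 - 2 x) ∂ - (2 c - b - 1) b`. -/
def hypImage (b : ℕ) (c τ y : ℝ) : ℝ :=
  b * ((1 - τ * y) ^ (b + 2))⁻¹ *
    ((2 - τ) * (b + 1 - c) * (1 - τ * y) - (b + 1) * (1 - τ))

/-- `τ^a (1 - τ)^{c - a} ∫ w (1 - τ x)^{-b-1}`. -/
def hypFlux (μ : Measure α) (w x : α → ℝ) (b : ℕ) (a c τ : ℝ) : ℝ :=
  τ ^ a * (1 - τ) ^ (c - a) * invPowIntegral μ w x (b + 1) τ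

/-- This is the identity behind Euler's integral for ₂F₁, integrated against w: the hypergeometric
operator in x, applied to the Euler integrand, is a derivative in τ. The relation a + b + 1 = 2c is
the symmetry of the operator under x ↦ 1 - x. -/
theorem hasDerivAt_hypFlux (hw : Integrable w μ) (hx : AEStronglyMeasurable x μ)
    (hB : 0 ≤ B) (h0 : 0 ≤ x₁) (h1 : x₁ < 1) (hbd : ∀ᵐ v ∂μ, |x v| ≤ B ∧ x v ≤ x₁) {b : ℕ}
    (hb : b ≠ 0) {a c : ℝ} (habc : a + b + 1 = 2 * c) {τ : ℝ} (hτ : τ ∈ Ioo (0 : ℝ) 1) :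
    HasDerivAt (hypFlux μ w x b a c)
      (-(τ ^ (a - 1) * (1 - τ) ^ (c - a - 1) / b) * ∫ v, w v * hypImage b c τ (x v) ∂μ) τ := by
  have hτ' : τ ∈ Icc (0 : ℝ) 1 := ⟨hτ.1.le, hτ.2.le⟩
  have hτ0 : τ ≠ 0 := hτ.1.ne'
  have hτ1 : 1 - τ ≠ 0 := (sub_pos.2 hτ.2).ne'
  obtain ⟨ε, hε, m, hm, hlow⟩ := exists_lower_bound h0 h1 hB hτ'
  have e1 : ∫ v, w v * hypImage b c τ (x v) ∂μ =
      b * ((2 - τ) * (b + 1 - c) * invPowIntegral μ w x (b + 1) τ -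
        (b + 1) * (1 - τ) * invPowIntegral μ w x (b + 2) τ) := by
    rw [invPowIntegral, invPowIntegral, ← integral_const_mul, ← integral_const_mul, ← integral_sub
      ((integrable_mul_inv_pow hw hx hB h0 h1 hbd _ hτ').const_mul _)
      ((integrable_mul_inv_pow hw hx hB h0 h1 hbd _ hτ').const_mul _), ← integral_const_mul]
    refine integral_congr_ae ?_
    filter_upwards [hbd] with v hv
    have h := hlow τ (mem_ball_self hε) _ hv.1 hv.2
    have hne : 1 - τ * x v ≠ 0 := (hm.trans_le h).ne'
    rw [hypImage]
    field_simp
    ring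
  have e2 := deriv_invPowIntegral hw hx hB h0 h1 hbd (b + 1) hτ'
  have d1 := Real.hasDerivAt_rpow_const (x := τ) (p := a) (Or.inl hτ0)
  have d2 := ((hasDerivAt_id τ).const_sub 1).rpow_const (p := c - a) (Or.inl hτ1)
  have d3 := hasDerivAt_invPowIntegral hw hx hB h0 h1 hbd (b + 1) hτ'
  refine ((d1.mul d2).mul d3).congr_deriv ?_
  have r1 : τ ^ a = τ ^ (a - 1) * τ := by
    rw [← Real.rpow_add_one hτ0]; ring_nf
  have r2 : (1 - τ) ^ (c - a) = (1 - τ) ^ (c - a - 1) * (1 - τ) := by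
    rw [← Real.rpow_add_one hτ1]; ring_nf
  have e3 : ∫ v, w v * (((b + 1 : ℕ) : ℝ) * x v * ((1 - τ * x v) ^ (b + 1 + 1))⁻¹) ∂μ =
      (b + 1) * (invPowIntegral μ w x (b + 2) τ - invPowIntegral μ w x (b + 1) τ) / τ := by
    rw [eq_div_iff hτ0, mul_comm, e2]
    push_cast
    ring
  have hb' : (b : ℝ) ≠ 0 := Nat.cast_ne_zero.2 hb
  rw [e1, e3]
  simp only [id, Pi.mul_apply]
  rw [r2, r1]
  obtain rfl : a = 2 * c - b - 1 := by linarith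
  field_simp
  ring

/-- The flux is constant on (0, 1) and tends to zero at τ = 1, so ∫ w (1 - τx)^(-b-1) vanishes for
all τ. Its value and derivative at τ = 0 are ∫ w and (b + 1) ∫ w x. Nothing is required of the sign
of a, as the endpoint τ = 0 of the flux is not used. -/
theorem integral_eq_zero_of_hypImage (hw : Integrable w μ) (hx : AEStronglyMeasurable x μ)
    (hB : 0 ≤ B) (h0 : 0 ≤ x₁) (h1 : x₁ < 1) (hbd : ∀ᵐ v ∂μ, |x v| ≤ B ∧ x v ≤ x₁) {b : ℕ}
    (hb : b ≠ 0) {a c : ℝ} (habc : a + b + 1 = 2 * c) (hca : 0 < c - a)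
    (h : ∀ τ ∈ Ioo (0 : ℝ) 1, ∫ v, w v * hypImage b c τ (x v) ∂μ = 0) :
    ∫ v, w v ∂μ = 0 ∧ ∫ v, w v * x v ∂μ = 0 := by
  have hcont : ∀ τ ∈ Ioc (0 : ℝ) 1, ContinuousAt (hypFlux μ w x b a c) τ := by
    intro τ hτ
    have c1 : ContinuousAt (fun τ : ℝ => τ ^ a) τ :=
      Real.continuousAt_rpow_const _ _ (Or.inl hτ.1.ne')
    have c2 : ContinuousAt (fun τ : ℝ => (1 - τ) ^ (c - a)) τ :=
      (continuousAt_const.sub continuousAt_id).rpow_const (Or.inr hca.le)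
    exact (c1.mul c2).mul
      (hasDerivAt_invPowIntegral hw hx hB h0 h1 hbd (b + 1) ⟨hτ.1.le, hτ.2⟩).continuousAt
  have hzero : ∀ τ ∈ Ioo (0 : ℝ) 1, invPowIntegral μ w x (b + 1) τ = 0 := by
    intro τ hτ
    obtain ⟨σ, hσ, hs⟩ := exists_hasDerivAt_eq_slope (hypFlux μ w x b a c)
      (fun τ => -(τ ^ (a - 1) * (1 - τ) ^ (c - a - 1) / b) *
        ∫ v, w v * hypImage b c τ (x v) ∂μ) hτ.2
      (fun σ hσ => (hcont σ ⟨hτ.1.trans_le hσ.1, hσ.2⟩).continuousWithinAt)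
      (fun σ hσ => hasDerivAt_hypFlux hw hx hB h0 h1 hbd hb habc ⟨hτ.1.trans hσ.1, hσ.2⟩)
    rw [h σ ⟨hτ.1.trans hσ.1, hσ.2⟩, mul_zero, eq_comm, div_eq_zero_iff] at hs
    have h2 := hs.resolve_right (sub_pos.2 hτ.2).ne'
    have h3 : hypFlux μ w x b a c 1 = 0 := by
      rw [hypFlux, sub_self, Real.zero_rpow hca.ne']; ring
    rw [h3, zero_sub, neg_eq_zero, hypFlux] at h2
    refine (mul_eq_zero.1 h2).resolve_left (mul_pos ?_ ?_).ne'
    · exact Real.rpow_pos_of_pos hτ.1 _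
    · exact Real.rpow_pos_of_pos (sub_pos.2 hτ.2) _
  -- Vanishing is known only for τ > 0, so value and derivative at 0 are taken from the right.
  have hd := hasDerivAt_invPowIntegral hw hx hB h0 h1 hbd (b + 1)
    (left_mem_Icc.2 (zero_le_one' ℝ))
  have hev : invPowIntegral μ w x (b + 1) =ᶠ[𝓝[>] 0] fun _ => 0 := by
    filter_upwards [Ioo_mem_nhdsGT (zero_lt_one' ℝ)] with τ hτ using hzero τ hτ
  have hval : invPowIntegral μ w x (b + 1) 0 = 0 := by
    have := hd.continuousAt.tendsto.mono_left (nhdsWithin_le_nhds (s := Ioi 0))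
    exact tendsto_nhds_unique this (tendsto_const_nhds.congr' hev.symm)
  have hd0 : HasDerivWithinAt (invPowIntegral μ w x (b + 1)) 0 (Ioi 0) 0 :=
    (hasDerivWithinAt_const 0 (Ioi 0) (0 : ℝ)).congr_of_eventuallyEq hev hval
  have hder := (uniqueDiffWithinAt_Ioi (0 : ℝ)).eq_deriv _ hd.hasDerivWithinAt hd0
  constructor
  · simpa [invPowIntegral] using hval
  · simp only [zero_mul, sub_zero, one_pow, inv_one, mul_one, mul_left_comm _ (((b + 1 : ℕ)) : ℝ),
      integral_const_mul] at hder
    exact (mul_eq_zero.1 hder).resolve_left (by positivity)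

/-- Rolle's theorem for a combination of two fluxes. Since a > 0 and c - a > 0, the combination
vanishes at both endpoints, whatever the coefficient A. -/
theorem exists_hypImage_combination_eq_zero {α' : Type*} [MeasurableSpace α'] {μ' : Measure α'}
    {w' x' : α' → ℝ} (hw : Integrable w μ) (hx : AEStronglyMeasurable x μ)
    (hw' : Integrable w' μ') (hx' : AEStronglyMeasurable x' μ')
    (hB : 0 ≤ B) (h0 : 0 ≤ x₁) (h1 : x₁ < 1) (hbd : ∀ᵐ v ∂μ, |x v| ≤ B ∧ x v ≤ x₁)
    (hbd' : ∀ᵐ v ∂μ', |x' v| ≤ B ∧ x' v ≤ x₁) {b : ℕ}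
    (hb : b ≠ 0) {a c : ℝ} (habc : a + b + 1 = 2 * c) (hca : 0 < c - a) (ha : 0 < a) (A : ℝ) :
    ∃ τ ∈ Ioo (0 : ℝ) 1, A * ∫ v, w v * hypImage b c τ (x v) ∂μ -
      ∫ v, w' v * hypImage b c τ (x' v) ∂μ' = 0 := by
  have hcont : Continuous (fun τ : ℝ => τ ^ a * (1 - τ) ^ (c - a)) :=
    (continuous_id.rpow_const fun _ => Or.inr ha.le).mul
      ((continuous_const.sub continuous_id).rpow_const fun _ => Or.inr hca.le)
  have hc : ContinuousOn (fun τ => A * hypFlux μ w x b a c τ - hypFlux μ' w' x' b a c τ)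
      (Icc 0 1) := by
    intro τ hτ
    refine ContinuousAt.continuousWithinAt ?_
    exact (continuousAt_const.mul (hcont.continuousAt.mul
      (hasDerivAt_invPowIntegral hw hx hB h0 h1 hbd (b + 1) hτ).continuousAt)).sub
      (hcont.continuousAt.mul
        (hasDerivAt_invPowIntegral hw' hx' hB h0 h1 hbd' (b + 1) hτ).continuousAt)
  obtain ⟨τ, hτ, h⟩ := exists_hasDerivAt_eq_zero (zero_lt_one' ℝ) hc
    (by simp [hypFlux, Real.zero_rpow ha.ne', Real.zero_rpow hca.ne'])
    (fun τ hτ => ((hasDerivAt_hypFlux hw hx hB h0 h1 hbd hb habc hτ).const_mul A).sub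
      (hasDerivAt_hypFlux hw' hx' hB h0 h1 hbd' hb habc hτ))
  refine ⟨τ, hτ, ?_⟩
  have hpos : τ ^ (a - 1) * (1 - τ) ^ (c - a - 1) / (b : ℝ) ≠ 0 := by
    have := Real.rpow_pos_of_pos hτ.1 (a - 1)
    have := Real.rpow_pos_of_pos (sub_pos.2 hτ.2) (c - a - 1)
    have : (b : ℝ) ≠ 0 := Nat.cast_ne_zero.2 hb
    positivity
  refine (mul_eq_zero.1 (?_ : τ ^ (a - 1) * (1 - τ) ^ (c - a - 1) / (b : ℝ) * _ = 0)).resolve_left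
    hpos
  linear_combination -h

end

/-! ### The radial operator of an angular sector -/

section
variable {j : ℕ} {κ R β : ℝ}

theorem neg_one_le_cs (κ r : ℝ) : -1 ≤ cs κ r := by
  rcases lt_trichotomy κ 0 with h | rfl | h
  · rw [cs_of_neg h]; linarith [Real.one_le_cosh (√(-κ) * r)]
  · simp [cs]
  · rw [cs_of_pos h]; exact Real.neg_one_le_cos _

theorem neg_one_lt_cs (hκ : 0 < κ → √κ * R < Real.pi) {r : ℝ} (hr : 0 ≤ r) (hrR : r ≤ R) :
    -1 < cs κ r := by
  refine lt_of_le_of_ne (neg_one_le_cs κ r) fun h => ?_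
  rcases hr.eq_or_lt with rfl | hr
  · rw [cs_zero] at h; norm_num at h
  · have h1 := sn_pos hκ hr hrR
    have h2 := cs_sq_add κ r
    rw [← h] at h2
    have h3 : κ * sn κ r ^ 2 = 0 := by linarith
    rcases mul_eq_zero.1 h3 with h4 | h4
    · rw [h4] at h; simp [cs] at h; norm_num at h
    · exact h1.ne' (pow_eq_zero_iff two_ne_zero |>.1 h4)

/-- The hypergeometric variable x = (1 - c_κ)/2 stays away from its singular point 1, the antipode
of the centre. For κ < 0 it is nonpositive, hence the separate bound on its absolute value. -/
theorem exists_cs_bounds (hκ : 0 < κ → √κ * R < Real.pi) (hR : 0 < R) :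
    ∃ B x₁ : ℝ, 0 ≤ B ∧ 0 ≤ x₁ ∧ x₁ < 1 ∧ ∀ r, 0 ≤ r → r ≤ R →
      |(1 - cs κ r) / 2| ≤ B ∧ (1 - cs κ r) / 2 ≤ x₁ := by
  have hc : Continuous fun r => (1 - cs κ r) / 2 :=
    (continuous_const.sub (continuous_cs κ)).div_const 2
  obtain ⟨r₁, hr₁, h1⟩ := isCompact_Icc.exists_isMaxOn (nonempty_Icc.2 hR.le) hc.continuousOn
  obtain ⟨r₂, hr₂, h2⟩ := isCompact_Icc.exists_isMaxOn (nonempty_Icc.2 hR.le) hc.abs.continuousOn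
  refine ⟨|(1 - cs κ r₂) / 2|, max 0 ((1 - cs κ r₁) / 2), abs_nonneg _, le_max_left _ _, ?_,
    fun r hr hrR => ⟨h2 ⟨hr, hrR⟩, (h1 ⟨hr, hrR⟩).trans (le_max_right _ _)⟩⟩
  refine max_lt one_pos ?_
  linarith [neg_one_lt_cs hκ hr₁.1 hr₁.2]

/-- The operator `(1 - s²) f'' - (n + 2 ℓ) s f' - (ℓ - 1) (ℓ + n) f`. -/
def sectorOp (n l : ℕ) (f : ℝ → ℝ) (s : ℝ) : ℝ :=
  (1 - s ^ 2) * deriv (deriv f) s - (n + 2 * l) * s * deriv f s - (l - 1) * (l + n) * f s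

/-- For real ω the power ⟨ω, θ⟩^ℓ is not a spherical harmonic; the last term is the price and has
degree ℓ - 2. This is why the moments are treated by an induction in steps of two. For ℓ < 2 the
coefficient ℓ(ℓ - 1) neutralizes the truncated exponent. -/
theorem testLap_pow (n l : ℕ) (κ W : ℝ) (f : ℝ → ℝ) (s ξ : ℝ) :
    testLap n κ W f (fun t => t ^ l) s ξ + n * κ * (f s * ξ ^ l) =
      κ * (ξ ^ l * sectorOp n l f s) + l * (l - 1) * W * (ξ ^ (l - 2) * f s) := by
  have h1 : deriv (fun t : ℝ => t ^ l) = fun t : ℝ => (l : ℝ) * t ^ (l - 1) := by ext; simp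
  have h2 : deriv (deriv (fun t : ℝ => t ^ l)) ξ = l * (l - 1) * ξ ^ (l - 2) := by
    rw [h1]
    rcases l with _ | l
    · simp
    · simp only [Nat.add_sub_cancel, deriv_const_mul_field', deriv_pow_field]
      rw [show l + 1 - 2 = l - 1 by omega]
      push_cast
      ring
  have h3 : ξ * ((l : ℝ) * ξ ^ (l - 1)) = l * ξ ^ l := by
    rcases l with _ | l
    · simp
    · rw [Nat.add_sub_cancel]; ring
  have h4 : (l * (l - 1) * ξ ^ (l - 2)) * ξ ^ 2 = l * (l - 1) * ξ ^ l := by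
    rcases l with _ | _ | l
    · simp
    · simp
    · rw [show l + 1 + 1 - 2 = l by omega]; ring
  rw [testLap, h2, h1, sectorOp]
  linear_combination (-2 * κ * s * deriv f s - f s * n * κ) * h3 - f s * κ * h4

theorem testBdry_pow (hβ : β * sn κ R = cs κ R) (l : ℕ) (f : ℝ → ℝ) (q : ℝ) :
    testBdry κ R β f (fun t => t ^ l) q =
      q ^ l * (sn κ R ^ l * (-(κ * sn κ R * deriv f (cs κ R)) + (l - 1) * β * f (cs κ R))) := by
  have h1 : deriv (fun t : ℝ => t ^ l) = fun t : ℝ => (l : ℝ) * t ^ (l - 1) := by ext; simp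
  have h3 : (sn κ R * q) * ((l : ℝ) * (sn κ R * q) ^ (l - 1)) = l * (sn κ R * q) ^ l := by
    rcases l with _ | l
    · simp
    · rw [Nat.add_sub_cancel]; ring
  rw [testBdry, h1]
  generalize f (cs κ R) = F0
  generalize deriv f (cs κ R) = F1
  rw [← hβ]
  simp only [mul_pow] at h3 ⊢
  linear_combination F0 * β * h3

/-- The function whose image under the radial operator is `hypImage`. -/
def hypTest (b : ℕ) (τ s : ℝ) : ℝ := ((1 - τ * ((1 - s) / 2)) ^ b)⁻¹

theorem hasDerivAt_hypTest (b : ℕ) {τ s : ℝ} (h : 1 - τ * ((1 - s) / 2) ≠ 0) :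
    HasDerivAt (hypTest b τ) (-(b * τ / 2) * hypTest (b + 1) τ s) s := by
  have h0 : HasDerivAt (fun s : ℝ => 1 - τ * ((1 - s) / 2)) (τ / 2) s := by
    have := ((((hasDerivAt_id s).const_sub 1).div_const 2).const_mul τ).const_sub 1
    exact this.congr_deriv (by ring)
  refine ((h0.pow b).inv (pow_ne_zero b h)).congr_deriv ?_
  simp only [Pi.pow_apply, hypTest]
  rcases b with _ | b
  · simp
  · rw [Nat.add_sub_cancel]
    generalize 1 - τ * ((1 - s) / 2) = y at *
    push_cast
    field_simp
    ring

theorem one_sub_mul_pos {τ s : ℝ} (hτ : τ ∈ Ioo (0 : ℝ) 1) (hs : -1 ≤ s) :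
    0 < 1 - τ * ((1 - s) / 2) := by
  nlinarith [hτ.1, hτ.2]

theorem contDiffAt_hypTest (b : ℕ) {τ : ℝ} (hτ : τ ∈ Ioo (0 : ℝ) 1) (r : ℝ) :
    ContDiffAt ℝ (⊤ : ℕ∞) (hypTest b τ) (cs κ r) := by
  refine ContDiffAt.inv ?_ (pow_ne_zero _ (one_sub_mul_pos hτ (neg_one_le_cs κ r)).ne')
  fun_prop

/-- In x = (1 - s)/2 the sector operator is hypergeometric with a = ℓ - 1, b = ℓ + n, c = n/2 + ℓ.
-/
theorem sectorOp_hypTest (n l : ℕ) {τ s : ℝ} (h : 1 - τ * ((1 - s) / 2) ≠ 0) :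
    sectorOp n l (hypTest (l + n) τ) s = hypImage (l + n) (n / 2 + l) τ ((1 - s) / 2) := by
  have hd : deriv (hypTest (l + n) τ) =ᶠ[nhds s]
      fun s => -((l + n : ℕ) * τ / 2) * hypTest (l + n + 1) τ s := by
    have hc : ContinuousAt (fun s : ℝ => 1 - τ * ((1 - s) / 2)) s := by fun_prop
    filter_upwards [hc.eventually_ne h] with s hs using (hasDerivAt_hypTest _ hs).deriv
  rw [sectorOp, hd.deriv_eq, ((hasDerivAt_hypTest _ h).const_mul _).deriv, hd.eq_of_nhds]
  simp only [hypTest, hypImage]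
  push_cast
  generalize hy : 1 - τ * ((1 - s) / 2) = y at *
  simp only [_root_.pow_succ]
  have hs : τ * s = 2 * y - 2 + τ := by rw [← hy]; ring
  field_simp
  linear_combination ((l + n : ℝ) * (-(l + n + 1) * (τ * s + 2 * y - 2 + τ) + 2 * y * (n + 2 * l))) * hs

/-- The operator is triangular on powers, and for n > 0 the diagonal entry vanishes only when k + ℓ
= 1. There s^k is a solution, giving c_κ when ℓ = 0 and s_κ⟨ω, θ⟩ when ℓ = 1. -/
theorem sectorOp_pow (n l k : ℕ) (s : ℝ) :
    sectorOp n l (fun s => s ^ k) s =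
      k * (k - 1) * s ^ (k - 2) - (k + l - 1) * (k + l + n) * s ^ k := by
  have h1 : deriv (fun t : ℝ => t ^ k) = fun t : ℝ => (k : ℝ) * t ^ (k - 1) := by ext; simp
  have h2 : deriv (deriv (fun t : ℝ => t ^ k)) s = k * (k - 1) * s ^ (k - 2) := by
    rw [h1]
    rcases k with _ | k
    · simp
    · simp only [Nat.add_sub_cancel, deriv_const_mul_field', deriv_pow_field]
      rw [show k + 1 - 2 = k - 1 by omega]
      push_cast
      ring
  have h3 : s * ((k : ℝ) * s ^ (k - 1)) = k * s ^ k := by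
    rcases k with _ | k
    · simp
    · rw [Nat.add_sub_cancel]; ring
  have h4 : (k * (k - 1) * s ^ (k - 2)) * s ^ 2 = k * (k - 1) * s ^ k := by
    rcases k with _ | _ | k
    · simp
    · simp
    · rw [show k + 1 + 1 - 2 = k by omega]; ring
  rw [sectorOp, h2, h1]
  linear_combination -h4 - (n + 2 * l) * h3

/-- Integration over `[0, R]` of the radial operator of degree `ℓ + 2` against `s_κ^{n + ℓ + 2}`: the
boundary operator appears, and a definite remainder. -/
theorem flux_identity (n l : ℕ) (hβ : β * sn κ R = cs κ R) {f : ℝ → ℝ}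
    (hf : ∀ r, ContDiffAt ℝ (⊤ : ℕ∞) f (cs κ r)) :
    sn κ R ^ (n + l + 2) *
        (-(κ * sn κ R * deriv f (cs κ R)) + (l + 1) * β * f (cs κ R)) =
      κ * (∫ r in (0 : ℝ)..R, sn κ r ^ (n + l + 2) * sectorOp n (l + 2) f (cs κ r)) +
        (l + 1) * (n + l + 1) * ∫ r in (0 : ℝ)..R, sn κ r ^ (n + l) * f (cs κ r) := by
  have hf1 := fun r => contDiffAt_deriv (hf r)
  have hf2 := fun r => contDiffAt_deriv (hf1 r)
  have c0 : Continuous fun r => f (cs κ r) := continuous_iff_continuousAt.2 fun r =>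
    (hf r).continuousAt.comp (continuous_cs κ).continuousAt
  have c1 : Continuous fun r => deriv f (cs κ r) := continuous_iff_continuousAt.2 fun r =>
    (hf1 r).continuousAt.comp (continuous_cs κ).continuousAt
  have c2 : Continuous fun r => deriv (deriv f) (cs κ r) := continuous_iff_continuousAt.2 fun r =>
    (hf2 r).continuousAt.comp (continuous_cs κ).continuousAt
  have hc := continuous_cs κ
  have hs := continuous_sn κ
  have i1 : Continuous fun r => κ * (sn κ r ^ (n + l + 2) * sectorOp n (l + 2) f (cs κ r)) :=
    continuous_const.mul ((hs.pow _).mul ((((continuous_const.sub (hc.pow 2)).mul c2).sub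
      ((continuous_const.mul hc).mul c1)).sub (continuous_const.mul c0)))
  have i2 : Continuous fun r => (l + 1) * (n + l + 1) * (sn κ r ^ (n + l) * f (cs κ r)) :=
    continuous_const.mul ((hs.pow _).mul c0)
  -- The function is the weighted Wronskian s_κ^(n-1) (u' s_κ - u s_κ') of u = s_κ^(ℓ+2) f(c_κ) with
  -- the degree-one solution s_κ. The remainder comes from the difference (ℓ + 1)(n + ℓ + 1) of the
  -- angular eigenvalues of degrees ℓ + 2 and 1.
  have hd : ∀ r, HasDerivAt (fun r => sn κ r ^ (n + l + 1) *
      (-(κ * sn κ r ^ 2 * deriv f (cs κ r)) + (l + 1) * (cs κ r * f (cs κ r))))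
      (κ * (sn κ r ^ (n + l + 2) * sectorOp n (l + 2) f (cs κ r)) +
        (l + 1) * (n + l + 1) * (sn κ r ^ (n + l) * f (cs κ r))) r := by
    intro r
    have d0 := ((hf r).differentiableAt (by simp)).hasDerivAt.comp r (hasDerivAt_cs κ r)
    have d1 := ((hf1 r).differentiableAt (by simp)).hasDerivAt.comp r (hasDerivAt_cs κ r)
    have ds := hasDerivAt_sn κ r
    have := (ds.fun_pow (n + l + 1)).mul (((((ds.fun_pow 2).const_mul κ).mul d1).neg).add
      (((hasDerivAt_cs κ r).mul d0).const_mul ((l : ℝ) + 1)))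
    refine this.congr_deriv ?_
    simp only [sectorOp, Function.comp, Pi.mul_apply, Pi.add_apply, Pi.neg_apply,
      Nat.add_sub_cancel]
    have e := cs_sq_add κ r
    have e4 : cs κ r ^ 2 = 1 - κ * sn κ r ^ 2 := by linarith
    push_cast
    generalize f (cs κ r) = F0
    generalize deriv f (cs κ r) = F1
    generalize deriv (deriv f) (cs κ r) = F2
    linear_combination ((l + 1) * (n + l + 1) * sn κ r ^ (n + l) * F0 +
      κ * sn κ r ^ (n + l + 2) * F2) * e4
  have := intervalIntegral.integral_eq_sub_of_hasDerivAt (a := 0) (b := R) (fun r _ => hd r)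
    ((i1.add i2).intervalIntegrable _ _)
  rw [intervalIntegral.integral_add (i1.intervalIntegrable _ _) (i2.intervalIntegrable _ _),
    intervalIntegral.integral_const_mul,
    intervalIntegral.integral_const_mul, sn_zero, zero_pow (by omega), zero_mul, sub_zero] at this
  rw [this, ← hβ]
  ring

end

/-! ### Vanishing of all moments -/

section
variable {j : ℕ} {κ R β : ℝ}

/-- `∫ φ (s_κ ⟨ω, θ⟩)^ℓ h(c_κ)`. -/
def ModelH1.moment (φ : ModelH1 (j + 2) κ R) (ω : EuclideanSpace ℝ (Fin (j + 2))) (l : ℕ)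
    (h : ℝ → ℝ) : ℝ :=
  ∫ v, φ.fn v * linField κ ω v ^ l * h (cs κ ‖v‖) ∂(modelVol (j + 2) κ R)

/-- `∮ φ ⟨ω, θ⟩^ℓ`. -/
def ModelH1.traceMoment (φ : ModelH1 (j + 2) κ R) (ω : EuclideanSpace ℝ (Fin (j + 2)))
    (l : ℕ) : ℝ :=
  ∫ θ : sphere (0 : EuclideanSpace ℝ (Fin (j + 2))) 1,
    φ.trace θ * inner ℝ ω (θ : EuclideanSpace ℝ (Fin (j + 2))) ^ l ∂(modelArea (j + 2) κ R)

variable (φ : ModelH1 (j + 2) κ R) (ω : EuclideanSpace ℝ (Fin (j + 2)))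

theorem continuous_comp_cs_norm {n : ℕ} {h : ℝ → ℝ} (hh : ∀ r, ContinuousAt h (cs κ r)) :
    Continuous fun v : EuclideanSpace ℝ (Fin n) => h (cs κ ‖v‖) :=
  continuous_iff_continuousAt.2 fun v =>
    ContinuousAt.comp (f := fun v : EuclideanSpace ℝ (Fin n) => cs κ ‖v‖) (hh ‖v‖)
      (contDiff_cs_norm κ).continuous.continuousAt

theorem ModelH1.integrable_mul_pow (hκ : 0 < κ → √κ * R < Real.pi) (l : ℕ) :
    Integrable (fun v => φ.fn v * linField κ ω v ^ l) (modelVol (j + 2) κ R) :=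
  φ.memLp_fn.integrable_mul (memLp_modelVol_of_continuous (p := 2) hκ
    ((contDiff_linField κ ω).continuous.pow l))

theorem ModelH1.integrable_moment (hκ : 0 < κ → √κ * R < Real.pi) (l : ℕ) {h : ℝ → ℝ}
    (hh : ∀ r, ContinuousAt h (cs κ r)) :
    Integrable (fun v => φ.fn v * linField κ ω v ^ l * h (cs κ ‖v‖)) (modelVol (j + 2) κ R) := by
  have := φ.memLp_fn.integrable_mul (memLp_modelVol_of_continuous (p := 2) hκ
    (((contDiff_linField κ ω).continuous.pow l).mul (continuous_comp_cs_norm hh)))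
  simpa only [Pi.mul_def, Pi.pow_apply, mul_assoc] using this

theorem continuousAt_sectorOp {f : ℝ → ℝ} {s : ℝ} (n l : ℕ)
    (hf : ContDiffAt ℝ (⊤ : ℕ∞) f s) : ContinuousAt (sectorOp n l f) s := by
  have c0 := hf.continuousAt
  have c1 := (contDiffAt_deriv hf).continuousAt
  have c2 := (contDiffAt_deriv (contDiffAt_deriv hf)).continuousAt
  unfold sectorOp
  fun_prop

/-- The weak equation tested against f(c_κ)(s_κ⟨ω, θ⟩)^ℓ. On the boundary sphere the test function
and its normal derivative are constants times ⟨ω, θ⟩^ℓ, so a single boundary moment appears. -/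
theorem sector_relation (hκ : 0 < κ → √κ * R < Real.pi) (hR : 0 < R)
    (hβ : β * sn κ R = cs κ R) (hφ : ∀ ψ, robinForm β φ ψ = 0) (l : ℕ) {f : ℝ → ℝ}
    (hf : ∀ r, ContDiffAt ℝ (⊤ : ℕ∞) f (cs κ r)) :
    φ.traceMoment ω l * (sn κ R ^ l *
        (-(κ * sn κ R * deriv f (cs κ R)) + (l - 1) * β * f (cs κ R))) =
      κ * φ.moment ω l (sectorOp (j + 2) l f) +
        l * (l - 1) * ‖ω‖ ^ 2 * φ.moment ω (l - 2) f := by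
  have hg : ContDiff ℝ (⊤ : ℕ∞) (fun t : ℝ => t ^ l) := by fun_prop
  have h := robinForm_testFn hκ hR φ ω hf hg β ((contDiff_testFn ω hf hg).of_le (by simp))
  rw [hφ, eq_comm, sub_eq_zero] at h
  simp only [testBdry_pow hβ, ← mul_assoc (φ.trace _)] at h
  rw [integral_mul_const] at h
  rw [ModelH1.traceMoment, h, ModelH1.moment, ModelH1.moment, ← integral_const_mul,
    ← integral_const_mul, ← integral_add
      ((φ.integrable_moment ω hκ l fun r => continuousAt_sectorOp _ _ (hf r)).const_mul _)
      ((φ.integrable_moment ω hκ (l - 2) fun r => (hf r).continuousAt).const_mul _)]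
  refine integral_congr_ae (Filter.Eventually.of_forall fun v => ?_)
  have := testLap_pow (j + 2) l κ (‖ω‖ ^ 2) f (cs κ ‖v‖) (linField κ ω v)
  push_cast at this
  simp only [testFn]
  rw [this]
  ring

theorem ModelH1.moment_hypTest (n l : ℕ) {τ : ℝ} (hτ : τ ∈ Ioo (0 : ℝ) 1) :
    φ.moment ω l (sectorOp n l (hypTest (l + n) τ)) =
      ∫ v, φ.fn v * linField κ ω v ^ l * hypImage (l + n) (n / 2 + l) τ ((1 - cs κ ‖v‖) / 2)
        ∂(modelVol (j + 2) κ R) := by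
  refine integral_congr_ae (Filter.Eventually.of_forall fun v => ?_)
  simp only [sectorOp_hypTest n l (one_sub_mul_pos hτ (neg_one_le_cs κ ‖v‖)).ne']

theorem aestronglyMeasurable_hypVar {n : ℕ} (μ : Measure (EuclideanSpace ℝ (Fin n))) :
    AEStronglyMeasurable (fun v => (1 - cs κ ‖v‖) / 2) μ :=
  ((continuous_const.sub (contDiff_cs_norm κ).continuous).div_const 2).aestronglyMeasurable

/-- The moments against powers of `c_κ` vanish. -/
theorem ModelH1.moment_pow_eq_zero (hκ : 0 < κ → √κ * R < Real.pi) (hR : 0 < R) (l : ℕ)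
    (h : ∀ f : ℝ → ℝ, (∀ r, ContDiffAt ℝ (⊤ : ℕ∞) f (cs κ r)) →
      φ.moment ω l (sectorOp (j + 2) l f) = 0) (k : ℕ) :
    φ.moment ω l (fun s => s ^ k) = 0 := by
  have hint := φ.integrable_mul_pow ω hκ l
  have hpi : ∀ k : ℕ, Integrable (fun v => φ.fn v * linField κ ω v ^ l * cs κ ‖v‖ ^ k)
      (modelVol (j + 2) κ R) := fun k =>
    φ.integrable_moment ω hκ l (h := fun s => s ^ k) fun r => by fun_prop
  induction k using Nat.strong_induction_on with
  | _ k ih =>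
    -- Here the diagonal entry vanishes and the recursion gives nothing, so the Euler family
    -- supplies the moment. The parameter a = ℓ - 1 is then 0 or -1.
    by_cases hk : k + l = 1
    · obtain ⟨B, x₁, hB, h0, h1, hbd⟩ := exists_cs_bounds hκ hR
      have hl : (l : ℝ) ≤ 1 := by exact_mod_cast (by omega : l ≤ 1)
      have key := integral_eq_zero_of_hypImage (b := l + (j + 2)) (a := l - 1)
        (c := ((j + 2 : ℕ) : ℝ) / 2 + l) hint (aestronglyMeasurable_hypVar (κ := κ) _) hB h0 h1
        (by
          filter_upwards [ae_modelVol_mem j κ R] with v hv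
          exact hbd _ (norm_nonneg v) (mem_ball_zero_iff.1 hv.1).le)
        (by omega) (by push_cast; ring) (by push_cast; linarith [(Nat.cast_nonneg j : (0:ℝ) ≤ j)])
        (fun τ hτ => by
          have := φ.moment_hypTest ω (j + 2) l hτ
          rw [← this, h _ (contDiffAt_hypTest _ hτ)])
      rcases Nat.eq_zero_or_pos k with rfl | hk0
      · simpa [ModelH1.moment] using key.1
      · obtain rfl : k = 1 := by omega
        have e : ∀ v, φ.fn v * linField κ ω v ^ l * cs κ ‖v‖ ^ 1 =
            φ.fn v * linField κ ω v ^ l -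
              2 * (φ.fn v * linField κ ω v ^ l * ((1 - cs κ ‖v‖) / 2)) := fun v => by ring
        have hi : Integrable (fun v => φ.fn v * linField κ ω v ^ l * ((1 - cs κ ‖v‖) / 2))
            (modelVol (j + 2) κ R) :=
          φ.integrable_moment ω hκ l (h := fun s => (1 - s) / 2) fun r => by fun_prop
        simp only [ModelH1.moment, e]
        rw [integral_sub hint (hi.const_mul 2), integral_const_mul, key.1, key.2]
        ring
    · have h1 := h (fun s => s ^ k) fun r => by fun_prop
      have h2 : φ.moment ω l (sectorOp (j + 2) l fun s => s ^ k) =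
          k * (k - 1) * φ.moment ω l (fun s => s ^ (k - 2)) -
            (k + l - 1) * (k + l + (j + 2 : ℕ)) * φ.moment ω l (fun s => s ^ k) := by
        simp only [ModelH1.moment]
        rw [← integral_const_mul, ← integral_const_mul,
          ← integral_sub ((hpi _).const_mul _) ((hpi _).const_mul _)]
        refine integral_congr_ae (Filter.Eventually.of_forall fun v => ?_)
        simp only [sectorOp_pow]
        ring
      have h3 : (k : ℝ) * (k - 1) * φ.moment ω l (fun s => s ^ (k - 2)) = 0 := by
        rcases Nat.lt_or_ge k 2 with hk2 | hk2
        · interval_cases k <;> simp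
        · rw [ih _ (by omega), mul_zero]
      rw [h1, h3, zero_sub, eq_comm, neg_eq_zero] at h2
      refine (mul_eq_zero.1 h2).resolve_left (mul_ne_zero ?_ (by positivity))
      rw [sub_ne_zero]
      exact_mod_cast hk

/-- A function all of whose moments against a bounded variable vanish is orthogonal to all
continuous functions of that variable. -/
theorem integral_mul_comp_eq_zero_of_pow {α : Type*} [MeasurableSpace α] {μ : Measure α}
    {w x : α → ℝ} {a b : ℝ} {f : ℝ → ℝ} (hw : Integrable w μ) (hx : AEStronglyMeasurable x μ)
    (hfx : Integrable (fun v => w v * f (x v)) μ) (hab : ∀ᵐ v ∂μ, x v ∈ Icc a b)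
    (hf : ContinuousOn f (Icc a b)) (h : ∀ k : ℕ, ∫ v, w v * x v ^ k ∂μ = 0) :
    ∫ v, w v * f (x v) ∂μ = 0 := by
  have hpi : ∀ p : Polynomial ℝ, Integrable (fun v => w v * p.eval (x v)) μ := by
    intro p
    obtain ⟨C, hC⟩ := (isCompact_Icc (a := a) (b := b)).bddAbove_image
      p.continuous.norm.continuousOn
    refine hw.mul_bdd (c := C) (p.continuous.comp_aestronglyMeasurable hx) ?_
    filter_upwards [hab] with v hv using hC ⟨_, hv, rfl⟩
  have hpoly : ∀ p : Polynomial ℝ, ∫ v, w v * p.eval (x v) ∂μ = 0 := by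
    intro p
    induction p using Polynomial.induction_on' with
    | add p q hp hq =>
      simp only [Polynomial.eval_add, mul_add]
      rw [integral_add (hpi p) (hpi q), hp, hq, add_zero]
    | monomial k a =>
      simp only [Polynomial.eval_monomial, mul_left_comm _ a]
      rw [integral_const_mul, h k, mul_zero]
  set M := ∫ v, ‖w v‖ ∂μ
  -- Weierstrass approximation within ε/(M + 1), where M is the L¹ norm of w; adding 1 avoids a
  -- division by zero.
  have hM : 0 ≤ M := integral_nonneg fun _ => norm_nonneg _
  refine abs_nonpos_iff.1 (le_of_forall_pos_le_add fun ε hε => ?_)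
  obtain ⟨p, hp⟩ := exists_polynomial_near_of_continuousOn a b f hf (ε / (M + 1)) (by positivity)
  have e : ∫ v, w v * f (x v) ∂μ = ∫ v, w v * (f (x v) - p.eval (x v)) ∂μ := by
    simp only [mul_sub]
    rw [integral_sub hfx (hpi p), hpoly, sub_zero]
  rw [e, zero_add]
  calc |∫ v, w v * (f (x v) - p.eval (x v)) ∂μ|
      ≤ ∫ v, ‖w v‖ * (ε / (M + 1)) ∂μ := by
        rw [← Real.norm_eq_abs]
        refine norm_integral_le_of_norm_le (hw.norm.mul_const _) ?_
        filter_upwards [hab] with v hv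
        rw [norm_mul]
        refine mul_le_mul_of_nonneg_left ?_ (norm_nonneg _)
        rw [norm_sub_rev]
        exact (hp _ hv).le
    _ = M * (ε / (M + 1)) := integral_mul_const _ _
    _ ≤ ε := by
        rw [mul_div_assoc', div_le_iff₀ (by positivity)]
        nlinarith

theorem ModelH1.moment_eq_zero_of_pow (hκ : 0 < κ → √κ * R < Real.pi) (hR : 0 < R) (l : ℕ)
    (h : ∀ k : ℕ, φ.moment ω l (fun s => s ^ k) = 0) {f : ℝ → ℝ}
    (hf : ∀ r, ContinuousAt f (cs κ r)) : φ.moment ω l f = 0 := by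
  obtain ⟨a, b, hab⟩ : ∃ a b, cs κ '' Icc 0 R = Icc a b :=
    ⟨_, _, eq_Icc_of_connected_compact ((isConnected_Icc hR.le).image _ (continuous_cs κ).continuousOn)
      (isCompact_Icc.image (continuous_cs κ))⟩
  refine integral_mul_comp_eq_zero_of_pow (a := a) (b := b) (φ.integrable_mul_pow ω hκ l)
    (contDiff_cs_norm κ).continuous.aestronglyMeasurable (φ.integrable_moment ω hκ l hf) ?_ ?_ h
  · filter_upwards [ae_modelVol_mem j κ R] with v hv
    exact hab ▸ ⟨_, ⟨norm_nonneg v, (mem_ball_zero_iff.1 hv.1).le⟩, rfl⟩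
  · rw [← hab]
    rintro _ ⟨r, -, rfl⟩
    exact (hf r).continuousWithinAt

theorem ModelH1.moment_eq_zero_of_traceMoment (hκ0 : κ ≠ 0) (hκ : 0 < κ → √κ * R < Real.pi)
    (hR : 0 < R) (hβ : β * sn κ R = cs κ R) (hφ : ∀ ψ, robinForm β φ ψ = 0) (l : ℕ)
    (hl : ∀ f : ℝ → ℝ, (∀ r, ContDiffAt ℝ (⊤ : ℕ∞) f (cs κ r)) →
      (l : ℝ) * (l - 1) * φ.moment ω (l - 2) f = 0)
    (ht : φ.traceMoment ω l = 0) {f : ℝ → ℝ} (hf : ∀ r, ContinuousAt f (cs κ r)) :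
    φ.moment ω l f = 0 := by
  refine φ.moment_eq_zero_of_pow ω hκ hR l (φ.moment_pow_eq_zero ω hκ hR l fun f hf => ?_) hf
  have h := sector_relation φ ω hκ hR hβ hφ l hf
  rw [ht, zero_mul] at h
  refine (mul_eq_zero.1 (?_ : κ * _ = 0)).resolve_left hκ0
  linear_combination -h - ‖ω‖ ^ 2 * hl f hf

/-- With T the boundary moment of degree ℓ + 2, the weak relation reads T s^(ℓ+2) Bf = κ L(f), and
the Wronskian identity reads s^(n+ℓ+2) Bf = κ J(f) + (ℓ + 1)(n + ℓ + 1) I(f), where s = s_κ(R) and B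
is the boundary factor common to both. If T ≠ 0, Rolle's theorem gives a positive test function f
with s^n L(f) = T J(f). Subtraction leaves T I(f) = 0 although I(f) > 0. -/
theorem ModelH1.traceMoment_eq_zero (hκ : 0 < κ → √κ * R < Real.pi)
    (hR : 0 < R) (hβ : β * sn κ R = cs κ R) (hφ : ∀ ψ, robinForm β φ ψ = 0) (l : ℕ)
    (hl : ∀ f : ℝ → ℝ, (∀ r, ContinuousAt f (cs κ r)) → φ.moment ω l f = 0) :
    φ.traceMoment ω (l + 2) = 0 := by
  by_contra hT
  set T := φ.traceMoment ω (l + 2) with hTdef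
  obtain ⟨B, x₁, hB, h0, h1, hbd⟩ := exists_cs_bounds hκ hR
  have hb1 : ∀ᵐ v ∂(modelVol (j + 2) κ R), |(1 - cs κ ‖v‖) / 2| ≤ B ∧ (1 - cs κ ‖v‖) / 2 ≤ x₁ := by
    filter_upwards [ae_modelVol_mem j κ R] with v hv
    exact hbd _ (norm_nonneg v) (mem_ball_zero_iff.1 hv.1).le
  have hb2 : ∀ᵐ r ∂(volume.restrict (Ioc 0 R)), |(1 - cs κ r) / 2| ≤ B ∧ (1 - cs κ r) / 2 ≤ x₁ := by
    filter_upwards [ae_restrict_mem measurableSet_Ioc] with r hr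
    exact hbd _ hr.1.le hr.2
  have hcs := continuous_cs κ
  have hsn := continuous_sn κ
  have hw' : Integrable (fun r => sn κ r ^ (j + 2 + l + 2)) (volume.restrict (Ioc 0 R)) :=
    ((hsn.pow _).integrableOn_Icc).mono_set Ioc_subset_Icc_self
  have hx' : AEStronglyMeasurable (fun r => (1 - cs κ r) / 2) (volume.restrict (Ioc 0 R)) :=
    ((continuous_const.sub hcs).div_const 2).aestronglyMeasurable
  -- The Euler parameters for degree ℓ + 2; a = ℓ + 1 is positive, as Rolle's theorem requires. The
  -- second measure is radial, with weight s_κ^(n+ℓ+2).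
  obtain ⟨τ, hτ, h⟩ := exists_hypImage_combination_eq_zero (b := l + 2 + (j + 2)) (a := l + 1)
    (c := ((j + 2 : ℕ) : ℝ) / 2 + (l + 2 : ℕ)) (φ.integrable_mul_pow ω hκ (l + 2))
    (aestronglyMeasurable_hypVar (κ := κ) _) hw' hx' hB h0 h1 hb1 hb2 (by omega)
    (by push_cast; ring) (by push_cast; linarith [(Nat.cast_nonneg j : (0:ℝ) ≤ j)])
    (by positivity) (sn κ R ^ (j + 2) / T)
  have hf := contDiffAt_hypTest (κ := κ) (l + 2 + (j + 2)) hτ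
  have e1 := φ.moment_hypTest ω (j + 2) (l + 2) hτ
  have e2 : ∫ r, sn κ r ^ (j + 2 + l + 2) * hypImage (l + 2 + (j + 2))
        (((j + 2 : ℕ) : ℝ) / 2 + (l + 2 : ℕ)) τ ((1 - cs κ r) / 2) ∂(volume.restrict (Ioc 0 R)) =
      ∫ r in (0 : ℝ)..R, sn κ r ^ (j + 2 + l + 2) *
        sectorOp (j + 2) (l + 2) (hypTest (l + 2 + (j + 2)) τ) (cs κ r) := by
    rw [intervalIntegral.integral_of_le hR.le]
    refine integral_congr_ae (Filter.Eventually.of_forall fun r => ?_)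
    simp only [sectorOp_hypTest (j + 2) (l + 2) (one_sub_mul_pos hτ (neg_one_le_cs κ r)).ne']
  rw [← e1, e2] at h
  have hrel := sector_relation φ ω hκ hR hβ hφ (l + 2) hf
  rw [Nat.add_sub_cancel, hl _ fun r => (hf r).continuousAt, mul_zero, add_zero, ← hTdef] at hrel
  have hflux := flux_identity (κ := κ) (R := R) (j + 2) l hβ hf
  have hpos : 0 < ∫ r in (0 : ℝ)..R, sn κ r ^ (j + 2 + l) * hypTest (l + 2 + (j + 2)) τ (cs κ r) := by
    refine intervalIntegral.intervalIntegral_pos_of_pos_on ?_ (fun r hr => ?_) hR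
    · refine Continuous.intervalIntegrable ((hsn.pow _).mul ?_) _ _
      exact continuous_iff_continuousAt.2 fun r => (hf r).continuousAt.comp hcs.continuousAt
    · exact mul_pos (pow_pos (sn_pos hκ hr.1 hr.2.le) _)
        (inv_pos.2 (pow_pos (one_sub_mul_pos hτ (neg_one_le_cs κ r)) _))
  set I := ∫ r in (0 : ℝ)..R, sn κ r ^ (j + 2 + l) * hypTest (l + 2 + (j + 2)) τ (cs κ r)
  set J := ∫ r in (0 : ℝ)..R, sn κ r ^ (j + 2 + l + 2) *
        sectorOp (j + 2) (l + 2) (hypTest (l + 2 + (j + 2)) τ) (cs κ r)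
  set L := φ.moment ω (l + 2) (sectorOp (j + 2) (l + 2) (hypTest (l + 2 + (j + 2)) τ))
  have h2 : sn κ R ^ (j + 2) * L = T * J := by
    field_simp at h
    linarith
  have h3 : T * ((l + 1) * ((j + 2 : ℕ) + l + 1) * I) = 0 := by
    push_cast at hrel hflux ⊢
    have h4 : sn κ R ^ (j + 2 + l + 2) = sn κ R ^ (j + 2) * sn κ R ^ (l + 2) := by ring
    rw [h4] at hflux
    linear_combination (-T) * hflux + sn κ R ^ (j + 2) * hrel + κ * h2
  refine (mul_ne_zero hT (mul_ne_zero ?_ hpos.ne')) h3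
  positivity

/-- All moments of a weak solution vanish, if the boundary moments of degrees zero and one do. -/
theorem ModelH1.moment_eq_zero (hκ0 : κ ≠ 0) (hκ : 0 < κ → √κ * R < Real.pi)
    (hR : 0 < R) (hβ : β * sn κ R = cs κ R) (hφ : ∀ ψ, robinForm β φ ψ = 0)
    (h0 : φ.traceMoment ω 0 = 0) (h1 : φ.traceMoment ω 1 = 0) (l : ℕ) :
    ∀ f : ℝ → ℝ, (∀ r, ContinuousAt f (cs κ r)) → φ.moment ω l f = 0 := by
  induction l using Nat.twoStepInduction with
  | zero =>
    exact fun f hf => φ.moment_eq_zero_of_traceMoment ω hκ0 hκ hR hβ hφ 0 (by simp) h0 hf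
  | one =>
    exact fun f hf => φ.moment_eq_zero_of_traceMoment ω hκ0 hκ hR hβ hφ 1 (by simp) h1 hf
  | more l ih _ =>
    -- Vanishing in degree ℓ is used twice: to kill the boundary moment of degree ℓ + 2, and to
    -- remove the lower-order term of the sector relation.
    refine fun f hf => φ.moment_eq_zero_of_traceMoment ω hκ0 hκ hR hβ hφ (l + 2) (fun f hf => ?_)
      (φ.traceMoment_eq_zero ω hκ hR hβ hφ l ih) hf
    rw [Nat.add_sub_cancel, ih f fun r => (hf r).continuousAt, mul_zero]

end

/-! ### Completeness of the sectors and the kernel -/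

section
variable {j : ℕ} {κ R β : ℝ}

/-- `exp(λ c_κ(r) + s_κ(r) ⟨ω, θ⟩)` on the closed ball. -/
def expField (j : ℕ) (κ R : ℝ) (p : ℝ × EuclideanSpace ℝ (Fin (j + 2))) :
    C(closedBall (0 : EuclideanSpace ℝ (Fin (j + 2))) R, ℝ) where
  toFun v := Real.exp (p.1 * cs κ ‖(v : EuclideanSpace ℝ (Fin (j + 2)))‖ + linField κ p.2 v)
  continuous_toFun := by
    have h1 := (contDiff_cs_norm (n := j + 2) κ).continuous
    have h2 := (contDiff_linField κ p.2).continuous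
    exact Real.continuous_exp.comp (((continuous_const.mul h1).add h2).comp continuous_subtype_val)

theorem linField_add {n : ℕ} (ω ω' v : EuclideanSpace ℝ (Fin n)) :
    linField κ (ω + ω') v = linField κ ω v + linField κ ω' v := by
  simp only [linField, inner_add_left, mul_add]

theorem linField_smul {n : ℕ} (a : ℝ) (ω v : EuclideanSpace ℝ (Fin n)) :
    linField κ (a • ω) v = a * linField κ ω v := by
  simp only [linField, real_inner_smul_left]
  ring

theorem linField_zero {n : ℕ} (v : EuclideanSpace ℝ (Fin n)) : linField κ 0 v = 0 := by
  simp [linField]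

theorem expField_mul (p q : ℝ × EuclideanSpace ℝ (Fin (j + 2))) :
    expField j κ R p * expField j κ R q = expField j κ R (p + q) := by
  ext v
  simp only [expField, ContinuousMap.mul_apply, ContinuousMap.coe_mk, ← Real.exp_add,
    Prod.fst_add, Prod.snd_add, linField_add]
  ring_nf

theorem expField_zero : expField j κ R 0 = 1 := by
  ext v
  simp [expField, linField_zero]

/-- The algebra generated by the functions `expField`. -/
def expAlgebra (j : ℕ) (κ R : ℝ) :
    Subalgebra ℝ C(closedBall (0 : EuclideanSpace ℝ (Fin (j + 2))) R, ℝ) :=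
  Algebra.adjoin ℝ (range (expField j κ R))

/-- Exponentials are closed under multiplication, so it is enough to integrate φ against each one of
them. -/
theorem expAlgebra_eq_span : Subalgebra.toSubmodule (expAlgebra j κ R) =
    Submodule.span ℝ (range (expField j κ R)) := by
  refine Algebra.adjoin_eq_span_of_subset ℝ (subset_trans (fun x hx => ?_) Submodule.subset_span)
  induction hx using Submonoid.closure_induction with
  | mem x h => exact h
  | one => exact ⟨0, expField_zero⟩
  | mul x y _ _ hx hy =>
    obtain ⟨p, rfl⟩ := hx
    obtain ⟨q, rfl⟩ := hy
    exact ⟨p + q, (expField_mul p q).symm⟩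

theorem cs_ne_of_lt (hκ0 : κ ≠ 0) (hκ : 0 < κ → √κ * R < Real.pi) {r s : ℝ} (hr : 0 ≤ r)
    (hrs : r < s) (hs : s ≤ R) : cs κ r ≠ cs κ s := by
  have := kappa_mul_cs_lt (R := s) hκ0
    (fun h => (mul_le_mul_of_nonneg_left hs (Real.sqrt_nonneg κ)).trans_lt (hκ h)) hr hrs
  intro h
  rw [h] at this
  exact lt_irrefl _ this

theorem expAlgebra_separatesPoints (hκ0 : κ ≠ 0) (hκ : 0 < κ → √κ * R < Real.pi) :
    (expAlgebra j κ R).SeparatesPoints := by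
  intro u v huv
  have huv' : (u : EuclideanSpace ℝ (Fin (j + 2))) ≠ v := fun h => huv (Subtype.ext h)
  have hu : ‖(u : EuclideanSpace ℝ (Fin (j + 2)))‖ ≤ R := mem_closedBall_zero_iff.1 u.2
  have hv : ‖(v : EuclideanSpace ℝ (Fin (j + 2)))‖ ≤ R := mem_closedBall_zero_iff.1 v.2
  have hmem : ∀ p, expField j κ R p ∈ expAlgebra j κ R := fun p =>
    Algebra.subset_adjoin ⟨p, rfl⟩
  by_cases hn : ‖(u : EuclideanSpace ℝ (Fin (j + 2)))‖ = ‖(v : EuclideanSpace ℝ (Fin (j + 2)))‖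
  -- Points at equal radius are separated in the direction ω = u - v; points at different radii are
  -- separated by c_κ, which is injective on [0, R].
  · refine ⟨_, ⟨_, hmem (0, (u : EuclideanSpace ℝ (Fin (j + 2))) - v), rfl⟩, ?_⟩
    simp only [expField, ContinuousMap.coe_mk, zero_mul, zero_add, ne_eq, Real.exp_eq_exp]
    have h0 : (u : EuclideanSpace ℝ (Fin (j + 2))) ≠ 0 := by
      intro h
      rw [h, norm_zero, eq_comm, norm_eq_zero] at hn
      exact huv' (h.trans hn.symm)
    have h0' : (v : EuclideanSpace ℝ (Fin (j + 2))) ≠ 0 := by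
      intro h
      rw [h, norm_zero, norm_eq_zero] at hn
      exact h0 hn
    have e : snRatio κ (u : EuclideanSpace ℝ (Fin (j + 2))) = snRatio κ v.1 := by
      rw [snRatio_eq κ h0, snRatio_eq κ h0', hn]
    rw [linField, linField, e, ← sub_eq_zero, ← mul_sub, ← inner_sub_right,
      real_inner_self_eq_norm_sq]
    refine mul_ne_zero (snRatio_pos hκ hv).ne' (pow_ne_zero _ ?_)
    exact norm_ne_zero_iff.2 (sub_ne_zero.2 huv')
  · refine ⟨_, ⟨_, hmem (1, 0), rfl⟩, ?_⟩
    simp only [expField, ContinuousMap.coe_mk, one_mul, linField_zero, add_zero, ne_eq,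
      Real.exp_eq_exp]
    rcases lt_or_gt_of_ne hn with h | h
    · exact cs_ne_of_lt hκ0 hκ (norm_nonneg _) h hv
    · exact (cs_ne_of_lt hκ0 hκ (norm_nonneg _) h hu).symm

/-- With f = exp(a ·) the moments are those of the weight φ exp(a c_κ) against powers of the bounded
variable s_κ⟨ω, θ⟩. They all vanish, so polynomial approximation extends this to the exponential. -/
theorem ModelH1.integral_mul_exp_eq_zero (hκ : 0 < κ → √κ * R < Real.pi)
    (φ : ModelH1 (j + 2) κ R) (ω : EuclideanSpace ℝ (Fin (j + 2)))
    (h : ∀ (l : ℕ) (f : ℝ → ℝ), (∀ r, ContinuousAt f (cs κ r)) → φ.moment ω l f = 0) (a : ℝ) :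
    ∫ v, φ.fn v * Real.exp (a * cs κ ‖v‖ + linField κ ω v) ∂(modelVol (j + 2) κ R) = 0 := by
  have c1 := (contDiff_cs_norm (n := j + 2) κ).continuous
  have c2 := (contDiff_linField κ ω).continuous
  obtain ⟨B, hB⟩ := (isCompact_closedBall (0 : EuclideanSpace ℝ (Fin (j + 2))) R).bddAbove_image
    c2.norm.continuousOn
  have hint : ∀ {g : EuclideanSpace ℝ (Fin (j + 2)) → ℝ}, Continuous g →
      Integrable (fun v => φ.fn v * g v) (modelVol (j + 2) κ R) := fun hg =>
    φ.memLp_fn.integrable_mul (memLp_modelVol_of_continuous (p := 2) hκ hg)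
  have e : ∀ v, φ.fn v * Real.exp (a * cs κ ‖v‖ + linField κ ω v) =
      φ.fn v * Real.exp (a * cs κ ‖v‖) * Real.exp (linField κ ω v) := fun v => by
    rw [Real.exp_add]; ring
  have hi := hint (g := fun v => Real.exp (a * cs κ ‖v‖ + linField κ ω v)) (by fun_prop)
  simp only [e] at hi ⊢
  refine integral_mul_comp_eq_zero_of_pow (a := -B) (b := B)
    (hint (g := fun v => Real.exp (a * cs κ ‖v‖)) (by fun_prop)) c2.aestronglyMeasurable hi ?_
    Real.continuous_exp.continuousOn fun k => ?_
  · filter_upwards [ae_modelVol_mem j κ R] with v hv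
    exact abs_le.1 (hB ⟨v, ball_subset_closedBall hv.1, rfl⟩)
  · rw [← h k (fun s => Real.exp (a * s)) (fun r => by fun_prop), ModelH1.moment]
    refine integral_congr_ae (Filter.Eventually.of_forall fun v => ?_)
    ring

/-- Stone–Weierstrass on the closed ball approximates any smooth compactly supported g uniformly by
combinations of the exponentials, to which φ is orthogonal. -/
theorem ModelH1.fn_ae_eq_zero (hκ0 : κ ≠ 0) (hκ : 0 < κ → √κ * R < Real.pi)
    (φ : ModelH1 (j + 2) κ R)
    (h : ∀ (ω : EuclideanSpace ℝ (Fin (j + 2))) (l : ℕ) (f : ℝ → ℝ),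
      (∀ r, ContinuousAt f (cs κ r)) → φ.moment ω l f = 0) :
    φ.fn =ᵐ[modelVol (j + 2) κ R] 0 := by
  have := isFiniteMeasure_modelVol (j := j) hκ
  have hφ : Integrable φ.fn (modelVol (j + 2) κ R) := φ.memLp_fn.integrable (by norm_num)
  have hint : ∀ {g : EuclideanSpace ℝ (Fin (j + 2)) → ℝ}, Continuous g →
      Integrable (fun v => φ.fn v * g v) (modelVol (j + 2) κ R) := fun hg =>
    φ.memLp_fn.integrable_mul (memLp_modelVol_of_continuous (p := 2) hκ hg)
  -- The algebra consists of functions on the subtype; each element is replaced by a continuous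
  -- extension to the whole space, where the integrals are formed.
  have hA : ∀ a ∈ expAlgebra j κ R, ∃ g : EuclideanSpace ℝ (Fin (j + 2)) → ℝ, Continuous g ∧
      (∀ v : closedBall (0 : EuclideanSpace ℝ (Fin (j + 2))) R, g v = a v) ∧
      ∫ v, φ.fn v * g v ∂(modelVol (j + 2) κ R) = 0 := by
    intro a ha
    rw [← Subalgebra.mem_toSubmodule, expAlgebra_eq_span] at ha
    induction ha using Submodule.span_induction with
    | mem x hx =>
      obtain ⟨p, rfl⟩ := hx
      have c1 := (contDiff_cs_norm (n := j + 2) κ).continuous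
      have c2 := (contDiff_linField κ p.2).continuous
      exact ⟨fun v => Real.exp (p.1 * cs κ ‖v‖ + linField κ p.2 v), by fun_prop, fun v => rfl,
        φ.integral_mul_exp_eq_zero hκ p.2 (h p.2) p.1⟩
    | zero => exact ⟨0, continuous_const, fun v => rfl, by simp⟩
    | add x y _ _ hx hy =>
      obtain ⟨g₁, c₁, e₁, i₁⟩ := hx
      obtain ⟨g₂, c₂, e₂, i₂⟩ := hy
      refine ⟨fun v => g₁ v + g₂ v, c₁.add c₂, fun v => by simp [e₁, e₂], ?_⟩
      simp only [mul_add]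
      rw [integral_add (hint c₁) (hint c₂), i₁, i₂, add_zero]
    | smul a x _ hx =>
      obtain ⟨g, c, e, i⟩ := hx
      refine ⟨fun v => a * g v, continuous_const.mul c, fun v => by simp [e], ?_⟩
      simp only [mul_left_comm _ a]
      rw [integral_const_mul, i, mul_zero]
  refine ae_eq_zero_of_integral_contDiff_smul_eq_zero hφ.locallyIntegrable fun g hg _ => ?_
  have hgc := hg.continuous
  have : CompactSpace (closedBall (0 : EuclideanSpace ℝ (Fin (j + 2))) R) :=
    isCompact_iff_compactSpace.1 (isCompact_closedBall _ _)
  set M := ∫ v, ‖φ.fn v‖ ∂(modelVol (j + 2) κ R)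
  have hM : 0 ≤ M := integral_nonneg fun _ => norm_nonneg _
  refine abs_nonpos_iff.1 (le_of_forall_pos_le_add fun ε hε => ?_)
  obtain ⟨⟨a, ha⟩, hap⟩ := ContinuousMap.exists_mem_subalgebra_near_continuousMap_of_separatesPoints
    (expAlgebra j κ R) (expAlgebra_separatesPoints hκ0 hκ)
    ⟨fun v => g v, hgc.comp continuous_subtype_val⟩ (ε / (M + 1)) (by positivity)
  obtain ⟨a', ca, ea, ia⟩ := hA a ha
  have e : ∫ v, g v • φ.fn v ∂(modelVol (j + 2) κ R) =
      ∫ v, φ.fn v * (g v - a' v) ∂(modelVol (j + 2) κ R) := by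
    simp only [mul_sub]
    rw [integral_sub (hint hgc) (hint ca), ia, sub_zero]
    simp only [smul_eq_mul, mul_comm]
  rw [e, zero_add, ← Real.norm_eq_abs]
  calc ‖∫ v, φ.fn v * (g v - a' v) ∂(modelVol (j + 2) κ R)‖
      ≤ ∫ v, ‖φ.fn v‖ * (ε / (M + 1)) ∂(modelVol (j + 2) κ R) := by
        refine norm_integral_le_of_norm_le (hφ.norm.mul_const _) ?_
        filter_upwards [ae_modelVol_mem j κ R] with v hv
        rw [norm_mul]
        refine mul_le_mul_of_nonneg_left ?_ (norm_nonneg _)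
        rw [norm_sub_rev, ea ⟨v, ball_subset_closedBall hv.1⟩]
        exact ((ContinuousMap.norm_coe_le_norm _
          (⟨v, ball_subset_closedBall hv.1⟩ : closedBall (0 : EuclideanSpace ℝ (Fin (j + 2))) R)).trans
          hap.le)
    _ = M * (ε / (M + 1)) := integral_mul_const _ _
    _ ≤ ε := by
        rw [mul_div_assoc', div_le_iff₀ (by positivity)]
        nlinarith

/-- The divergence theorem on the unit ball for the field ⟨ω, v⟩ω', whose divergence is the constant
⟨ω, ω'⟩; c is the volume of the unit ball. -/
theorem exists_integral_inner_sphere (j : ℕ) :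
    ∃ c : ℝ, 0 < c ∧ ∀ ω ω' : EuclideanSpace ℝ (Fin (j + 2)),
      ∫ θ : sphere (0 : EuclideanSpace ℝ (Fin (j + 2))) 1,
        inner ℝ ω (θ : EuclideanSpace ℝ (Fin (j + 2))) *
          inner ℝ ω' (θ : EuclideanSpace ℝ (Fin (j + 2)))
        ∂(volume : Measure (EuclideanSpace ℝ (Fin (j + 2)))).toSphere = c * inner ℝ ω ω' := by
  refine ⟨volume.real (ball (0 : EuclideanSpace ℝ (Fin (j + 2))) 1),
    ENNReal.toReal_pos (measure_ball_pos volume _ one_pos).ne' measure_ball_lt_top.ne,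
    fun ω ω' => ?_⟩
  have hY : ContDiff ℝ 1 (fun v : EuclideanSpace ℝ (Fin (j + 2)) => (inner ℝ ω v : ℝ) • ω') :=
    (contDiff_const.inner ℝ contDiff_id).smul contDiff_const
  have h := integral_divergence_ball (Nat.succ_pos _) one_pos hY
  have hd : ∀ v, divergence (fun v : EuclideanSpace ℝ (Fin (j + 2)) => (inner ℝ ω v : ℝ) • ω') v =
      inner ℝ ω ω' := by
    intro v
    have h1 : HasFDerivAt (fun v : EuclideanSpace ℝ (Fin (j + 2)) => (inner ℝ ω v : ℝ))
        (innerSL ℝ ω) v := (innerSL ℝ ω).hasFDerivAt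
    rw [divergence_smul h1.differentiableAt (differentiableAt_const _), h1.fderiv, divergence_const]
    simp
  simp only [hd, one_pow, one_mul, one_smul, real_inner_smul_left] at h
  rw [← h, setIntegral_const, smul_eq_mul]

/-- An element of the kernel of the form is one of the functions `s_κ(r) ⟨ω, θ⟩`. -/
theorem ModelH1.exists_fn_ae_eq_linField (hκ0 : κ ≠ 0) (hκ : 0 < κ → √κ * R < Real.pi)
    (hR : 0 < R) (hβ : β * sn κ R = cs κ R) {φ : ModelH1 (j + 2) κ R}
    (hφ : φ ∈ robinKernel (j + 2) κ R β) :
    ∃ ω, φ.fn =ᵐ[modelVol (j + 2) κ R] linField κ ω := by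
  have hs := sn_pos hκ hR le_rfl
  have := isFiniteMeasure_modelArea (j + 2) κ R
  obtain ⟨c, hc, hcω⟩ := exists_integral_inner_sphere j
  have htr : Integrable φ.trace (modelArea (j + 2) κ R) := φ.memLp_trace.integrable (by norm_num)
  have hvec : Integrable (fun θ : sphere (0 : EuclideanSpace ℝ (Fin (j + 2))) 1 =>
      φ.trace θ • (θ : EuclideanSpace ℝ (Fin (j + 2)))) (modelArea (j + 2) κ R) :=
    htr.smul_bdd 1 continuous_subtype_val.aestronglyMeasurable
      (Filter.Eventually.of_forall fun θ => by simp)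
  set a := ∫ θ : sphere (0 : EuclideanSpace ℝ (Fin (j + 2))) 1,
    φ.trace θ • (θ : EuclideanSpace ℝ (Fin (j + 2))) ∂(modelArea (j + 2) κ R) with ha
  have haω : ∀ ω, φ.traceMoment ω 1 = inner ℝ ω a := by
    intro ω
    have := ContinuousLinearMap.integral_comp_comm (innerSL ℝ ω) hvec
    rw [innerSL_apply_apply] at this
    rw [ha, ← this, ModelH1.traceMoment]
    refine integral_congr_ae (Filter.Eventually.of_forall fun θ => ?_)
    simp
  -- Normalization that makes the first boundary moments of s_κ⟨ω₀, θ⟩ equal those of φ: one power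
  -- of s_κ(R) comes from the trace, the other j + 1 from the area, and c from the sphere integral.
  set ω₀ : EuclideanSpace ℝ (Fin (j + 2)) := (sn κ R ^ (j + 1) * sn κ R * c)⁻¹ • a with hω₀
  set ψ := φ.addSmul hκ hs (linH1 hκ hR ω₀) (-1) with hψ
  have hψ0 : ∀ χ, robinForm β ψ χ = 0 := by
    intro χ
    rw [robinForm_comm, hψ, robinForm_addSmul, robinForm_lin hκ hR hβ, robinForm_comm,
      robinForm_eq_zero_of_mem_robinKernel hκ0 hκ hR hφ]
    ring
  have hlin : ∀ θ : sphere (0 : EuclideanSpace ℝ (Fin (j + 2))) 1, (linH1 hκ hR ω₀).trace θ =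
      sn κ R * inner ℝ ω₀ (θ : EuclideanSpace ℝ (Fin (j + 2))) := by
    intro θ
    simp only [linH1, smoothH1]
    rw [testFn_smul_sphere hR _ _ _ (by simp), one_mul]
  have hlini : Integrable (linH1 hκ hR ω₀).trace (modelArea (j + 2) κ R) :=
    (linH1 hκ hR ω₀).memLp_trace.integrable (by norm_num)
  have h0 : ∀ ω, ψ.traceMoment ω 0 = 0 := by
    intro ω
    have h1 := hφ.1.2
    have h2 := (meanZero_lin hκ0 hκ hR hβ ω₀).2
    simp only [ModelH1.traceMoment, hψ, ModelH1.addSmul, pow_zero, mul_one]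
    rw [integral_add htr (hlini.const_mul _), integral_const_mul, h1, h2]
    simp
  have h1 : ∀ ω, ψ.traceMoment ω 1 = 0 := by
    intro ω
    have hb : ∀ {g : sphere (0 : EuclideanSpace ℝ (Fin (j + 2))) 1 → ℝ},
        Integrable g (modelArea (j + 2) κ R) → Integrable (fun θ => g θ *
          inner ℝ ω (θ : EuclideanSpace ℝ (Fin (j + 2)))) (modelArea (j + 2) κ R) := fun hg =>
      hg.mul_bdd (c := ‖ω‖) (by fun_prop) (Filter.Eventually.of_forall fun θ => by
        simpa using norm_inner_le_norm (𝕜 := ℝ) ω (θ : EuclideanSpace ℝ (Fin (j + 2))))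
    have e1 := haω ω
    simp only [ModelH1.traceMoment, pow_one] at e1
    simp only [ModelH1.traceMoment, hψ, ModelH1.addSmul, pow_one, add_mul, mul_assoc]
    rw [integral_add (hb htr) ((hb hlini).const_mul _), integral_const_mul, e1]
    simp only [hlin, mul_assoc]
    rw [integral_const_mul, integral_modelArea hs.le, hcω, hω₀, real_inner_smul_left,
      real_inner_comm ω a]
    simp only [show j + 2 - 1 = j + 1 from rfl]
    field_simp
    ring
  have hz := ψ.fn_ae_eq_zero hκ0 hκ fun ω l =>
    ψ.moment_eq_zero ω hκ0 hκ hR hβ hψ0 (h0 ω) (h1 ω) l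
  refine ⟨ω₀, ?_⟩
  filter_upwards [hz] with v hv
  simp only [hψ, ModelH1.addSmul, linH1, smoothH1, testFn, Pi.zero_apply] at hv
  linarith

theorem linH1_mem_robinKernel (hκ0 : κ ≠ 0) (hκ : 0 < κ → √κ * R < Real.pi) (hR : 0 < R)
    (hβ : β * sn κ R = cs κ R) (ω : EuclideanSpace ℝ (Fin (j + 2))) :
    linH1 hκ hR ω ∈ robinKernel (j + 2) κ R β :=
  ⟨meanZero_lin hκ0 hκ hR hβ ω, fun ψ _ => by rw [robinForm_comm, robinForm_lin hκ hR hβ]⟩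

end

/-! ### Scaling and the Escobar profile -/

theorem eLpNorm_restrict_comp_affine {E : Type*} [NormedAddCommGroup E] [NormedSpace ℝ E]
    [FiniteDimensional ℝ E] [MeasurableSpace E] [BorelSpace E] (μ : Measure E)
    [μ.IsAddHaarMeasure] {a : ℝ} (ha : 0 < a) (b : E) (S : Set E) (g : E → ℝ) (q : ENNReal) :
    eLpNorm g q (μ.restrict S) = ENNReal.ofReal (a ^ Module.finrank ℝ E) ^ (1 / q).toReal *
      eLpNorm (fun y => g (a • y + b)) q (μ.restrict ((fun y => a • y + b) ⁻¹' S)) := by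
  have hA : MeasurableEmbedding fun y : E => a • y + b :=
    ((Homeomorph.smulOfNeZero a ha.ne').trans (Homeomorph.addRight b)).measurableEmbedding
  have hmap : Measure.map (fun y : E => a • y + b) μ =
      ENNReal.ofReal (a ^ Module.finrank ℝ E)⁻¹ • μ := by
    have h1 : (fun y : E => a • y + b) = (fun y => y + b) ∘ (fun y => a • y) := rfl
    rw [h1, ← Measure.map_map (measurable_add_const b) (measurable_const_smul a),
      Measure.map_addHaar_smul _ ha.ne', abs_of_pos (by positivity), Measure.map_smul,
      map_add_right_eq_self]
  have hpos : 0 < a ^ Module.finrank ℝ E := by positivity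
  have hμ : μ.restrict S = ENNReal.ofReal (a ^ Module.finrank ℝ E) •
      Measure.map (fun y : E => a • y + b) (μ.restrict ((fun y => a • y + b) ⁻¹' S)) := by
    rw [← hA.restrict_map, hmap, Measure.restrict_smul, smul_smul, ← ENNReal.ofReal_mul hpos.le,
      mul_inv_cancel₀ hpos.ne', ENNReal.ofReal_one, one_smul]
  rw [hμ, eLpNorm_smul_measure_of_ne_zero (by simpa using hpos), hA.eLpNorm_map_measure]
  rfl

section
variable {m : ℕ}

theorem bdryPoint_zero (x : EuclideanSpace ℝ (Fin m)) : bdryPoint x 0 = 0 := rfl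

theorem bdryPoint_succ (x : EuclideanSpace ℝ (Fin m)) (i : Fin m) :
    bdryPoint x i.succ = x i := rfl

theorem profile_zero_affine {C a : ℝ} (ha : 0 < a) {n : ℕ}
    {p b x y : EuclideanSpace ℝ (Fin n)} (h : x - p = a • (y - b)) :
    profile C 0 p x = C * (a ^ 2) ^ (-((n : ℝ) - 2) / 2) * profile 1 0 b y := by
  rw [profile, profile, h, norm_smul, Real.norm_of_nonneg ha.le, add_zero, add_zero, mul_pow,
    Real.mul_rpow (by positivity) (by positivity)]
  ring

/-- The dilation by -p₁ and a translation carry the standard profile to this one. Its factor is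
written exactly as for the boundary norm, since n/2^* = (n - 1)/2^# = (n - 2)/2; the ratio of the
norms is therefore invariant. -/
theorem bulkNorm_escobar (hm : 2 ≤ m) {C : ℝ} {p : EuclideanSpace ℝ (Fin (m + 1))}
    (hC : 0 < C) (hp : p 0 < 0) :
    bulkNorm (profile C 0 p) = ENNReal.ofReal ((-p 0) ^ ((((m + 1 : ℕ) : ℝ) - 2) / 2) *
      (C * ((-p 0) ^ 2) ^ (-(((m + 1 : ℕ) : ℝ) - 2) / 2))) *
        bulkNorm (m := m) (profile 1 0 (-EuclideanSpace.single 0 1)) := by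
  have ha : 0 < -p 0 := by linarith
  have hm' : (2 : ℝ) ≤ m := by exact_mod_cast hm
  have hS : (fun y : EuclideanSpace ℝ (Fin (m + 1)) =>
      (-p 0) • y + (p + (-p 0) • EuclideanSpace.single 0 1)) ⁻¹' halfSpace m = halfSpace m := by
    ext y
    simp [halfSpace, mul_neg_iff, hp, hp.not_gt]
  rw [bulkNorm, eLpNorm_restrict_comp_affine volume ha (p + (-p 0) • EuclideanSpace.single 0 1),
    hS]
  have hg : (fun y : EuclideanSpace ℝ (Fin (m + 1)) => profile C 0 p
      ((-p 0) • y + (p + (-p 0) • EuclideanSpace.single 0 1))) =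
      (C * ((-p 0) ^ 2) ^ (-(((m + 1 : ℕ) : ℝ) - 2) / 2)) •
        profile 1 0 (-EuclideanSpace.single 0 1) := by
    ext y
    rw [profile_zero_affine ha (b := -EuclideanSpace.single 0 1) (y := y)]
    · rfl
    · module
  have hc : 0 < C * ((-p 0) ^ 2) ^ (-(((m + 1 : ℕ) : ℝ) - 2) / 2) := by positivity
  rw [hg, eLpNorm_const_smul, ← mul_assoc, Real.enorm_of_nonneg hc.le,
    ENNReal.ofReal_rpow_of_pos (by positivity), ← ENNReal.ofReal_mul (by positivity), bulkNorm]
  congr 3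
  rw [one_div, ENNReal.toReal_inv, ENNReal.toReal_ofReal, twoStar, finrank_euclideanSpace,
    Fintype.card_fin, ← Real.rpow_natCast, ← Real.rpow_mul ha.le]
  · congr 1
    push_cast
    field_simp
  · rw [twoStar]
    push_cast
    exact div_nonneg (by positivity) (by linarith)

theorem bdryNorm_escobar (hm : 2 ≤ m) {C : ℝ} {p : EuclideanSpace ℝ (Fin (m + 1))}
    (hC : 0 < C) (hp : p 0 < 0) :
    bdryNorm (profile C 0 p) = ENNReal.ofReal ((-p 0) ^ ((((m + 1 : ℕ) : ℝ) - 2) / 2) *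
      (C * ((-p 0) ^ 2) ^ (-(((m + 1 : ℕ) : ℝ) - 2) / 2))) *
        bdryNorm (m := m) (profile 1 0 (-EuclideanSpace.single 0 1)) := by
  have ha : 0 < -p 0 := by linarith
  have hm' : (2 : ℝ) ≤ m := by exact_mod_cast hm
  set b : EuclideanSpace ℝ (Fin m) := WithLp.toLp 2 fun i => p i.succ with hb
  rw [bdryNorm, ← Measure.restrict_univ (μ := volume),
    eLpNorm_restrict_comp_affine volume ha b, preimage_univ, Measure.restrict_univ]
  have hg : (fun y : EuclideanSpace ℝ (Fin m) => profile C 0 p (bdryPoint ((-p 0) • y + b))) =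
      (C * ((-p 0) ^ 2) ^ (-(((m + 1 : ℕ) : ℝ) - 2) / 2)) •
        fun y => profile 1 0 (-EuclideanSpace.single 0 1) (bdryPoint y) := by
    ext y
    rw [profile_zero_affine ha (b := -EuclideanSpace.single 0 1) (y := bdryPoint y)]
    · rfl
    · ext i
      refine Fin.cases ?_ (fun i => ?_) i
      · simp [bdryPoint_zero]
      · simp [bdryPoint_succ, hb]
  have hc : 0 < C * ((-p 0) ^ 2) ^ (-(((m + 1 : ℕ) : ℝ) - 2) / 2) := by positivity
  rw [hg, eLpNorm_const_smul, ← mul_assoc, Real.enorm_of_nonneg hc.le,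
    ENNReal.ofReal_rpow_of_pos (by positivity), ← ENNReal.ofReal_mul (by positivity), bdryNorm]
  congr 3
  rw [one_div, ENNReal.toReal_inv, ENNReal.toReal_ofReal, twoSharp, finrank_euclideanSpace,
    Fintype.card_fin, ← Real.rpow_natCast, ← Real.rpow_mul ha.le]
  · congr 1
    push_cast
    rw [show (m : ℝ) + 1 - 1 = m by ring]
    field_simp
  · rw [twoSharp]
    push_cast
    exact div_nonneg (by linarith) (by linarith)

/-- A bridge extremal of the Escobar type has the Escobar threshold as its parameter. -/
theorem IsBridgeExtremal.ne_zero (hm : 2 ≤ m) {T : ℝ} (hT : 0 < T) (hTE : T ≠ escobarThreshold m)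
    {C c : ℝ} {p : EuclideanSpace ℝ (Fin (m + 1))} (hU : IsBridgeExtremal T C c p) : c ≠ 0 := by
  rintro rfl
  have hp : p 0 < 0 := by
    by_contra h
    -- For c = 0 the profile is singular at p, which must then lie outside the closed half-space.
    have := hU.regular p (not_lt.1 h)
    simp at this
  have h1 := hU.bulk
  have h2 := hU.bdry
  rw [bulkNorm_escobar hm hU.pos hp] at h1
  rw [bdryNorm_escobar hm hU.pos hp] at h2
  set k := (-p 0) ^ ((((m + 1 : ℕ) : ℝ) - 2) / 2) *
      (C * ((-p 0) ^ 2) ^ (-(((m + 1 : ℕ) : ℝ) - 2) / 2))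
  have hk : 0 < k := by
    have ha : 0 < -p 0 := by linarith
    have := hU.pos
    positivity
  refine hTE ?_
  rw [escobarThreshold, ← ENNReal.mul_div_mul_left _ _ (c := ENNReal.ofReal k) (by simpa using hk)
    ENNReal.ofReal_ne_top, h1, h2, div_one, ENNReal.toReal_ofReal hT.le]

end

/-! ### Caps of the model quadrics -/

section
variable {m : ℕ} {κ R η t k b : ℝ}

theorem modelPoint_eq {n : ℕ} (κ : ℝ) (v : EuclideanSpace ℝ (Fin n)) :
    modelPoint κ v = ((√|κ| * snRatio κ v) • v, cs κ ‖v‖) := by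
  rw [modelPoint, ← norm_mul_snRatio]
  by_cases hv : v = 0
  · simp [hv]
  · have : ‖v‖ ≠ 0 := norm_ne_zero_iff.2 hv
    rw [smul_smul]
    congr 2
    field_simp

theorem quadric_modelPoint {n : ℕ} (hηκ : η * |κ| = κ) (v : EuclideanSpace ℝ (Fin n)) :
    quadric η (modelPoint κ v) = 1 := by
  have h := cs_sq_add κ ‖v‖
  rw [← norm_mul_snRatio] at h
  rw [quadric, modelPoint_eq, norm_smul, mul_pow, Real.norm_eq_abs, sq_abs, mul_pow,
    Real.sq_sqrt (abs_nonneg κ)]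
  linear_combination h + (snRatio κ v ^ 2 * ‖v‖ ^ 2) * hηκ

/-- The cap `η b < η s` of the quadric. -/
def modelCap (n : ℕ) (η b : ℝ) : Set (EuclideanSpace ℝ (Fin n) × ℝ) :=
  {w | quadric η w = 1 ∧ (η = -1 → 0 < w.2) ∧ η * b < η * w.2}

/-- The image of the half-space `-t < y₁` under the inverse stereographic projection. -/
def stereoCap (m : ℕ) (η t : ℝ) : Set (EuclideanSpace ℝ (Fin (m + 1)) × ℝ) :=
  {w | quadric η w = 1 ∧ (η = -1 → 0 < w.2) ∧ η * -t < η * (η * w.1 0 - t * w.2)}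

/-- The height c_κ(r) determines the radius by strict monotonicity. For surjectivity the
intermediate value theorem gives r, the quadric equation then forces √|κ| s_κ(r) = ‖X‖, and X gives
the direction. -/
theorem bijOn_modelPoint {n : ℕ} (hκ0 : κ ≠ 0) (hη : η = 1 ∨ η = -1) (hηκ : η * |κ| = κ)
    (hκ : 0 < κ → √κ * R < Real.pi) (hR : 0 < R) :
    BijOn (modelPoint κ) (ball (0 : EuclideanSpace ℝ (Fin n)) R) (modelCap n η (cs κ R)) := by
  have hk : 0 < |κ| := abs_pos.2 hκ0
  have hsk : 0 < √|κ| := Real.sqrt_pos.2 hk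
  have hη2 : η * η = 1 := by rcases hη with rfl | rfl <;> norm_num
  have hlt : ∀ r, 0 ≤ r → r < R → η * cs κ R < η * cs κ r := by
    intro r h0 hr
    have := kappa_mul_cs_lt hκ0 hκ h0 hr
    rw [← hηκ] at this
    simp only [mul_right_comm η |κ|] at this
    rw [hηκ] at this
    exact lt_of_mul_lt_mul_right this hk.le
  refine ⟨fun v hv => ⟨quadric_modelPoint hηκ v, ?_, ?_⟩, fun u hu v hv huv => ?_, fun w hw => ?_⟩
  · rintro rfl
    have : κ < 0 := by linarith
    rw [modelPoint, cs_of_neg this]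
    exact Real.cosh_pos _
  · exact hlt _ (norm_nonneg v) (mem_ball_zero_iff.1 hv)
  · have hu' := mem_ball_zero_iff.1 hu
    have hv' := mem_ball_zero_iff.1 hv
    rw [modelPoint_eq, modelPoint_eq, Prod.mk.injEq] at huv
    have hn : ‖u‖ = ‖v‖ := by
      rcases lt_trichotomy ‖u‖ ‖v‖ with h | h | h
      · exact absurd huv.2 (cs_ne_of_lt hκ0 hκ (norm_nonneg _) h hv'.le)
      · exact h
      · exact absurd huv.2 (cs_ne_of_lt hκ0 hκ (norm_nonneg _) h hu'.le).symm
    have he : snRatio κ u = snRatio κ v := by rw [snRatio, snRatio, hn]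
    rw [he] at huv
    exact smul_right_injective _ (mul_pos hsk (snRatio_pos hκ hv'.le)).ne' huv.1
  · obtain ⟨hq, hs, hb⟩ := hw
    rw [quadric] at hq
    have hle : η * w.2 ≤ η * cs κ 0 := by
      rw [cs_zero]
      rcases hη with rfl | rfl
      · nlinarith [sq_nonneg ‖w.1‖]
      · have := hs rfl
        nlinarith [sq_nonneg ‖w.1‖]
    obtain ⟨r, hr, hrw⟩ := intermediate_value_Icc' hR.le
      (continuous_const.mul (continuous_cs κ) : Continuous fun r => η * cs κ r).continuousOn
      ⟨hb.le, hle⟩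
    have hrw' : cs κ r = w.2 := by
      have := congrArg (η * ·) hrw
      simpa [← mul_assoc, hη2] using this
    have hrR : r < R := by
      refine lt_of_le_of_ne hr.2 ?_
      rintro rfl
      exact hb.ne hrw
    have hsn : √|κ| * sn κ r = ‖w.1‖ := by
      have h0 : 0 ≤ sn κ r := by
        rcases hr.1.eq_or_lt with h | h
        · rw [← h, sn_zero]
        · exact (sn_pos hκ h hr.2).le
      refine (sq_eq_sq₀ (mul_nonneg hsk.le h0) (norm_nonneg _)).1 ?_
      have h1 := cs_sq_add κ r
      rw [mul_pow, Real.sq_sqrt hk.le]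
      rw [hrw'] at h1
      linear_combination η * h1 - η * hq + (η * sn κ r ^ 2) * hηκ +
        (‖w.1‖ ^ 2 - sn κ r ^ 2 * |κ|) * hη2
    by_cases hX : w.1 = 0
    · have hr0 : r = 0 := by
        by_contra h
        have := sn_pos hκ (lt_of_le_of_ne hr.1 (Ne.symm h)) hr.2
        rw [hX, norm_zero] at hsn
        exact (mul_pos hsk this).ne' hsn
      refine ⟨0, by simpa using hR, ?_⟩
      rw [hr0] at hrw'
      rw [modelPoint]
      ext1
      · simp [hX]
      · simpa using hrw'
    · have hX' : ‖w.1‖ ≠ 0 := norm_ne_zero_iff.2 hX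
      have hr0 : r ≠ 0 := by
        rintro rfl
        rw [sn_zero, mul_zero] at hsn
        exact hX' hsn.symm
      have hn : ‖r • (‖w.1‖⁻¹ • w.1)‖ = r := by
        rw [norm_smul, norm_smul, norm_inv, norm_norm, inv_mul_cancel₀ hX', mul_one,
          Real.norm_of_nonneg hr.1]
      refine ⟨r • (‖w.1‖⁻¹ • w.1), ?_, ?_⟩
      · rw [mem_ball_zero_iff, hn]; exact hrR
      · rw [modelPoint, hn, hrw', hsn, smul_smul r⁻¹, inv_mul_cancel₀ hr0, one_smul, smul_smul,
          mul_inv_cancel₀ hX', one_smul]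

/-- The condition under which the profile is regular on the half-space `-t ≤ y₁`. -/
def StereoRegular (m : ℕ) (η t : ℝ) : Prop :=
  ∀ y : EuclideanSpace ℝ (Fin (m + 1)), -t ≤ y 0 → 0 < ‖y‖ ^ 2 + η

theorem quadric_invStereo {n : ℕ} {y : EuclideanSpace ℝ (Fin n)}
    (hy : ‖y‖ ^ 2 + η ≠ 0) : quadric η (invStereo η y) = 1 := by
  rw [quadric, invStereo, norm_smul, mul_pow, Real.norm_eq_abs, sq_abs]
  field_simp
  ring

theorem one_sub_invStereo {n : ℕ} {y : EuclideanSpace ℝ (Fin n)}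
    (hy : ‖y‖ ^ 2 + η ≠ 0) : 1 - (invStereo η y).2 = 2 * η / (‖y‖ ^ 2 + η) := by
  rw [invStereo]
  field_simp
  ring

theorem invStereo_injOn {n : ℕ} (hη : η = 1 ∨ η = -1) :
    InjOn (invStereo η) {y : EuclideanSpace ℝ (Fin n) | ‖y‖ ^ 2 + η ≠ 0} := by
  intro y hy z hz h
  have hη0 : η ≠ 0 := by rcases hη with rfl | rfl <;> norm_num
  have h1 := one_sub_invStereo hy
  rw [h, one_sub_invStereo hz, div_eq_div_iff hz hy] at h1
  have h2 : ‖y‖ ^ 2 + η = ‖z‖ ^ 2 + η := mul_left_cancel₀ (mul_ne_zero two_ne_zero hη0) h1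
  have h3 : (2 / (‖y‖ ^ 2 + η)) • y = (2 / (‖z‖ ^ 2 + η)) • z := congrArg Prod.fst h
  rw [h2] at h3
  exact smul_right_injective _ (div_ne_zero two_ne_zero hz) h3

/-- Otherwise e₁, where |y|² - 1 vanishes, would lie in the closed half-space. -/
theorem StereoRegular.lt_neg_one (h : StereoRegular m (-1) t) : t < -1 := by
  by_contra hlt
  have := h (EuclideanSpace.single 0 1) (by simp; linarith)
  simp at this

/-- The inverse is y = ηX/(1 - s). It is defined on the whole cap because the projection centre X =
0, s = 1 turns the strict cap inequality into an equality. -/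
theorem bijOn_invStereo (hη : η = 1 ∨ η = -1) (hreg : StereoRegular m η t) :
    BijOn (invStereo η) {y : EuclideanSpace ℝ (Fin (m + 1)) | -t < y 0} (stereoCap m η t) := by
  have hη2 : η * η = 1 := by rcases hη with rfl | rfl <;> norm_num
  refine ⟨fun y hy => ?_, (invStereo_injOn hη).mono fun y hy => (hreg y (le_of_lt hy)).ne',
    fun w hw => ?_⟩
  · have hD := hreg y (le_of_lt hy)
    refine ⟨quadric_invStereo hD.ne', ?_, ?_⟩
    · rintro rfl
      exact div_pos (by have := sq_nonneg ‖y‖; linarith) hD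
    · have e : η * (η * (invStereo η y).1 0 - t * (invStereo η y).2) - η * -t =
          2 * (y 0 + t) / (‖y‖ ^ 2 + η) := by
        simp only [invStereo, PiLp.smul_apply, smul_eq_mul]
        field_simp
        linear_combination (2 * y 0 + 2 * t) * hη2
      have : 0 < 2 * (y 0 + t) / (‖y‖ ^ 2 + η) :=
        div_pos (by linarith [show -t < y 0 from hy]) hD
      linarith
  · obtain ⟨hq, hs, hb⟩ := hw
    rw [quadric] at hq
    have hX0 : w.1 = 0 → w.1 0 = 0 := fun h => by rw [h]; rfl
    have hs1 : 0 < η * (1 - w.2) := by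
      rcases hη with rfl | rfl
      · have h1 : w.2 ≤ 1 := by nlinarith [sq_nonneg ‖w.1‖]
        rcases h1.eq_or_lt with h | h
        · have : ‖w.1‖ = 0 := by rw [h] at hq; nlinarith [sq_nonneg ‖w.1‖]
          rw [h, hX0 (norm_eq_zero.1 this)] at hb
          linarith
        · linarith
      · have h0 := hs rfl
        have h1 : 1 ≤ w.2 := by nlinarith [sq_nonneg ‖w.1‖]
        rcases h1.eq_or_lt with h | h
        · have : ‖w.1‖ = 0 := by rw [← h] at hq; nlinarith [sq_nonneg ‖w.1‖]
          rw [← h, hX0 (norm_eq_zero.1 this)] at hb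
          linarith
        · linarith
    have hne : 1 - w.2 ≠ 0 := fun h => by rw [h, mul_zero] at hs1; exact lt_irrefl _ hs1
    have hn : ‖(η / (1 - w.2)) • w.1‖ ^ 2 + η = 2 / (η * (1 - w.2)) := by
      rw [norm_smul, mul_pow, Real.norm_eq_abs, sq_abs, eq_div_iff hs1.ne']
      field_simp
      linear_combination (η ^ 2 * hq) + (1 - w.2 ^ 2 + (1 - w.2) ^ 2) * hη2
    refine ⟨(η / (1 - w.2)) • w.1, ?_, ?_⟩
    · simp only [mem_ofPred_eq, PiLp.smul_apply, smul_eq_mul]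
      have e : η * (η * w.1 0 - t * w.2) - η * -t =
          (η / (1 - w.2) * w.1 0 + t) * (η * (1 - w.2)) := by
        field_simp
        ring
      have h1 : 0 < (η / (1 - w.2) * w.1 0 + t) * (η * (1 - w.2)) := by linarith
      have h2 := pos_of_mul_pos_left h1 hs1.le
      linarith
    · rw [invStereo, hn]
      ext1
      · simp only [smul_smul]
        rw [show 2 / (2 / (η * (1 - w.2))) * (η / (1 - w.2)) = η * η by field_simp, hη2, one_smul]
      · simp only
        rw [show ‖(η / (1 - w.2)) • w.1‖ ^ 2 - η = 2 / (η * (1 - w.2)) - 2 * η by linarith]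
        have hη0 : η ≠ 0 := fun h => by rw [h, zero_mul] at hs1; exact lt_irrefl _ hs1
        field_simp
        linear_combination (w.2 - 1) * hη2

end

/-! ### Orthogonal and Lorentz transformations moving the image of the half-space to a cap -/

section
variable {m : ℕ} {κ R η t k b : ℝ}

/-- The reflection of the quadric which exchanges `((e₁, -t) / k)` with the pole. -/
def capReflection (m : ℕ) (η t k : ℝ) : (EuclideanSpace ℝ (Fin (m + 1)) × ℝ) →ₗ[ℝ]
    (EuclideanSpace ℝ (Fin (m + 1)) × ℝ) where
  toFun w := (w.1 + ((t * w.1 0 + w.2) / k - w.1 0) • EuclideanSpace.single 0 1,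
    (η * w.1 0 - t * w.2) / k)
  map_add' v w := by
    ext1
    · simp only [Prod.fst_add, Prod.snd_add, PiLp.add_apply]
      module
    · simp only [Prod.fst_add, Prod.snd_add, PiLp.add_apply]
      ring
  map_smul' a w := by
    ext1
    · simp only [Prod.smul_fst, Prod.smul_snd, PiLp.smul_apply, smul_eq_mul, RingHom.id_apply]
      module
    · simp only [Prod.smul_fst, Prod.smul_snd, PiLp.smul_apply, smul_eq_mul, RingHom.id_apply]
      ring

theorem capReflection_fst_zero (w : EuclideanSpace ℝ (Fin (m + 1)) × ℝ) :
    (capReflection m η t k w).1 0 = (t * w.1 0 + w.2) / k := by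
  simp [capReflection]

theorem capReflection_snd (w : EuclideanSpace ℝ (Fin (m + 1)) × ℝ) :
    (capReflection m η t k w).2 = (η * w.1 0 - t * w.2) / k := rfl

theorem quadric_capReflection (hk0 : k ≠ 0) (hk : k ^ 2 = t ^ 2 + η)
    (w : EuclideanSpace ℝ (Fin (m + 1)) × ℝ) :
    quadric η (capReflection m η t k w) = quadric η w := by
  have h : ‖(capReflection m η t k w).1‖ ^ 2 =
      ‖w.1‖ ^ 2 - w.1 0 ^ 2 + ((t * w.1 0 + w.2) / k) ^ 2 := by
    simp only [capReflection, LinearMap.coe_mk, AddHom.coe_mk]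
    rw [norm_add_sq_real, norm_smul, real_inner_smul_right, EuclideanSpace.inner_single_right]
    simp only [PiLp.norm_single, norm_one, mul_one, Real.norm_eq_abs, sq_abs,
      conj_trivial, one_mul]
    ring
  rw [quadric, h, capReflection_snd, quadric]
  field_simp
  linear_combination (-(w.2 ^ 2) - η * w.1 0 ^ 2) * hk

theorem capReflection_capReflection (hk0 : k ≠ 0) (hk : k ^ 2 = t ^ 2 + η)
    (w : EuclideanSpace ℝ (Fin (m + 1)) × ℝ) :
    capReflection m η t k (capReflection m η t k w) = w := by
  ext1
  · change (capReflection m η t k w).1 + ((t * (capReflection m η t k w).1 0 +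
      (capReflection m η t k w).2) / k - (capReflection m η t k w).1 0) •
        EuclideanSpace.single 0 1 = w.1
    have e : (t * (capReflection m η t k w).1 0 + (capReflection m η t k w).2) / k = w.1 0 := by
      rw [capReflection_fst_zero, capReflection_snd]
      field_simp
      linear_combination (-w.1 0) * hk
    rw [e, capReflection_fst_zero]
    simp only [capReflection, LinearMap.coe_mk, AddHom.coe_mk]
    module
  · rw [capReflection_snd, capReflection_fst_zero, capReflection_snd]
    field_simp
    linear_combination (-w.2) * hk

/-- The last component of the reflected point is the functional defining the source cap divided by
k, so one cap goes to the other. In the Lorentz case the sheet is preserved because |X₁| < s there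
and t < -1. -/
theorem bijOn_capReflection (hη : η = 1 ∨ η = -1) (hk0 : 0 < k) (hk : k ^ 2 = t ^ 2 + η)
    (ht : η = -1 → t < -1) :
    BijOn (capReflection m η t k) (stereoCap m η t) (modelCap (m + 1) η (-t / k)) := by
  have hη2 : η * η = 1 := by rcases hη with rfl | rfl <;> norm_num
  have hinv := capReflection_capReflection (m := m) hk0.ne' hk
  have hX : ∀ w : EuclideanSpace ℝ (Fin (m + 1)) × ℝ, η = -1 → quadric η w = 1 →
      |w.1 0| < |w.2| := by
    intro w h hq
    rw [quadric, h] at hq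
    have h1 : |w.1 0| ≤ ‖w.1‖ := PiLp.norm_apply_le w.1 0
    refine sq_lt_sq.1 ?_
    have := pow_le_pow_left₀ (abs_nonneg _) h1 2
    rw [sq_abs] at this
    linarith
  refine ⟨fun w hw => ?_, (Function.LeftInverse.injective hinv).injOn, fun w hw => ?_⟩
  · obtain ⟨hq, hs, hb⟩ := hw
    refine ⟨(quadric_capReflection hk0.ne' hk w).trans hq, fun h => ?_, ?_⟩
    · have h1 := hX w h hq
      have h2 := ht h
      have h3 := hs h
      rw [abs_of_pos h3] at h1
      rw [capReflection_snd, h]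
      refine div_pos ?_ hk0
      nlinarith [(abs_lt.1 h1).2]
    · rw [capReflection_snd, mul_div_assoc', mul_div_assoc']
      exact div_lt_div_of_pos_right hb hk0
  · obtain ⟨hq, hs, hb⟩ := hw
    have hq' := (quadric_capReflection (m := m) hk0.ne' hk w).trans hq
    refine ⟨capReflection m η t k w, ⟨hq', fun h => ?_, ?_⟩, hinv w⟩
    · have h1 := hX w h hq
      have h2 := ht h
      have h3 := hs h
      rw [abs_of_pos h3] at h1
      rw [capReflection_snd, h]
      refine div_pos ?_ hk0
      nlinarith [(abs_lt.1 h1).2]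
    · have h1 := congrArg Prod.snd (hinv w)
      rw [capReflection_snd, div_eq_iff hk0.ne'] at h1
      rw [h1]
      rw [mul_div_assoc', div_lt_iff₀ hk0] at hb
      linarith

/-- For κ > 0, |t| < k allows an arccosine. For κ < 0, -t/k = √(1 + 1/k²) is cosh(arsinh(1/k)). -/
theorem exists_cs_eq (hκ0 : κ ≠ 0) (hη : η = 1 ∨ η = -1) (hηκ : η * |κ| = κ) (hk0 : 0 < k)
    (hk : k ^ 2 = t ^ 2 + η) (ht : η = -1 → t < -1) :
    ∃ R, 0 < R ∧ (0 < κ → √κ * R < Real.pi) ∧ cs κ R = -t / k := by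
  have habs : 0 < |κ| := abs_pos.2 hκ0
  rcases hη with rfl | rfl
  · have hκ : 0 < κ := by linarith
    have hs := Real.sqrt_pos.2 hκ
    have h1 : |-t / k| < 1 := by
      rw [abs_div, abs_of_pos hk0, div_lt_one hk0, abs_neg]
      exact abs_lt_of_sq_lt_sq (by linarith) hk0.le
    obtain ⟨h2, h3⟩ := abs_lt.1 h1
    refine ⟨Real.arccos (-t / k) / √κ, div_pos (Real.arccos_pos.2 h3) hs, fun _ => ?_, ?_⟩
    · rw [mul_div_cancel₀ _ hs.ne']
      exact Real.arccos_lt_pi.2 h2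
    · rw [cs_of_pos hκ, mul_div_cancel₀ _ hs.ne', Real.cos_arccos h2.le h3.le]
  · have hκ : κ < 0 := by linarith
    have hs : 0 < √(-κ) := Real.sqrt_pos.2 (by linarith)
    have h1 : 0 < -t / k := div_pos (by linarith [ht rfl]) hk0
    refine ⟨Real.arsinh (1 / k) / √(-κ), div_pos (Real.arsinh_pos_iff.2 (by positivity)) hs,
      fun h => absurd h hκ.not_gt, ?_⟩
    rw [cs_of_neg hκ, mul_div_cancel₀ _ hs.ne', Real.cosh_arsinh, ← Real.sqrt_sq h1.le]
    congr 1
    field_simp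
    linarith

/-- A reduction to the model ball exists. -/
theorem exists_reduction (hκ0 : κ ≠ 0) (hη : η = 1 ∨ η = -1) (hηκ : η * |κ| = κ) (hk0 : 0 < k)
    (hk : k ^ 2 = t ^ 2 + η) (ht : η = -1 → t < -1) (hreg : StereoRegular m η t) :
    ∃ (R : ℝ) (G : EuclideanSpace ℝ (Fin (m + 1)) → EuclideanSpace ℝ (Fin (m + 1))), 0 < R ∧
      (0 < κ → √κ * R < Real.pi) ∧ BijOn G {y | -t < y 0} (ball 0 R) ∧
      ∀ y : EuclideanSpace ℝ (Fin (m + 1)), -t < y 0 →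
        modelPoint κ (G y) = capReflection m η t k (invStereo η y) := by
  obtain ⟨R, hR, hκ, hcs⟩ := exists_cs_eq hκ0 hη hηκ hk0 hk ht
  have h1 := (bijOn_capReflection (m := m) hη hk0 hk ht).comp (bijOn_invStereo hη hreg)
  have h2 := bijOn_modelPoint (n := m + 1) hκ0 hη hηκ hκ hR
  rw [hcs] at h2
  refine ⟨R, fun y => Function.invFunOn (modelPoint κ) (ball 0 R)
    (capReflection m η t k (invStereo η y)), hR, hκ, ?_, fun y hy => ?_⟩
  · exact BijOn.comp (h2.symm h2.invOn_invFunOn.symm) h1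
  · exact Function.invFunOn_eq (h2.surjOn (h1.mapsTo hy))

/-- Polarization of the quadratic form. -/
theorem quadric_add {n : ℕ} (v w : EuclideanSpace ℝ (Fin n) × ℝ) :
    quadric η (v + w) = quadric η v + quadric η w + 2 * (v.2 * w.2 + η * inner ℝ v.1 w.1) := by
  simp only [quadric, Prod.fst_add, Prod.snd_add, norm_add_sq_real]
  ring

/-- Every orthogonal or Lorentz transformation that maps the image of the half-space onto a
geodesic ball about the pole has the same last component, and the radius of the ball is fixed. -/
theorem snd_eq_of_image_eq_cap (hm : 0 < m) (hη : η = 1 ∨ η = -1) (hk0 : 0 < k)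
    (hk : k ^ 2 = t ^ 2 + η) (hreg : StereoRegular m η t)
    {O : (EuclideanSpace ℝ (Fin (m + 1)) × ℝ) →ₗ[ℝ] (EuclideanSpace ℝ (Fin (m + 1)) × ℝ)}
    (hO : ∀ w, quadric η (O w) = quadric η w)
    (h1 : ∀ y : EuclideanSpace ℝ (Fin (m + 1)), -t < y 0 →
      O (invStereo η y) ∈ modelCap (m + 1) η b)
    (h2 : ∀ w ∈ modelCap (m + 1) η b, ∃ y : EuclideanSpace ℝ (Fin (m + 1)), -t < y 0 ∧
      O (invStereo η y) = w) :
    Function.Bijective O ∧ (∀ w, (O w).2 = (η * w.1 0 - t * w.2) / k) ∧ b = -t / k := by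
  have hη2 : η * η = 1 := by rcases hη with rfl | rfl <;> norm_num
  have hpol : ∀ v w, (O v).2 * (O w).2 + η * inner ℝ (O v).1 (O w).1 =
      v.2 * w.2 + η * inner ℝ v.1 w.1 := by
    intro v w
    have e1 := hO (v + w)
    rw [map_add, quadric_add, quadric_add, hO, hO] at e1
    linarith
  have hinj : Function.Injective O := by
    refine (injective_iff_map_eq_zero O).2 fun w hw => ?_
    have e := hpol w (η • w.1, w.2)
    rw [hw] at e
    simp only [Prod.snd_zero, Prod.fst_zero, zero_mul, inner_zero_left, mul_zero, add_zero,
      real_inner_smul_right, real_inner_self_eq_norm_sq, ← mul_assoc, hη2, one_mul] at e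
    have h3 : ‖w.1‖ = 0 := by nlinarith [sq_nonneg ‖w.1‖, mul_self_nonneg w.2]
    have h4 : w.2 = 0 := by nlinarith [sq_nonneg ‖w.1‖, mul_self_nonneg w.2]
    exact Prod.ext (norm_eq_zero.1 h3) h4
  have hbij : Function.Bijective O := ⟨hinj, LinearMap.injective_iff_surjective.1 hinj⟩
  refine ⟨hbij, ?_⟩
  -- O preserves the polar form, so its last component is the pairing with w₁, the preimage of the
  -- pole. The rest of the proof determines w₁.
  obtain ⟨w₁, hw₁⟩ := hbij.2 (0, 1)
  have hl : ∀ w, (O w).2 = w.2 * w₁.2 + η * inner ℝ w.1 w₁.1 := by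
    intro w
    rw [← hpol, hw₁]
    simp
  have hq₁ : w₁.2 ^ 2 + η * ‖w₁.1‖ ^ 2 = 1 := by
    have := hO w₁
    rw [hw₁] at this
    simpa [quadric] using this.symm
  -- Boundary goes to boundary. Approach from inside gives the weak cap inequality; were it strict,
  -- the image would also come from an interior point, against injectivity.
  have hbd : ∀ y : EuclideanSpace ℝ (Fin (m + 1)), y 0 = -t → (O (invStereo η y)).2 = b := by
    intro y hy
    have hD := hreg y hy.ge
    set z : ℝ → EuclideanSpace ℝ (Fin (m + 1)) := fun ε => y + ε • EuclideanSpace.single 0 1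
      with hz
    have hz0 : ∀ ε, 0 < ε → -t < z ε 0 := fun ε hε => by simp [hz, hy, hε]
    have hcont : ContinuousAt (fun ε => (O (invStereo η (z ε))).2) 0 := by
      have hzc : ContinuousAt z 0 := by fun_prop
      have hz00 : z 0 = y := by simp [hz]
      have hne : ‖z 0‖ ^ 2 + η ≠ 0 := by rw [hz00]; exact hD.ne'
      have hinvc : ContinuousAt (fun ε => invStereo η (z ε)) 0 := by
        unfold invStereo
        exact (((continuousAt_const).div ((hzc.norm.pow 2).add continuousAt_const) hne).smul
          hzc).prodMk ((((hzc.norm.pow 2).sub continuousAt_const)).div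
            ((hzc.norm.pow 2).add continuousAt_const) hne)
      exact (continuous_snd.comp O.continuous_of_finiteDimensional).continuousAt.comp hinvc
    have hlim : Filter.Tendsto (fun ε => (O (invStereo η (z ε))).2) (nhdsWithin 0 (Ioi 0))
        (nhds (O (invStereo η y)).2) := by
      have := hcont.tendsto.mono_left (nhdsWithin_le_nhds (s := Ioi 0))
      simpa [hz] using this
    have hmem : ∀ᶠ ε in nhdsWithin (0 : ℝ) (Ioi 0), O (invStereo η (z ε)) ∈
        modelCap (m + 1) η b := by
      filter_upwards [self_mem_nhdsWithin] with ε hε using h1 _ (hz0 ε hε)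
    have hq : quadric η (O (invStereo η y)) = 1 := by rw [hO, quadric_invStereo hD.ne']
    have hge : η * b ≤ η * (O (invStereo η y)).2 :=
      ge_of_tendsto (hlim.const_mul η) (hmem.mono fun ε h => h.2.2.le)
    have hsheet : η = -1 → 0 < (O (invStereo η y)).2 := by
      intro h
      have h3 : 0 ≤ (O (invStereo η y)).2 := ge_of_tendsto hlim (hmem.mono fun ε h' => (h'.2.1 h).le)
      refine lt_of_le_of_ne h3 fun h0 => ?_
      rw [quadric, ← h0, h] at hq
      nlinarith [sq_nonneg ‖(O (invStereo η y)).1‖]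
    by_contra hne
    have hη0 : η ≠ 0 := by rintro rfl; norm_num at hη2
    have hgt : η * b < η * (O (invStereo η y)).2 :=
      lt_of_le_of_ne hge fun h => hne (mul_left_cancel₀ hη0 h).symm
    obtain ⟨y', hy', he⟩ := h2 _ ⟨hq, hsheet, hgt⟩
    have := invStereo_injOn hη (hreg y' hy'.le).ne' hD.ne' (hinj he)
    rw [this, hy] at hy'
    exact lt_irrefl _ hy'
  have hform : ∀ y : EuclideanSpace ℝ (Fin (m + 1)), ‖y‖ ^ 2 + η ≠ 0 →
      (O (invStereo η y)).2 * (‖y‖ ^ 2 + η) =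
        (‖y‖ ^ 2 - η) * w₁.2 + 2 * η * inner ℝ y w₁.1 := by
    intro y hy
    rw [hl, invStereo, real_inner_smul_left]
    field_simp
  have hin : ∀ (α r : ℝ) (i : Fin (m + 1)), inner ℝ (α • EuclideanSpace.single 0 (1 : ℝ) +
      r • EuclideanSpace.single i (1 : ℝ) : EuclideanSpace ℝ (Fin (m + 1))) w₁.1 =
        α * w₁.1 0 + r * w₁.1 i := by
    intro α r i
    rw [inner_add_left, real_inner_smul_left, real_inner_smul_left,
      EuclideanSpace.inner_single_left, EuclideanSpace.inner_single_left]
    simp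
  have hnorm : ∀ (α r : ℝ) (i : Fin (m + 1)), i ≠ 0 → ‖(α • EuclideanSpace.single 0 (1 : ℝ) +
      r • EuclideanSpace.single i (1 : ℝ) : EuclideanSpace ℝ (Fin (m + 1)))‖ ^ 2 =
        α ^ 2 + r ^ 2 := by
    intro α r i hi
    rw [norm_add_sq_real, real_inner_smul_left, real_inner_smul_right,
      EuclideanSpace.inner_single_left, norm_smul, norm_smul]
    simp [hi.symm]
  have hval : ∀ (α r : ℝ) (i : Fin (m + 1)), i ≠ 0 → (α • EuclideanSpace.single 0 (1 : ℝ) +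
      r • EuclideanSpace.single i (1 : ℝ) : EuclideanSpace ℝ (Fin (m + 1))) 0 = α := by
    intro α r i hi
    simp [hi.symm]
  have hpoly : ∀ (r : ℝ) (i : Fin (m + 1)), i ≠ 0 → b * (t ^ 2 + r ^ 2 + η) =
      (t ^ 2 + r ^ 2 - η) * w₁.2 + 2 * η * (-t * w₁.1 0 + r * w₁.1 i) := by
    intro r i hi
    have h3 := hbd _ (hval (-t) r i hi)
    have h4 := hreg _ (hval (-t) r i hi).ge
    have h5 := hform _ h4.ne'
    rw [h3, hnorm _ _ _ hi, hin, neg_sq] at h5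
    exact h5
  have ha : ∀ i : Fin (m + 1), i ≠ 0 → w₁.1 i = 0 := by
    intro i hi
    have e1 := hpoly 1 i hi
    have e2 := hpoly (-1) i hi
    have e3 : η * (η * w₁.1 i) = 0 := by
      have : η * w₁.1 i = 0 := by linarith
      rw [this, mul_zero]
    rwa [← mul_assoc, hη2, one_mul] at e3
  have hi : Fin.succ (⟨0, hm⟩ : Fin m) ≠ 0 := Fin.succ_ne_zero _
  have e0 := hpoly 0 _ hi
  have e1 := hpoly 1 _ hi
  rw [ha _ hi] at e0 e1
  have hσ : w₁.2 = b := by linarith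
  have hσ2 : b = -t * w₁.1 0 := by
    rw [hσ] at e0
    have : η * (η * b) = η * (η * (-t * w₁.1 0)) := by
      congr 1
      linarith
    rwa [← mul_assoc, ← mul_assoc, hη2, one_mul, one_mul] at this
  have hw₁' : w₁.1 = w₁.1 0 • EuclideanSpace.single 0 (1 : ℝ) := by
    ext i
    by_cases h : i = 0
    · simp [h]
    · simp [ha i h, h]
  have hnw : ‖w₁.1‖ ^ 2 = w₁.1 0 ^ 2 := by
    rw [hw₁', norm_smul]
    simp
  have hsq : (w₁.1 0 * k) ^ 2 = 1 := by
    rw [hσ, hσ2, hnw] at hq₁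
    rw [mul_pow, hk]
    linarith
  -- The quadric fixes w₁ only up to sign; the interior point (1 - t)e₁ decides it.
  have hpos : 0 < w₁.1 0 := by
    have h3 := h1 _ (show -t < ((1 - t) • EuclideanSpace.single 0 (1 : ℝ) + (0 : ℝ) •
      EuclideanSpace.single (Fin.succ (⟨0, hm⟩ : Fin m)) (1 : ℝ) :
        EuclideanSpace ℝ (Fin (m + 1))) 0 by rw [hval _ _ _ hi]; linarith)
    have h4 := hreg ((1 - t) • EuclideanSpace.single 0 (1 : ℝ) + (0 : ℝ) •
      EuclideanSpace.single (Fin.succ (⟨0, hm⟩ : Fin m)) (1 : ℝ)) (by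
        rw [hval _ _ _ hi]; linarith)
    have h5 := hform _ h4.ne'
    have h6 := mul_lt_mul_of_pos_right h3.2.2 h4
    rw [mul_assoc η (Prod.snd _), h5, hnorm _ _ _ hi, hin, hσ] at h6
    rw [hσ2] at h6
    rcases hη with rfl | rfl <;> nlinarith
  have hone : w₁.1 0 * k = 1 := by
    have : 0 < w₁.1 0 * k := mul_pos hpos hk0
    nlinarith
  have hw0 : w₁.1 0 = 1 / k := by rw [eq_div_iff hk0.ne', hone]
  refine ⟨fun w => ?_, ?_⟩
  · rw [hl, hw₁', real_inner_smul_right, EuclideanSpace.inner_single_right, hσ, hσ2, hw0]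
    simp
    ring
  · rw [hσ2, hw0]
    ring

end

/-! ### The profile and its Jacobi fields -/

section
variable {m : ℕ} {C c : ℝ} {p : EuclideanSpace ℝ (Fin (m + 1))}

theorem fderiv_profile {n : ℕ} {C c : ℝ} {p x : EuclideanSpace ℝ (Fin n)}
    (hx : 0 < ‖x - p‖ ^ 2 + c) (v : EuclideanSpace ℝ (Fin n)) :
    fderiv ℝ (profile C c p) x v =
      -((n : ℝ) - 2) * inner ℝ (x - p) v / (‖x - p‖ ^ 2 + c) * profile C c p x := by
  have h1 : HasFDerivAt (fun x => ‖x - p‖ ^ 2 + c) _ x :=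
    (((hasFDerivAt_id x).sub_const p).norm_sq).add_const c
  have h2 := ((h1.rpow_const (p := -((n : ℝ) - 2) / 2) (Or.inl hx.ne')).const_mul C).fderiv
  rw [show profile C c p = fun x => C * (‖x - p‖ ^ 2 + c) ^ (-((n : ℝ) - 2) / 2) from rfl, h2]
  rw [Real.rpow_sub_one hx.ne']
  simp [inner_sub_left]
  ring

theorem profile_pos {n : ℕ} {C c : ℝ} {p x : EuclideanSpace ℝ (Fin n)} (hC : 0 < C)
    (hx : 0 < ‖x - p‖ ^ 2 + c) : 0 < profile C c p x := by
  unfold profile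
  positivity

theorem profile_rpow {n : ℕ} (hn : 2 < n) {C c : ℝ} {p x : EuclideanSpace ℝ (Fin n)} (hC : 0 < C)
    (hx : 0 < ‖x - p‖ ^ 2 + c) : profile C c p x ^ (twoSharp n - 1) =
      C ^ (2 / ((n : ℝ) - 2)) / (‖x - p‖ ^ 2 + c) * profile C c p x := by
  have hn' : (0 : ℝ) < n - 2 := by rw [sub_pos]; exact_mod_cast hn
  have h1 : twoSharp n - 1 = 1 + 2 / ((n : ℝ) - 2) := by
    rw [twoSharp]; field_simp; ring
  rw [h1, Real.rpow_add (profile_pos hC hx), Real.rpow_one, mul_comm]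
  congr 1
  rw [profile, Real.mul_rpow hC.le (by positivity), ← Real.rpow_mul hx.le,
    show -((n : ℝ) - 2) / 2 * (2 / (n - 2)) = -1 by field_simp, Real.rpow_neg_one]
  rfl

/-- The boundary constant of the profile. -/
theorem boundaryEquation_iff (hm : 2 ≤ m) (hC : 0 < C)
    (hreg : ∀ x : EuclideanSpace ℝ (Fin (m + 1)), 0 ≤ x 0 → 0 < ‖x - p‖ ^ 2 + c) (σ : ℝ) :
    BoundaryEquation (profile C c p) σ ↔
      σ * C ^ (2 / (((m + 1 : ℕ) : ℝ) - 2)) = (((m + 1 : ℕ) : ℝ) - 2) * p 0 := by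
  have key : ∀ x : EuclideanSpace ℝ (Fin (m + 1)), x 0 = 0 →
      (fderiv ℝ (profile C c p) x (-EuclideanSpace.single 0 1) =
        -σ * profile C c p x ^ (twoSharp (m + 1) - 1) ↔
      σ * C ^ (2 / (((m + 1 : ℕ) : ℝ) - 2)) = (((m + 1 : ℕ) : ℝ) - 2) * p 0) := by
    intro x hx
    have hD := hreg x hx.ge
    have hU := profile_pos (p := p) hC hD
    rw [fderiv_profile hD, profile_rpow (by omega) hC hD, inner_neg_right,
      EuclideanSpace.inner_single_right, ← mul_assoc, mul_left_inj' hU.ne', mul_div_assoc',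
      div_left_inj' hD.ne', PiLp.sub_apply, hx]
    simp only [one_mul, conj_trivial, zero_sub, neg_neg]
    constructor <;> intro h <;> linarith
  constructor
  · intro h
    exact (key 0 rfl).1 (h 0 rfl)
  · exact fun h x hx => (key x hx).2 h

/-- The linear form on the model quadric that corresponds to a Jacobi field. -/
def jacobiForm (c : ℝ) (p : EuclideanSpace ℝ (Fin (m + 1))) (j : Fin (m + 1)) :
    (EuclideanSpace ℝ (Fin (m + 1)) × ℝ) →ₗ[ℝ] ℝ :=
  if j = 0 then (-(((m + 1 : ℕ) : ℝ) - 2) / 2) • (LinearMap.snd ℝ _ _ +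
      (√|c|)⁻¹ • (innerSL ℝ p).toLinearMap ∘ₗ LinearMap.fst ℝ _ _)
  else (-(((m + 1 : ℕ) : ℝ) - 2) / (2 * √|c|)) •
    (innerSL ℝ (EuclideanSpace.single j (1 : ℝ))).toLinearMap ∘ₗ LinearMap.fst ℝ _ _

theorem jacobiForm_zero (w : EuclideanSpace ℝ (Fin (m + 1)) × ℝ) :
    jacobiForm c p 0 w = -(((m + 1 : ℕ) : ℝ) - 2) / 2 * (w.2 + (√|c|)⁻¹ * inner ℝ p w.1) := by
  simp [jacobiForm]
  ring

theorem jacobiForm_of_ne {j : Fin (m + 1)} (hj : j ≠ 0)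
    (w : EuclideanSpace ℝ (Fin (m + 1)) × ℝ) :
    jacobiForm c p j w = -(((m + 1 : ℕ) : ℝ) - 2) / (2 * √|c|) * w.1 j := by
  simp [jacobiForm, hj, EuclideanSpace.inner_single_left]

theorem sign_mul_abs_self (c : ℝ) : Real.sign c * |c| = c := by
  rcases lt_trichotomy c 0 with h | rfl | h
  · rw [Real.sign_of_neg h, abs_of_neg h]; ring
  · simp
  · rw [Real.sign_of_pos h, abs_of_pos h]; ring

theorem norm_smul_sub_sq (hc : c ≠ 0) (x : EuclideanSpace ℝ (Fin (m + 1))) :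
    ‖x - p‖ ^ 2 + c = |c| * (‖(√|c|)⁻¹ • (x - p)‖ ^ 2 + Real.sign c) := by
  have h : 0 < |c| := abs_pos.2 hc
  rw [norm_smul, mul_pow, norm_inv, inv_pow, Real.norm_of_nonneg (Real.sqrt_nonneg _),
    Real.sq_sqrt h.le, mul_add, ← mul_assoc, mul_inv_cancel₀ h.ne', one_mul, mul_comm |c|,
    sign_mul_abs_self]

/-- The logarithmic derivative of U is rational with denominator |x - p|² + c, the denominator of
the stereographic projection. For the dilation field one also uses ⟨x - p, x⟩ = ⟨p, x - p⟩ + |x -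
p|². -/
theorem jacobiField_div_profile (hC : 0 < C) (hc : c ≠ 0)
    {x : EuclideanSpace ℝ (Fin (m + 1))} (hx : 0 < ‖x - p‖ ^ 2 + c) (j : Fin (m + 1)) :
    jacobiField (profile C c p) j x / profile C c p x =
      jacobiForm c p j (invStereo (Real.sign c) ((√|c|)⁻¹ • (x - p))) := by
  have hU := profile_pos (p := p) hC hx
  have habs : 0 < |c| := abs_pos.2 hc
  have hs : 0 < √|c| := Real.sqrt_pos.2 habs
  have hss : √|c| ^ 2 = |c| := Real.sq_sqrt habs.le
  have hD := norm_smul_sub_sq (p := p) hc x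
  have hD0 : ‖(√|c|)⁻¹ • (x - p)‖ ^ 2 + Real.sign c ≠ 0 := by
    intro h
    rw [h, mul_zero] at hD
    exact hx.ne' hD
  rw [div_eq_iff hU.ne', jacobiField]
  split_ifs with h
  · subst h
    rw [jacobiForm_zero, fderiv_profile hx]
    have e : inner ℝ (x - p) x = inner ℝ p (x - p) + ‖x - p‖ ^ 2 := by
      rw [← real_inner_self_eq_norm_sq, ← inner_add_left, add_sub_cancel, real_inner_comm]
    have e2 : ‖x - p‖ ^ 2 = |c| * ‖(√|c|)⁻¹ • (x - p)‖ ^ 2 := by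
      rw [norm_smul, mul_pow, norm_inv, inv_pow, Real.norm_of_nonneg hs.le, hss, ← mul_assoc,
        mul_inv_cancel₀ habs.ne', one_mul]
    rw [hD, e, e2, invStereo]
    simp only [real_inner_smul_right]
    generalize √|c| = s at *
    generalize ‖s⁻¹ • (x - p)‖ ^ 2 = N at *
    rw [← hss]
    field_simp
    ring
  · rw [jacobiForm_of_ne h, fderiv_profile hx, EuclideanSpace.inner_single_right, hD, invStereo]
    simp only [PiLp.smul_apply, smul_eq_mul, one_mul, conj_trivial]
    generalize √|c| = s at *
    generalize ‖s⁻¹ • (x - p)‖ ^ 2 = N at *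
    rw [← hss]
    field_simp

theorem sign_eq_one_or (hc : c ≠ 0) : Real.sign c = 1 ∨ Real.sign c = -1 :=
  (Real.sign_apply_eq_of_ne_zero c hc).symm

theorem stereoRegular_of_regular (hc : c ≠ 0)
    (hreg : ∀ x : EuclideanSpace ℝ (Fin (m + 1)), 0 ≤ x 0 → 0 < ‖x - p‖ ^ 2 + c) :
    StereoRegular m (Real.sign c) (p 0 / √|c|) := by
  intro y hy
  have habs : 0 < |c| := abs_pos.2 hc
  have hs : 0 < √|c| := Real.sqrt_pos.2 habs
  have h := hreg (√|c| • y + p) (by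
    rw [← neg_div, div_le_iff₀ hs] at hy
    simp only [PiLp.add_apply, PiLp.smul_apply, smul_eq_mul]
    linarith)
  rw [norm_smul_sub_sq hc, add_sub_cancel_right, smul_smul, inv_mul_cancel₀ hs.ne', one_smul] at h
  exact pos_of_mul_pos_right h habs.le

/-- Regularity at the boundary point -t e₁ makes the normalizing length k = √(t² + η) positive. -/
theorem StereoRegular.sq_add_pos {η t : ℝ} (h : StereoRegular m η t) : 0 < t ^ 2 + η := by
  have := h (EuclideanSpace.single 0 (-t)) (by simp)
  simpa using this

theorem abs_sign (hc : c ≠ 0) : |Real.sign c| = 1 := by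
  rcases sign_eq_one_or hc with h | h <;> simp [h]

theorem abs_profileCurvature (n : ℕ) (hC : 0 < C) (hc : c ≠ 0) :
    |profileCurvature n C c| = (2 * √|c| / C ^ (2 / ((n : ℝ) - 2))) ^ 2 := by
  have habs : 0 < |c| := abs_pos.2 hc
  have h : C ^ (4 / ((n : ℝ) - 2)) = (C ^ (2 / ((n : ℝ) - 2))) ^ 2 := by
    rw [← Real.rpow_natCast, ← Real.rpow_mul hC.le]
    congr 1
    push_cast
    ring
  have hC2 : 0 < C ^ (2 / ((n : ℝ) - 2)) := by positivity
  rw [profileCurvature, abs_div, abs_sign hc, abs_of_pos (by positivity), h, div_pow, mul_pow,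
    Real.sq_sqrt habs.le]
  field_simp
  norm_num

theorem profileCurvature_ne_zero (n : ℕ) (hC : 0 < C) (hc : c ≠ 0) :
    profileCurvature n C c ≠ 0 := by
  have habs : 0 < |c| := abs_pos.2 hc
  rw [← abs_pos, abs_profileCurvature n hC hc]
  positivity

theorem sign_mul_abs_profileCurvature (n : ℕ) (hC : 0 < C) :
    Real.sign c * |profileCurvature n C c| = profileCurvature n C c := by
  by_cases hc : c = 0
  · simp [hc, profileCurvature]
  have habs : 0 < |c| := abs_pos.2 hc
  rw [profileCurvature, abs_div, abs_sign hc, abs_of_pos (by positivity)]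
  ring

theorem exists_isReductionMap (hC : 0 < C) (hc : c ≠ 0)
    (hreg : ∀ x : EuclideanSpace ℝ (Fin (m + 1)), 0 ≤ x 0 → 0 < ‖x - p‖ ^ 2 + c) :
    ∃ R F, IsReductionMap C c p R F := by
  have hη := sign_eq_one_or hc
  have hs : 0 < √|c| := Real.sqrt_pos.2 (abs_pos.2 hc)
  have hst := stereoRegular_of_regular hc hreg
  have hk := hst.sq_add_pos
  have hk2 : √((p 0 / √|c|) ^ 2 + Real.sign c) ^ 2 = (p 0 / √|c|) ^ 2 + Real.sign c :=
    Real.sq_sqrt hk.le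
  have hk0 : 0 < √((p 0 / √|c|) ^ 2 + Real.sign c) := Real.sqrt_pos.2 hk
  obtain ⟨R, G, hR, hκ, hG, hf⟩ := exists_reduction (m := m)
    (profileCurvature_ne_zero (m + 1) hC hc) hη (sign_mul_abs_profileCurvature (m + 1) hC) hk0 hk2
    (fun h => by rw [h] at hst; exact hst.lt_neg_one) hst
  have hiff : ∀ x : EuclideanSpace ℝ (Fin (m + 1)), x ∈ halfSpace m ↔
      -(p 0 / √|c|) < ((√|c|)⁻¹ • (x - p)) 0 := by
    intro x
    rw [PiLp.smul_apply, PiLp.sub_apply, smul_eq_mul, inv_mul_eq_div, ← neg_div,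
      div_lt_div_iff_of_pos_right hs]
    simp [halfSpace]
  refine ⟨R, fun x => G ((√|c|)⁻¹ • (x - p)), hR, hκ, ?_, _,
    fun X => quadric_capReflection hk0.ne' hk2 X, fun x hx => hf _ ((hiff x).1 hx)⟩
  refine hG.comp ⟨fun x hx => (hiff x).1 hx, fun x _ y _ h => ?_, fun y hy => ?_⟩
  · exact sub_left_injective (smul_right_injective _ (inv_ne_zero hs.ne') h)
  · refine ⟨√|c| • y + p, ?_, ?_⟩
    · rw [hiff, add_sub_cancel_right, smul_smul, inv_mul_cancel₀ hs.ne', one_smul]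
      exact hy
    · simp only [add_sub_cancel_right, smul_smul]
      rw [inv_mul_cancel₀ hs.ne', one_smul]

/-- The freedom in O is a rotation about the pole. What every choice shares is R and the preimage
(e₁, -t)/k of the pole, with t = p₁/√|c|, and this is all that is needed later. -/
theorem IsReductionMap.snd_eq {R : ℝ}
    {F : EuclideanSpace ℝ (Fin (m + 1)) → EuclideanSpace ℝ (Fin (m + 1))} (hm : 0 < m)
    (hC : 0 < C) (hc : c ≠ 0)
    (hreg : ∀ x : EuclideanSpace ℝ (Fin (m + 1)), 0 ≤ x 0 → 0 < ‖x - p‖ ^ 2 + c)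
    (hF : IsReductionMap C c p R F) :
    ∃ (k : ℝ) (O : (EuclideanSpace ℝ (Fin (m + 1)) × ℝ) ≃ₗ[ℝ]
        (EuclideanSpace ℝ (Fin (m + 1)) × ℝ)),
      0 < k ∧ k ^ 2 = (p 0 / √|c|) ^ 2 + Real.sign c ∧
      cs (profileCurvature (m + 1) C c) R = -(p 0 / √|c|) / k ∧
      O (k⁻¹ • EuclideanSpace.single 0 1, -(p 0 / √|c|) / k) = (0, 1) ∧
      ∀ x ∈ halfSpace m, modelPoint (profileCurvature (m + 1) C c) (F x) =
        O (invStereo (Real.sign c) ((√|c|)⁻¹ • (x - p))) := by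
  have hη := sign_eq_one_or hc
  have hs : 0 < √|c| := Real.sqrt_pos.2 (abs_pos.2 hc)
  have hst := stereoRegular_of_regular hc hreg
  have hk := hst.sq_add_pos
  have hk2 : √((p 0 / √|c|) ^ 2 + Real.sign c) ^ 2 = (p 0 / √|c|) ^ 2 + Real.sign c :=
    Real.sq_sqrt hk.le
  have hk0 : 0 < √((p 0 / √|c|) ^ 2 + Real.sign c) := Real.sqrt_pos.2 hk
  set k := √((p 0 / √|c|) ^ 2 + Real.sign c)
  have hM := bijOn_modelPoint (n := m + 1) (profileCurvature_ne_zero (m + 1) hC hc) hη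
    (sign_mul_abs_profileCurvature (m + 1) hC) hF.radius_lt hF.radius_pos
  obtain ⟨O, hO, hform⟩ := hF.formula
  have hiff : ∀ x : EuclideanSpace ℝ (Fin (m + 1)), x ∈ halfSpace m ↔
      -(p 0 / √|c|) < ((√|c|)⁻¹ • (x - p)) 0 := by
    intro x
    rw [PiLp.smul_apply, PiLp.sub_apply, smul_eq_mul, inv_mul_eq_div, ← neg_div,
      div_lt_div_iff_of_pos_right hs]
    simp [halfSpace]
  obtain ⟨hbij, hsnd, hcs⟩ := snd_eq_of_image_eq_cap (b := cs (profileCurvature (m + 1) C c) R)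
    hm hη hk0 hk2 hst hO (fun y hy => by
      have e : (√|c|)⁻¹ • (√|c| • y + p - p) = y := by
        rw [add_sub_cancel_right, smul_smul, inv_mul_cancel₀ hs.ne', one_smul]
      have hx : √|c| • y + p ∈ halfSpace m := by rw [hiff, e]; exact hy
      have h := hform _ hx
      rw [e] at h
      rw [← h]
      exact hM.mapsTo (hF.bij.mapsTo hx)) (fun w hw => by
      obtain ⟨v, hv, rfl⟩ := hM.surjOn hw
      obtain ⟨x, hx, rfl⟩ := hF.bij.surjOn hv
      exact ⟨_, (hiff x).1 hx, (hform x hx).symm⟩)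
  refine ⟨k, LinearEquiv.ofBijective O hbij, hk0, hk2, hcs, ?_, hform⟩
  have hη2 : Real.sign c * Real.sign c = 1 := by rcases hη with h | h <;> rw [h] <;> norm_num
  set P : EuclideanSpace ℝ (Fin (m + 1)) × ℝ :=
    (k⁻¹ • EuclideanSpace.single 0 1, -(p 0 / √|c|) / k) with hP
  -- A point of the quadric with last component 1 has X = 0, so it is the pole.
  have h1 : (O P).2 = 1 := by
    rw [hsnd, hP]
    simp only [PiLp.smul_apply, PiLp.single_apply, smul_eq_mul]
    simp only [if_true]
    generalize p 0 / √|c| = t at hk2 ⊢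
    field_simp
    linear_combination -hk2
  have h2 : quadric (Real.sign c) (O P) = 1 := by
    rw [hO, hP, quadric, norm_smul, norm_inv, Real.norm_of_nonneg hk0.le]
    simp only [PiLp.norm_single, norm_one]
    generalize p 0 / √|c| = t at hk2 ⊢
    field_simp
    linear_combination -hk2
  rw [quadric, h1] at h2
  have h3 : Real.sign c * (Real.sign c * ‖(O P).1‖ ^ 2) = 0 := by
    rw [show Real.sign c * ‖(O P).1‖ ^ 2 = 0 by linarith, mul_zero]
  rw [← mul_assoc, hη2, one_mul] at h3
  exact Prod.ext (norm_eq_zero.1 (pow_eq_zero_iff two_ne_zero |>.1 h3)) h1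

end

/-! ### The reduced Jacobi fields -/

section
variable {m : ℕ} {C c R : ℝ} {p : EuclideanSpace ℝ (Fin (m + 1))}
  {F : EuclideanSpace ℝ (Fin (m + 1)) → EuclideanSpace ℝ (Fin (m + 1))}

theorem sqrt_abs_mul_sn {κ η t k : ℝ} (hη2 : η * η = 1) (hηκ : η * |κ| = κ) (hk0 : 0 < k)
    (hk : k ^ 2 = t ^ 2 + η) (hs : 0 < sn κ R) (hcs : cs κ R = -t / k) :
    √|κ| * sn κ R = 1 / k := by
  have h1 := cs_sq_add κ R
  have h2 : 0 ≤ √|κ| * sn κ R := mul_nonneg (Real.sqrt_nonneg _) hs.le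
  refine (sq_eq_sq₀ h2 (by positivity)).1 ?_
  rw [mul_pow, Real.sq_sqrt (abs_nonneg κ)]
  rw [hcs] at h1
  have h3 : η * |κ| * sn κ R ^ 2 = η / k ^ 2 := by
    rw [hηκ, eq_div_iff (by positivity)]
    field_simp at h1
    linarith
  have h4 : η * (η * |κ| * sn κ R ^ 2) = η * (η / k ^ 2) := by rw [h3]
  rw [← mul_assoc, ← mul_assoc, hη2, one_mul, mul_div_assoc', hη2] at h4
  rw [h4]
  ring

/-- Since 2^# - 2 = 2/(n - 2) and √|κ| = 2√|c| / C^(2/(n-2)), the boundary equation gives β =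
-t√|κ|. With √|κ| s_κ(R) = 1/k the product is -t/k = c_κ(R). -/
theorem IsReductionMap.beta_mul_sn (hm : 2 ≤ m) (hC : 0 < C) (hc : c ≠ 0)
    (hreg : ∀ x : EuclideanSpace ℝ (Fin (m + 1)), 0 ≤ x 0 → 0 < ‖x - p‖ ^ 2 + c)
    (hF : IsReductionMap C c p R F) {σ β : ℝ} (hσ : BoundaryEquation (profile C c p) σ)
    (hβ : β = -(twoSharp (m + 1) - 2) * σ) :
    β * sn (profileCurvature (m + 1) C c) R = cs (profileCurvature (m + 1) C c) R := by
  obtain ⟨k, O, hk0, hk, hcs, -, -⟩ := hF.snd_eq (by omega) hC hc hreg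
  have hη2 : Real.sign c * Real.sign c = 1 := by
    rcases sign_eq_one_or hc with h | h <;> rw [h] <;> norm_num
  have hsn := sqrt_abs_mul_sn hη2 (sign_mul_abs_profileCurvature (m + 1) hC) hk0 hk
    (sn_pos hF.radius_lt hF.radius_pos le_rfl) hcs
  have hs : 0 < √|c| := Real.sqrt_pos.2 (abs_pos.2 hc)
  have hn : (0 : ℝ) < ((m + 1 : ℕ) : ℝ) - 2 := by
    have : (2 : ℝ) ≤ m := by exact_mod_cast hm
    push_cast
    linarith
  have he : 0 < C ^ (2 / (((m + 1 : ℕ) : ℝ) - 2)) := by positivity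
  rw [abs_profileCurvature (m + 1) hC hc, Real.sqrt_sq (by positivity)] at hsn
  have hσ' := (boundaryEquation_iff hm hC hreg σ).1 hσ
  rw [hcs, hβ, twoSharp]
  generalize sn (profileCurvature (m + 1) C c) R = S at *
  generalize C ^ (2 / (((m + 1 : ℕ) : ℝ) - 2)) = e at *
  generalize (((m + 1 : ℕ) : ℝ)) = n at *
  generalize √|c| = s at *
  have h1 : S = e / (2 * s * k) := by
    rw [eq_div_iff (by positivity)]
    field_simp at hsn
    linarith
  rw [h1]
  field_simp
  linear_combination -hσ'

/-- The reduced Jacobi fields are a basis of the functions `s_κ(r) ⟨ω, θ⟩`. -/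
theorem IsReductionMap.exists_reducedField_eq (hm : 2 ≤ m) (hC : 0 < C) (hc : c ≠ 0)
    (hreg : ∀ x : EuclideanSpace ℝ (Fin (m + 1)), 0 ≤ x 0 → 0 < ‖x - p‖ ^ 2 + c)
    (hF : IsReductionMap C c p R F) :
    ∃ a : Fin (m + 1) → EuclideanSpace ℝ (Fin (m + 1)), LinearIndependent ℝ a ∧
      ∀ j, ∀ v ∈ ball (0 : EuclideanSpace ℝ (Fin (m + 1))) R,
        reducedField (profile C c p) F j v = linField (profileCurvature (m + 1) C c) (a j) v := by
  obtain ⟨k, O, hk0, hk, hcs, hpole, hform⟩ := hF.snd_eq (by omega) hC hc hreg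
  set κ := profileCurvature (m + 1) C c
  have hκ0 : 0 < √|κ| :=
    Real.sqrt_pos.2 (abs_pos.2 (profileCurvature_ne_zero (m + 1) hC hc))
  have hs : 0 < √|c| := Real.sqrt_pos.2 (abs_pos.2 hc)
  have hn : ((m + 1 : ℕ) : ℝ) - 2 ≠ 0 := by
    have : (2 : ℝ) ≤ m := by exact_mod_cast hm
    push_cast
    linarith
  have hpole' : O.symm (0, 1) = (k⁻¹ • EuclideanSpace.single 0 1, -(p 0 / √|c|) / k) := by
    rw [← hpole, LinearEquiv.symm_apply_apply]
  -- At (e₁, -t)/k the two terms of the dilation form cancel because t = p₁/√|c|, and the tangential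
  -- coordinates are zero.
  have hzero : ∀ j, jacobiForm c p j (O.symm (0, 1)) = 0 := by
    intro j
    rw [hpole']
    by_cases hj : j = 0
    · subst hj
      rw [jacobiForm_zero]
      simp only [real_inner_smul_right, EuclideanSpace.inner_single_right, conj_trivial, one_mul]
      field_simp
      ring
    · rw [jacobiForm_of_ne hj]
      simp [hj]
  set a : Fin (m + 1) → EuclideanSpace ℝ (Fin (m + 1)) := fun j =>
    (InnerProductSpace.toDual ℝ _).symm (LinearMap.toContinuousLinearMap
      (√|κ| • (jacobiForm c p j ∘ₗ O.symm.toLinearMap ∘ₗ LinearMap.inl ℝ _ _))) with ha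
  have hin : ∀ j X, inner ℝ (a j) X = √|κ| * jacobiForm c p j (O.symm (X, 0)) := by
    intro j X
    simp only [ha]
    rw [InnerProductSpace.toDual_symm_apply]
    rfl
  have hsplit : ∀ j (w : EuclideanSpace ℝ (Fin (m + 1)) × ℝ), jacobiForm c p j (O.symm w) =
      jacobiForm c p j (O.symm (w.1, 0)) := by
    intro j w
    have e : w = (w.1, 0) + w.2 • ((0, 1) : EuclideanSpace ℝ (Fin (m + 1)) × ℝ) := by
      ext1 <;> simp
    conv_lhs => rw [e]
    rw [map_add, map_add, map_smul, map_smul, hzero, smul_zero, add_zero]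
  refine ⟨a, ?_, fun j v hv => ?_⟩
  · rw [Fintype.linearIndependent_iff]
    intro g hg
    -- A relation among the vectors a_j lifts to the Jacobi forms on the whole space, as these
    -- ignore the pole direction. Evaluation at (0, 1) isolates j = 0, then evaluation at (e_i, 0)
    -- isolates i.
    have hsum : ∀ w, ∑ j, g j * jacobiForm c p j w = 0 := by
      intro w
      have h1 : inner ℝ (∑ j, g j • a j) (O w).1 = (0 : ℝ) := by rw [hg, inner_zero_left]
      rw [sum_inner] at h1
      simp only [real_inner_smul_left, hin] at h1
      have h2 : ∀ j, jacobiForm c p j w = jacobiForm c p j (O.symm ((O w).1, 0)) := fun j => by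
        rw [← hsplit, LinearEquiv.symm_apply_apply]
      simp only [h2]
      have h3 : √|κ| * ∑ j, g j * jacobiForm c p j (O.symm ((O w).1, 0)) = 0 := by
        rw [Finset.mul_sum]
        exact (Finset.sum_congr rfl fun j _ => by ring).trans h1
      exact (mul_eq_zero.1 h3).resolve_left hκ0.ne'
    have hg0 : g 0 = 0 := by
      have h1 := hsum (0, 1)
      rw [Finset.sum_eq_single 0 (fun j _ hj => by rw [jacobiForm_of_ne hj]; simp) (by simp),
        jacobiForm_zero] at h1
      refine (mul_eq_zero.1 h1).resolve_right ?_
      simp only [inner_zero_right, mul_zero, add_zero, mul_one]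
      exact div_ne_zero (neg_ne_zero.2 hn) two_ne_zero
    intro i
    by_cases hi : i = 0
    · rw [hi, hg0]
    · have h1 := hsum (EuclideanSpace.single i 1, 0)
      rw [Finset.sum_eq_single i (fun j _ hj => by
        by_cases h0 : j = 0
        · rw [h0, hg0, zero_mul]
        · rw [jacobiForm_of_ne h0]
          simp [hj]) (by simp), jacobiForm_of_ne hi] at h1
      refine (mul_eq_zero.1 h1).resolve_right ?_
      simp only [PiLp.single_apply, if_true, mul_one]
      exact div_ne_zero (neg_ne_zero.2 hn) (by positivity)
  · set x := Function.invFunOn F (halfSpace m) v with hx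
    have hv' : v ∈ F '' halfSpace m := hF.bij.surjOn hv
    have hxm : x ∈ halfSpace m := Function.invFunOn_mem hv'
    have hFx : F x = v := Function.invFunOn_eq hv'
    have h1 := hform x hxm
    rw [hFx] at h1
    rw [reducedField, ← hx, jacobiField_div_profile hC hc (hreg x (le_of_lt hxm)),
      ← LinearEquiv.symm_apply_apply O (invStereo _ _), ← h1, hsplit, modelPoint_eq, linField, hin]
    have e : ((√|κ| * snRatio κ v) • v, (0 : ℝ)) = (√|κ| * snRatio κ v) • (v, (0 : ℝ)) := by
      ext1 <;> simp
    simp only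
    rw [e, map_smul, map_smul, smul_eq_mul]
    ring

end

/-! ### The kernel as a space of square integrable functions -/

section
variable {j : ℕ} {κ R β : ℝ}

/-- The class of `s_κ(r) ⟨ω, θ⟩` in `L²`. -/
def linLp (hκ : 0 < κ → √κ * R < Real.pi) :
    EuclideanSpace ℝ (Fin (j + 2)) →ₗ[ℝ] Lp ℝ 2 (modelVol (j + 2) κ R) where
  toFun ω := (memLp_modelVol_of_continuous hκ (contDiff_linField κ ω).continuous).toLp _
  map_add' ω ω' := by
    rw [← MemLp.toLp_add]
    exact MemLp.toLp_congr _ _ (Filter.Eventually.of_forall fun v => linField_add ω ω' v)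
  map_smul' a ω := by
    rw [RingHom.id_apply, ← MemLp.toLp_const_smul]
    exact MemLp.toLp_congr _ _ (Filter.Eventually.of_forall fun v => linField_smul a ω v)

theorem coeFn_linLp (hκ : 0 < κ → √κ * R < Real.pi) (ω : EuclideanSpace ℝ (Fin (j + 2))) :
    linLp hκ ω =ᵐ[modelVol (j + 2) κ R] linField κ ω :=
  MemLp.coeFn_toLp (memLp_modelVol_of_continuous hκ (contDiff_linField κ ω).continuous)

/-- A continuous function that vanishes almost everywhere vanishes on the open ball; evaluation at a
small positive multiple of ω then forces ω = 0. -/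
theorem linLp_injective (hκ : 0 < κ → √κ * R < Real.pi) (hR : 0 < R) :
    Function.Injective (linLp (j := j) hκ) := by
  refine (injective_iff_map_eq_zero _).2 fun ω hω => ?_
  have h1 : linField κ ω =ᵐ[modelVol (j + 2) κ R] 0 :=
    (coeFn_linLp hκ ω).symm.trans (by rw [hω]; exact Lp.coeFn_zero _ _ _)
  have h2 := (absolutelyContinuous_modelVol (j := j) hκ).ae_eq h1
  have h3 := Measure.eqOn_open_of_ae_eq h2 isOpen_ball (contDiff_linField κ ω).continuous.continuousOn
    continuousOn_const
  by_contra hne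
  have hn : 0 < ‖ω‖ := norm_pos_iff.2 hne
  have hmem : (R / (2 * ‖ω‖)) • ω ∈ ball (0 : EuclideanSpace ℝ (Fin (j + 2))) R := by
    rw [mem_ball_zero_iff, norm_smul, Real.norm_of_nonneg (by positivity)]
    field_simp
    linarith
  have h4 := h3 hmem
  rw [linField, real_inner_smul_right, real_inner_self_eq_norm_sq] at h4
  have h5 := snRatio_pos_of_mem_ball hκ hmem
  have : 0 < snRatio κ ((R / (2 * ‖ω‖)) • ω) * (R / (2 * ‖ω‖) * ‖ω‖ ^ 2) := by positivity
  exact this.ne' h4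

theorem setOf_robinKernel_eq_range (hκ0 : κ ≠ 0) (hκ : 0 < κ → √κ * R < Real.pi) (hR : 0 < R)
    (hβ : β * sn κ R = cs κ R) :
    {u : Lp ℝ 2 (modelVol (j + 2) κ R) | ∃ φ ∈ robinKernel (j + 2) κ R β,
      φ.fn =ᵐ[modelVol (j + 2) κ R] u} = range (linLp (j := j) hκ) := by
  ext u
  constructor
  · rintro ⟨φ, hφ, hu⟩
    obtain ⟨ω, hω⟩ := ModelH1.exists_fn_ae_eq_linField hκ0 hκ hR hβ hφ
    exact ⟨ω, Lp.ext ((coeFn_linLp hκ ω).trans (hω.symm.trans hu))⟩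
  · rintro ⟨ω, rfl⟩
    refine ⟨linH1 hκ hR ω, linH1_mem_robinKernel hκ0 hκ hR hβ ω, ?_⟩
    refine Filter.EventuallyEq.trans (Filter.Eventually.of_forall fun v => ?_) (coeFn_linLp hκ ω).symm
    simp [linH1, smoothH1, testFn]

open MvPolynomial in
theorem inSector_one_of_eq_linField {n : ℕ} {φ : EuclideanSpace ℝ (Fin n) → ℝ}
    (a : EuclideanSpace ℝ (Fin n))
    (h : ∀ v ∈ ball (0 : EuclideanSpace ℝ (Fin n)) R, φ v = linField κ a v) :
    InSector 1 R φ := by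
  refine ⟨sn κ, ∑ i, MvPolynomial.C (a i) * X i, ?_, ?_, fun v hv hv0 => ?_⟩
  · refine IsHomogeneous.sum _ _ _ fun i _ => ?_
    simpa using (isHomogeneous_C (Fin n) (a i)).mul (isHomogeneous_X ℝ i)
  · refine Finset.sum_eq_zero fun i _ => ?_
    have : pderiv i (∑ i, MvPolynomial.C (a i) * X i) = MvPolynomial.C (a i) := by
      rw [map_sum, Finset.sum_eq_single i]
      · simp
      · intro k _ hk
        simp [pderiv_X_of_ne hk]
      · simp
    rw [this, pderiv_C]
  · rw [h v hv, linField, map_sum, snRatio_eq κ hv0]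
    simp only [map_mul, eval_C, eval_X, PiLp.smul_apply, smul_eq_mul]
    rw [EuclideanSpace.inner_eq_star_dotProduct]
    simp only [dotProduct, star_trivial, Finset.mul_sum]
    refine Finset.sum_congr rfl fun i _ => ?_
    ring

end

end BridgeKernel

end

open BridgeKernel MeasureTheory in
theorem propositionA3 (m : ℕ) (hm : 2 ≤ m) (T : ℝ) (hT : 0 < T) (hTE : T ≠ escobarThreshold m)
    (C c : ℝ) (p : EuclideanSpace ℝ (Fin (m + 1))) (hU : IsBridgeExtremal T C c p) :
    c ≠ 0 ∧
    (∃ (R : ℝ) (F : EuclideanSpace ℝ (Fin (m + 1)) → EuclideanSpace ℝ (Fin (m + 1))) (σ : ℝ),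
      IsReductionMap C c p R F ∧ BoundaryEquation (profile C c p) σ) ∧
    ∀ (R : ℝ) (F : EuclideanSpace ℝ (Fin (m + 1)) → EuclideanSpace ℝ (Fin (m + 1))) (σ β : ℝ),
      IsReductionMap C c p R F → BoundaryEquation (profile C c p) σ →
      β = -(twoSharp (m + 1) - 2) * σ →
      ∃ Φ : Fin (m + 1) → Lp ℝ 2 (modelVol (m + 1) (profileCurvature (m + 1) C c) R),
        (∀ j, Φ j =ᵐ[modelVol (m + 1) (profileCurvature (m + 1) C c) R]
          reducedField (profile C c p) F j) ∧
        {u : Lp ℝ 2 (modelVol (m + 1) (profileCurvature (m + 1) C c) R) |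
            ∃ φ ∈ robinKernel (m + 1) (profileCurvature (m + 1) C c) R β,
              φ.fn =ᵐ[modelVol (m + 1) (profileCurvature (m + 1) C c) R] u} =
          (Submodule.span ℝ (Set.range Φ) : Set _) ∧
        (∀ φ ∈ robinKernel (m + 1) (profileCurvature (m + 1) C c) R β,
          ∀ ψ, robinForm β φ ψ = 0) ∧
        LinearIndependent ℝ Φ ∧
        (∀ j, InSector 1 R (reducedField (profile C c p) F j)) := by
  have hc := hU.ne_zero hm hT hTE
  refine ⟨hc, ?_, fun R F σ β hF hσ hβ => ?_⟩
  · obtain ⟨R, F, hF⟩ := exists_isReductionMap hU.pos hc hU.regular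
    refine ⟨R, F, (((m + 1 : ℕ) : ℝ) - 2) * p 0 / C ^ (2 / (((m + 1 : ℕ) : ℝ) - 2)), hF, ?_⟩
    rw [boundaryEquation_iff hm hU.pos hU.regular]
    exact div_mul_cancel₀ _ (Real.rpow_pos_of_pos hU.pos _).ne'
  · have hκ0 := profileCurvature_ne_zero (m + 1) hU.pos hc
    have hβ' := hF.beta_mul_sn hm hU.pos hc hU.regular hσ hβ
    obtain ⟨a, hli, ha⟩ := hF.exists_reducedField_eq hm hU.pos hc hU.regular
    obtain ⟨j, rfl⟩ : ∃ j, m = j + 1 := ⟨m - 1, by omega⟩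
    -- There are n independent vectors in ℝⁿ, so the Jacobi fields exhaust the functions s_κ⟨ω, θ⟩
    -- by dimension count.
    have hspan : Submodule.span ℝ (Set.range a) = ⊤ :=
      hli.span_eq_top_of_card_eq_finrank' (by simp)
    refine ⟨fun i => linLp hF.radius_lt (a i), fun i => ?_, ?_, fun φ hφ ψ =>
      robinForm_eq_zero_of_mem_robinKernel hκ0 hF.radius_lt hF.radius_pos hφ ψ, ?_,
      fun i => inSector_one_of_eq_linField (a i) (ha i)⟩
    · filter_upwards [coeFn_linLp hF.radius_lt (a i), ae_modelVol_mem j _ R] with v hv hvR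
      rw [hv, ha i v hvR.1]
    · refine (setOf_robinKernel_eq_range hκ0 hF.radius_lt hF.radius_pos hβ').trans ?_
      rw [show (fun i => linLp hF.radius_lt (a i)) = linLp hF.radius_lt ∘ a from rfl,
        Set.range_comp, Submodule.span_image, hspan, Submodule.map_top]
      rfl
    · exact hli.map' _ (LinearMap.ker_eq_bot.2 (linLp_injective hF.radius_lt hF.radius_pos))
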